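/- **Setting.** A bounding class $\mathcal B$ is a set of non-decreasing functions $\mathbb R_{\ge 0}\to\mathbb R_{>0}$ that contains the constant function $1$ and such that every positive rational linear combination of elements of $\mathcal B$, and every composite $x\mapsto f(ax+b)$ with $f\in\mathcal B$ and rational $a,b\ge 0$, is bounded above by an element of $\mathcal B$. A length function on a discrete group $G$ is a map $L:G\to\mathbb R_{\ge 0}$ with $L(gh)\le L(g)+L(h)$ and $L(g^{-1})=L(g)$ (for instance a word-length function). For a weighted set $(S,w)$, $w:S\to\mathbb R_{\ge 0}$, let $H_{\mathcal B,w}(S)$ be the space of all $x:S\to\mathbb C$ with $|x|_f:=\sum_s|x(s)|f(w(s))<\infty$ for all $f\in\mathcal B$; a subset is bounded if every $|\cdot|_f$ is bounded on it. With convolution, $H:=H_{\mathcal B,L}(G)$ is a bornological algebra, with augmentation $\epsilon(x)=\sum_g x(g)$. A bornological $H$-module is a complete convex bornological complex vector space $V$ with an $H$-module structure whose action $H\times V\to V$ is bounded. The $\mathcal B$-bounded cohomology $\mathcal BH^*(G;V)=\mathrm{Ext}^*_H(\mathbb C,V)$ is the cohomology (cocycles modulo coboundaries) of the complex of bounded $n$-linear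 maps $c:H^n\to V$, $n\ge 0$ (the bounded $H$-homomorphisms on the bar resolution of $\mathbb C$ over $H$), with $$(\delta c)(x_0,\dots,x_n)=x_0\,c(x_1,\dots,x_n)+\sum_{j=0}^{n-1}(-1)^{j+1}c(\dots,x_jx_{j+1},\dots)+(-1)^{n+1}\epsilon(x_n)\,c(x_0,\dots,x_{n-1}),$$ and the comparison map $\mathcal BH^*(G;V)\to H^*(G;V)$ is restriction of cochains to $G\subset H$. A nice resolution of $\mathbb Z$ over $\mathbb Z[G]$ (for the given $L$) is a resolution $C_*$ with $C_n=\mathbb Z[G][T_n]$ for a finite weighted set $(T_n,w^T_n)$, with a proper weight function $w_n$ on $S_n=G\times T_n$ such that $C_{1,n}L(g)+w^T_n(t)\le w_n(gt)\le C_{2,n}L(g)+w^T_n(t)$ for constants $0<C_{1,n}\le C_{2,n}$, and with linearly bounded boundary maps. Let $\mathcal BD_n=H_{\mathcal B,w_n}(S_n)$ be the completion of $D_n=\mathbb C\otimes C_n$. $G$ is of type $\mathcal B FP^\infty$ if it is of type $FP^\infty$ and, for some nice resolution, the completed augmented complex $\mathcal BD_*\to\mathbb C$ has a bounded $\mathbb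 C$-linear chain contraction (in all degrees). **Theorem.** Let $G$ be a discrete group of type $FP^\infty$ with length function $L$, and let $\mathcal B$ be a bounding class. The following are equivalent. 1. $(G,L)$ is strongly $\mathcal B$-isocohomological: $\mathcal BH^n(G;V)\to H^n(G;V)$ is an isomorphism for all $n$ and all bornological $H_{\mathcal B,L}(G)$-modules $V$. 2. $\mathcal BH^n(G;V)\to H^n(G;V)$ is surjective for all $n$ and all bornological $H_{\mathcal B,L}(G)$-modules $V$. 3. $G$ is of type $\mathcal B FP^\infty$. Moreover, if $\mathcal B$ is multiplicative (products of two elements of $\mathcal B$ are bounded above by elements of $\mathcal B$) and equivalent to a countable bounding class $\mathcal B'$ (each element of either class is bounded above by an element of the other), then the same equivalence holds when $\mathcal BH^*(G;V)$ is computed from the subcomplex of those cochains in $\mathrm{Hom}_G(C_*(EG),V)$, $EG$ the homogeneous bar construction with weight $w(g_0,\dots,g_n)=L(g_0)+\sum_{i=1}^nL(g_{i-1}^{-1}g_i)$, which map subsets of $C_n(EG)$ that are bounded in all the seminorms $\sum_\sigma|\alpha_\sigma|f(w(\sigma))$, $f\in\mathcal B$, to bounded subsets of $V$, the comparison map being induced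 by inclusion. -/

import Mathlib

open scoped NNReal

universe u v

noncomputable section

/-! ### Bounding classes and length functions -/

/-- A bounding class: a set of non-decreasing functions from the non-negative to the positive
reals which contains the constant function `1`, is weakly closed under positive rational linear
combinations, and is weakly closed under composition on the right with the linear functions
`x ↦ a * x + b` (`a`, `b` non-negative rationals). -/
structure BoundingClass where
  carrier : Set (ℝ≥0 → ℝ)
  pos : ∀ f ∈ carrier, ∀ x, 0 < f x
  mono : ∀ f ∈ carrier, Monotone f
  one_mem : (fun _ => 1) ∈ carrier
  lin : ∀ f ∈ carrier, ∀ g ∈ carrier, ∀ a b : ℚ, 0 < a → 0 < b →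
    ∃ h ∈ carrier, ∀ x, (a : ℝ) * f x + (b : ℝ) * g x ≤ h x
  comp : ∀ f ∈ carrier, ∀ a b : ℚ≥0,
    ∃ h ∈ carrier, ∀ x : ℝ≥0, f ((a : ℝ≥0) * x + (b : ℝ≥0)) ≤ h x

namespace BoundingClass

/-- `B` is weakly closed under multiplication. -/
def Multiplicative (B : BoundingClass) : Prop :=
  ∀ f ∈ B.carrier, ∀ g ∈ B.carrier, ∃ h ∈ B.carrier, ∀ x, f x * g x ≤ h x

/-- Every function of `B` is bounded above by a function of `B'`. -/
def Le (B B' : BoundingClass) : Prop :=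
  ∀ f ∈ B.carrier, ∃ g ∈ B'.carrier, ∀ x, f x ≤ g x

/-- `B` is equivalent to a countable bounding class (so that the completions below are Frechet
spaces). -/
def IsFrechet (B : BoundingClass) : Prop :=
  ∃ B' : BoundingClass, B'.carrier.Countable ∧ B.Le B' ∧ B'.Le B

theorem exists_mul_add (B : BoundingClass) {f g : ℝ≥0 → ℝ} (hf : f ∈ B.carrier)
    (hg : g ∈ B.carrier) (a : ℝ) :
    ∃ h ∈ B.carrier, ∀ x, f x ≤ h x ∧ g x ≤ h x ∧ a * (f x + g x) ≤ h x := by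
  obtain ⟨q, hq⟩ := exists_rat_gt (max a 1)
  have hq1 : (1 : ℝ) < q := (le_max_right _ _).trans_lt hq
  have hqa : a < q := (le_max_left _ _).trans_lt hq
  have hq0 : 0 < q := by exact_mod_cast (zero_lt_one.trans hq1)
  obtain ⟨h, hh, hle⟩ := B.lin f hf g hg q q hq0 hq0
  refine ⟨h, hh, fun x => ?_⟩
  have h1 := B.pos f hf x
  have h2 := B.pos g hg x
  have h3 := hle x
  refine ⟨?_, ?_, ?_⟩ <;> nlinarith

theorem exists_dilate (B : BoundingClass) {f : ℝ≥0 → ℝ} (hf : f ∈ B.carrier) (a b : ℝ≥0) :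
    ∃ h ∈ B.carrier, ∀ x : ℝ≥0, f (a * x + b) ≤ h x := by
  obtain ⟨p, hp⟩ := exists_nat_gt a
  obtain ⟨q, hq⟩ := exists_nat_gt b
  obtain ⟨h, hh, hle⟩ := B.comp f hf (p : ℚ≥0) (q : ℚ≥0)
  refine ⟨h, hh, fun x => le_trans (B.mono f hf ?_) (hle x)⟩
  have h1 : a ≤ (((p : ℚ≥0) : ℝ≥0)) := by simpa using hp.le
  have h2 : b ≤ (((q : ℚ≥0) : ℝ≥0)) := by simpa using hq.le
  gcongr

end BoundingClass

/-- A length function on a group: non-negative, subadditive, invariant under inversion. -/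
structure LengthFunction (G : Type*) [Group G] where
  toFun : G → ℝ≥0
  mul_le : ∀ g h, toFun (g * h) ≤ toFun g + toFun h
  inv : ∀ g, toFun g⁻¹ = toFun g

instance {G : Type*} [Group G] : CoeFun (LengthFunction G) (fun _ => G → ℝ≥0) :=
  ⟨LengthFunction.toFun⟩

/-! ### Bornologies

A bounded set of a type with a `Bornology` is a set satisfying `Bornology.IsBounded`. -/

/-- A map is bounded if it maps bounded sets to bounded sets. For maps out of products the
product bornology is used. -/
def IsBoundedMap {X Y : Type*} [Bornology X] [Bornology Y] (f : X → Y) : Prop :=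
  ∀ s : Set X, Bornology.IsBounded s → Bornology.IsBounded (f '' s)

/-- Complete convex bornological vector spaces: every bounded set is contained in a bounded
completant disc, that is, in the injective bounded linear image of the closed unit ball of a
Banach space. -/
class CompleteBornological (V : Type v) [AddCommGroup V] [Module ℂ V] [Bornology V] : Prop where
  exists_disc : ∀ A : Set V, Bornology.IsBounded A →
    ∃ (E : Type v) (_ : NormedAddCommGroup E) (_ : NormedSpace ℂ E) (_ : CompleteSpace E)
      (i : E →ₗ[ℂ] V), Function.Injective i ∧
        (∀ r : ℝ, Bornology.IsBounded (i '' Metric.closedBall 0 r)) ∧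
        A ⊆ i '' Metric.closedBall 0 1

theorem CompleteBornological.isBounded_add {V : Type v} [AddCommGroup V] [Module ℂ V] [Bornology V]
    [CompleteBornological V] {A C : Set V} (hA : Bornology.IsBounded A)
    (hC : Bornology.IsBounded C) :
    Bornology.IsBounded {z : V | ∃ x ∈ A, ∃ y ∈ C, z = x + y} := by
  obtain ⟨E, _, _, _, i, -, hb, hsub⟩ :=
    CompleteBornological.exists_disc (A ∪ C) (hA.union hC)
  refine (hb 2).subset ?_
  rintro z ⟨x, hx, y, hy, rfl⟩
  obtain ⟨x', hx', rfl⟩ := hsub (Or.inl hx)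
  obtain ⟨y', hy', rfl⟩ := hsub (Or.inr hy)
  refine ⟨x' + y', ?_, map_add i x' y'⟩
  rw [mem_closedBall_zero_iff] at *
  linarith [norm_add_le x' y']

theorem CompleteBornological.isBounded_smul {V : Type v} [AddCommGroup V] [Module ℂ V]
    [Bornology V] [CompleteBornological V] (c : ℂ) {A : Set V} (hA : Bornology.IsBounded A) :
    Bornology.IsBounded {z : V | ∃ x ∈ A, z = c • x} := by
  obtain ⟨E, _, _, _, i, -, hb, hsub⟩ := CompleteBornological.exists_disc A hA
  refine (hb ‖c‖).subset ?_
  rintro z ⟨x, hx, rfl⟩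
  obtain ⟨x', hx', rfl⟩ := hsub hx
  refine ⟨c • x', ?_, map_smul i c x'⟩
  rw [mem_closedBall_zero_iff] at *
  rw [norm_smul]
  nlinarith [norm_nonneg c]

/-! ### Weighted completions -/

/-- The weighted `ℓ¹`-norm `∑ |x s| f (w s)`. -/
def wnorm {S : Type*} (w : S → ℝ≥0) (f : ℝ≥0 → ℝ) (x : S → ℂ) : ℝ :=
  ∑' s, ‖x s‖ * f (w s)

/-- The functions on the weighted set `(S, w)` all of whose weighted norms are finite. -/
def weightedL1 (B : BoundingClass) {S : Type*} (w : S → ℝ≥0) : Submodule ℂ (S → ℂ) where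
  carrier := {x | ∀ f ∈ B.carrier, Summable fun s => ‖x s‖ * f (w s)}
  zero_mem' := by intro f _; simp
  add_mem' := by
    intro x y hx hy f hf
    refine Summable.of_nonneg_of_le
      (fun s => mul_nonneg (norm_nonneg _) (B.pos f hf _).le) (fun s => ?_)
      ((hx f hf).add (hy f hf))
    rw [← add_mul]
    exact mul_le_mul_of_nonneg_right (norm_add_le _ _) (B.pos f hf _).le
  smul_mem' := by
    intro c x hx f hf
    have := (hx f hf).mul_left ‖c‖
    simpa [mul_assoc] using this

/-- The completion of `ℂ[S]` with respect to the seminorms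
`|x|_f = ∑ |x s| f (w s)`, `f ∈ B`. -/
def WL1 (B : BoundingClass) {S : Type u} (w : S → ℝ≥0) : Type u := weightedL1 B w

namespace WL1

variable {B : BoundingClass} {S : Type u} {w : S → ℝ≥0} {T : Type v} {w' : T → ℝ≥0}

instance : AddCommGroup (WL1 B w) := inferInstanceAs (AddCommGroup (weightedL1 B w))

instance : Module ℂ (WL1 B w) := inferInstanceAs (Module ℂ (weightedL1 B w))

/-- The coefficient function of an element of the completion. -/
def coeff (x : WL1 B w) : S → ℂ := Subtype.val (p := fun y => y ∈ weightedL1 B w) x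

instance : CoeFun (WL1 B w) (fun _ => S → ℂ) := ⟨coeff⟩

/-- The element of the completion with a given coefficient function. -/
def mk (x : S → ℂ) (hx : ∀ f ∈ B.carrier, Summable fun s => ‖x s‖ * f (w s)) : WL1 B w := ⟨x, hx⟩

@[simp] theorem mk_apply (x : S → ℂ) (hx : ∀ f ∈ B.carrier, Summable fun s => ‖x s‖ * f (w s))
    (s : S) : (mk x hx : WL1 B w) s = x s := rfl

@[ext] theorem ext {x y : WL1 B w} (h : ∀ s, x s = y s) : x = y := Subtype.ext (funext h)

@[simp] theorem add_apply (x y : WL1 B w) (s : S) : (x + y) s = x s + y s := rfl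

@[simp] theorem zero_apply (s : S) : (0 : WL1 B w) s = 0 := rfl

@[simp] theorem smul_apply (c : ℂ) (x : WL1 B w) (s : S) : (c • x) s = c * x s := rfl

theorem summable (x : WL1 B w) {f : ℝ≥0 → ℝ} (hf : f ∈ B.carrier) :
    Summable fun s => ‖x s‖ * f (w s) := x.2 f hf

theorem summable_norm (x : WL1 B w) : Summable fun s => ‖x s‖ := by
  simpa using x.summable B.one_mem

theorem term_nonneg {f : ℝ≥0 → ℝ} (hf : f ∈ B.carrier) (x : WL1 B w) (s : S) :
    0 ≤ ‖x s‖ * f (w s) := mul_nonneg (norm_nonneg _) (B.pos f hf _).le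

/-- The bornology of the completion: a set is bounded if each of the seminorms `|x|_f`, `f ∈ B`,
is bounded on it. -/
instance : Bornology (WL1 B w) :=
  Bornology.ofBounded
    {A | ∀ f ∈ B.carrier, ∃ M : ℝ, ∀ x ∈ A, wnorm w f x ≤ M}
    (fun f _ => ⟨0, by simp⟩)
    (fun A hA A' h f hf => by
      obtain ⟨M, hM⟩ := hA f hf
      exact ⟨M, fun x hx => hM x (h hx)⟩)
    (fun A hA A' hA' f hf => by
      obtain ⟨M, hM⟩ := hA f hf
      obtain ⟨M', hM'⟩ := hA' f hf
      exact ⟨max M M', fun x hx => hx.elim (fun h => (hM x h).trans (le_max_left _ _))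
        (fun h => (hM' x h).trans (le_max_right _ _))⟩)
    (fun x f _ => ⟨wnorm w f x, by simp⟩)

/-- A finitely supported function as an element of the completion. -/
def ofFinsupp (x : S →₀ ℂ) : WL1 B w :=
  mk x (fun f _ => summable_of_ne_finset_zero (s := x.support) (fun s hs => by
    simp [Finsupp.notMem_support_iff.mp hs]))

/-- The basis element of `s`. -/
def delta (s : S) : WL1 B w := ofFinsupp (Finsupp.single s 1)

@[simp] theorem ofFinsupp_apply (x : S →₀ ℂ) (s : S) : (ofFinsupp x : WL1 B w) s = x s := rfl

theorem summable_kernel (c : S → WL1 B w')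
    (hc : ∀ f ∈ B.carrier, ∃ h ∈ B.carrier, ∀ s, wnorm w' f (c s) ≤ h (w s))
    (x : WL1 B w) {f : ℝ≥0 → ℝ} (hf : f ∈ B.carrier) :
    Summable fun p : S × T => ‖x p.1‖ * (‖c p.1 p.2‖ * f (w' p.2)) := by
  obtain ⟨h, hh, hle⟩ := hc f hf
  have h0 : ∀ s t, 0 ≤ ‖x s‖ * (‖c s t‖ * f (w' t)) := fun s t =>
    mul_nonneg (norm_nonneg _) ((c s).term_nonneg hf t)
  refine (summable_prod_of_nonneg (fun p => h0 p.1 p.2)).2 ⟨fun s => ?_, ?_⟩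
  · have h1 : Summable fun t => ‖c s t‖ * f (w' t) := (c s).summable hf
    exact h1.mul_left ‖x s‖
  · have h1 : ∀ s, ∑' t, ‖x s‖ * (‖c s t‖ * f (w' t)) ≤ ‖x s‖ * h (w s) := fun s => by
      rw [tsum_mul_left]
      exact mul_le_mul_of_nonneg_left (hle s) (norm_nonneg _)
    exact Summable.of_nonneg_of_le (fun s => tsum_nonneg (h0 s)) h1 (x.summable hh)

theorem summable_kernel_apply (c : S → WL1 B w')
    (hc : ∀ f ∈ B.carrier, ∃ h ∈ B.carrier, ∀ s, wnorm w' f (c s) ≤ h (w s))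
    (x : WL1 B w) (t : T) : Summable fun s => ‖x s * c s t‖ := by
  have h := (summable_kernel c hc x B.one_mem).prod_symm.prod_factor t
  simpa using h

/-- The linear map which sends the basis element of `s` to `c s` and commutes with the infinite
sums that occur. -/
def lift (c : S → WL1 B w')
    (hc : ∀ f ∈ B.carrier, ∃ h ∈ B.carrier, ∀ s, wnorm w' f (c s) ≤ h (w s)) :
    WL1 B w →ₗ[ℂ] WL1 B w' where
  toFun x := mk (fun t => ∑' s, x s * c s t) (fun f hf => by
    have h := (summable_kernel c hc x hf).prod_symm
    refine Summable.of_nonneg_of_le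
      (fun t => mul_nonneg (norm_nonneg _) (B.pos f hf _).le) (fun t => ?_) h.prod
    have h1 := norm_tsum_le_tsum_norm (summable_kernel_apply c hc x t)
    calc ‖∑' s, x s * c s t‖ * f (w' t) ≤ (∑' s, ‖x s * c s t‖) * f (w' t) :=
          mul_le_mul_of_nonneg_right h1 (B.pos f hf _).le
      _ = ∑' s, ‖x s‖ * (‖c s t‖ * f (w' t)) := by
          rw [← tsum_mul_right]
          simp only [norm_mul, mul_assoc])
  map_add' x y := by
    ext t
    simp only [mk_apply, add_apply, add_mul]
    exact (summable_kernel_apply c hc x t).of_norm.tsum_add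
      (summable_kernel_apply c hc y t).of_norm
  map_smul' a x := by
    ext t
    simp only [mk_apply, smul_apply, mul_assoc, RingHom.id_apply]
    exact tsum_mul_left

theorem lift_apply (c : S → WL1 B w')
    (hc : ∀ f ∈ B.carrier, ∃ h ∈ B.carrier, ∀ s, wnorm w' f (c s) ≤ h (w s))
    (x : WL1 B w) (t : T) : lift c hc x t = ∑' s, x s * c s t := rfl

theorem wnorm_lift_le (c : S → WL1 B w')
    (hc : ∀ f ∈ B.carrier, ∃ h ∈ B.carrier, ∀ s, wnorm w' f (c s) ≤ h (w s))
    (x : WL1 B w) {f h : ℝ≥0 → ℝ} (hf : f ∈ B.carrier) (hh : h ∈ B.carrier)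
    (hle : ∀ s, wnorm w' f (c s) ≤ h (w s)) : wnorm w' f (lift c hc x) ≤ wnorm w h x := by
  have h1 := (summable_kernel c hc x hf).prod_symm
  have h2 : ∀ t, ‖lift c hc x t‖ * f (w' t) ≤ ∑' s, ‖x s‖ * (‖c s t‖ * f (w' t)) := fun t => by
    calc ‖lift c hc x t‖ * f (w' t) ≤ (∑' s, ‖x s * c s t‖) * f (w' t) :=
          mul_le_mul_of_nonneg_right (norm_tsum_le_tsum_norm (summable_kernel_apply c hc x t))
            (B.pos f hf _).le
      _ = ∑' s, ‖x s‖ * (‖c s t‖ * f (w' t)) := by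
          rw [← tsum_mul_right]
          simp only [norm_mul, mul_assoc]
  calc wnorm w' f (lift c hc x) ≤ ∑' t, ∑' s, ‖x s‖ * (‖c s t‖ * f (w' t)) :=
        ((lift c hc x).summable hf).tsum_le_tsum h2 h1.prod
    _ = ∑' s, ∑' t, ‖x s‖ * (‖c s t‖ * f (w' t)) :=
        Summable.tsum_comm (f := fun s t => ‖x s‖ * (‖c s t‖ * f (w' t)))
          (summable_kernel c hc x hf)
    _ ≤ wnorm w h x := by
        have h3 : ∀ s, ∑' t, ‖x s‖ * (‖c s t‖ * f (w' t)) ≤ ‖x s‖ * h (w s) := fun s => by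
          rw [tsum_mul_left]
          exact mul_le_mul_of_nonneg_left (hle s) (norm_nonneg _)
        exact (summable_kernel c hc x hf).prod.tsum_le_tsum h3 (x.summable hh)

theorem lift_lift {U : Type*} {w'' : U → ℝ≥0} (c : T → WL1 B w'')
    (hc : ∀ f ∈ B.carrier, ∃ h ∈ B.carrier, ∀ t, wnorm w'' f (c t) ≤ h (w' t))
    (c' : S → WL1 B w')
    (hc' : ∀ f ∈ B.carrier, ∃ h ∈ B.carrier, ∀ s, wnorm w' f (c' s) ≤ h (w s))
    (x : WL1 B w) (u : U) :
    lift c hc (lift c' hc' x) u = ∑' s, x s * lift c hc (c' s) u := by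
  obtain ⟨h, hh, hle⟩ := hc _ B.one_mem
  have hcu : ∀ t, ‖c t u‖ ≤ h (w' t) := fun t => by
    refine le_trans ?_ (hle t)
    have h1 := (c t).summable_norm.le_tsum u (fun _ _ => norm_nonneg _)
    simpa [wnorm] using h1
  have hs : Summable (fun p : S × T => x p.1 * c' p.1 p.2 * c p.2 u) := by
    refine Summable.of_norm_bounded (summable_kernel c' hc' x hh) (fun p => ?_)
    rw [norm_mul, norm_mul, mul_assoc]
    exact mul_le_mul_of_nonneg_left
      (mul_le_mul_of_nonneg_left (hcu p.2) (norm_nonneg _)) (norm_nonneg _)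
  calc lift c hc (lift c' hc' x) u = ∑' t, ∑' s, x s * c' s t * c t u := by
        simp only [lift_apply, tsum_mul_right]
    _ = ∑' s, ∑' t, x s * c' s t * c t u :=
        Summable.tsum_comm (f := fun s t => x s * c' s t * c t u) hs
    _ = ∑' s, x s * lift c hc (c' s) u := by
        simp only [lift_apply, mul_assoc, tsum_mul_left]

@[simp] theorem delta_apply_self (s : S) : (delta s : WL1 B w) s = 1 := by
  simp [delta]

theorem delta_apply_ne {s t : S} (h : t ≠ s) : (delta s : WL1 B w) t = 0 := by
  simp [delta, Ne.symm h]

theorem lift_delta (c : S → WL1 B w')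
    (hc : ∀ f ∈ B.carrier, ∃ h ∈ B.carrier, ∀ s, wnorm w' f (c s) ≤ h (w s)) (s : S) :
    lift c hc (delta s) = c s := by
  ext t
  rw [lift_apply, tsum_eq_single s (fun s' hs' => by rw [delta_apply_ne hs', zero_mul]),
    delta_apply_self, one_mul]

end WL1

/-! ### The completed group algebra -/

/-- The completion of the group algebra `ℂ[G]` in the seminorms `∑ |x g| f (L g)`, `f ∈ B`. -/
abbrev HAlg (B : BoundingClass) {G : Type u} [Group G] (L : LengthFunction G) : Type u :=
  WL1 B L.toFun

namespace HAlg

variable {B : BoundingClass} {G : Type u} [Group G] {L : LengthFunction G}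

theorem summable_translate (g : G) (x : HAlg B L) {f : ℝ≥0 → ℝ} (hf : f ∈ B.carrier) :
    Summable fun k => ‖x k‖ * f (L (g * k)) := by
  obtain ⟨h, hh, hle⟩ := B.exists_dilate hf 1 (L g)
  refine Summable.of_nonneg_of_le
    (fun k => mul_nonneg (norm_nonneg _) (B.pos f hf _).le) (fun k => ?_) (x.summable hh)
  refine mul_le_mul_of_nonneg_left (le_trans (B.mono f hf ?_) (hle _)) (norm_nonneg _)
  rw [one_mul, add_comm]
  exact L.mul_le g k

/-- Left translation by a group element. -/
def translate (g : G) (x : HAlg B L) : HAlg B L :=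
  WL1.mk (fun h => x (g⁻¹ * h)) (fun f hf => by
    rw [← (Equiv.mulLeft g).summable_iff]
    refine (summable_translate g x hf).congr (fun k => ?_)
    simp)

@[simp] theorem translate_apply (g : G) (x : HAlg B L) (h : G) :
    translate g x h = x (g⁻¹ * h) := rfl

theorem translate_bound (x : HAlg B L) :
    ∀ f ∈ B.carrier, ∃ h ∈ B.carrier, ∀ g : G, wnorm L f (translate g x) ≤ h (L g) := by
  intro f hf
  obtain ⟨f2, hf2, hle2⟩ := B.exists_dilate hf 2 0
  obtain ⟨h, hh, hle⟩ := B.exists_mul_add hf2 B.one_mem (max (wnorm L (fun _ => 1) x) (wnorm L f2 x))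
  refine ⟨h, hh, fun g => le_trans ?_ (hle (L g)).2.2⟩
  have e1 : wnorm L f (translate g x) = ∑' k, ‖x k‖ * f (L (g * k)) := by
    rw [wnorm, ← (Equiv.mulLeft g).tsum_eq]
    simp
  have s1 : Summable fun k => ‖x k‖ * (1 : ℝ) * f2 (L g) :=
    (x.summable B.one_mem).mul_right _
  have s2 : Summable fun k => ‖x k‖ * f2 (L k) := x.summable hf2
  have key : ∀ k, ‖x k‖ * f (L (g * k)) ≤ ‖x k‖ * 1 * f2 (L g) + ‖x k‖ * f2 (L k) := fun k => by
    have h1 : f (L (g * k)) ≤ f2 (L g) + f2 (L k) := by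
      have p1 := B.pos f2 hf2 (L g)
      have p2 := B.pos f2 hf2 (L k)
      rcases le_total (L g) (L k) with hgk | hgk
      · have h2 : f (L (g * k)) ≤ f2 (L k) := by
          refine le_trans (B.mono f hf ?_) (hle2 (L k))
          calc L (g * k) ≤ L g + L k := L.mul_le g k
            _ ≤ L k + L k := by gcongr
            _ = 2 * L k + 0 := by ring
        linarith
      · have h2 : f (L (g * k)) ≤ f2 (L g) := by
          refine le_trans (B.mono f hf ?_) (hle2 (L g))
          calc L (g * k) ≤ L g + L k := L.mul_le g k
            _ ≤ L g + L g := by gcongr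
            _ = 2 * L g + 0 := by ring
        linarith
    calc ‖x k‖ * f (L (g * k)) ≤ ‖x k‖ * (f2 (L g) + f2 (L k)) :=
          mul_le_mul_of_nonneg_left h1 (norm_nonneg _)
      _ = _ := by ring
  calc wnorm L f (translate g x) ≤ ∑' k, (‖x k‖ * 1 * f2 (L g) + ‖x k‖ * f2 (L k)) := by
        rw [e1]
        exact (summable_translate g x hf).tsum_le_tsum key (s1.add s2)
    _ = wnorm L (fun _ => 1) x * f2 (L g) + wnorm L f2 x * 1 := by
        rw [s1.tsum_add s2, tsum_mul_right, mul_one, wnorm, wnorm]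
    _ ≤ _ := by
        rw [mul_add]
        exact add_le_add
          (mul_le_mul_of_nonneg_right (le_max_left _ _) (B.pos f2 hf2 _).le)
          (mul_le_mul_of_nonneg_right (le_max_right _ _) zero_le_one)

/-- Convolution `(x * y) h = ∑ x g * y (g⁻¹ * h)`. -/
instance : Mul (HAlg B L) :=
  ⟨fun x y => WL1.lift (fun g => translate g y) (translate_bound y) x⟩

theorem mul_def (x y : HAlg B L) :
    x * y = WL1.lift (fun g => translate g y) (translate_bound y) x := rfl

theorem mul_apply (x y : HAlg B L) (h : G) : (x * y) h = ∑' g, x g * y (g⁻¹ * h) := rfl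

instance : One (HAlg B L) := ⟨WL1.delta 1⟩

theorem one_def : (1 : HAlg B L) = WL1.delta 1 := rfl

theorem delta_mul (g : G) (x : HAlg B L) : (WL1.delta g : HAlg B L) * x = translate g x := by
  rw [mul_def, WL1.lift_delta]

theorem translate_mul (g : G) (x y : HAlg B L) : translate g (x * y) = translate g x * y := by
  ext h
  rw [translate_apply, mul_apply, mul_apply,
    ← (Equiv.mulLeft g).tsum_eq (fun k => translate g x k * y (k⁻¹ * h))]
  simp [mul_assoc]

theorem mul_one' (x : HAlg B L) : x * 1 = x := by
  ext h
  rw [mul_apply, tsum_eq_single h]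
  · simp [one_def]
  · intro g hg
    rw [one_def, WL1.delta_apply_ne, mul_zero]
    intro h1
    exact hg (inv_mul_eq_one.mp h1)

theorem mul_assoc' (x y z : HAlg B L) : x * y * z = x * (y * z) := by
  ext h
  rw [mul_def (x * y) z, mul_def x y, WL1.lift_lift, mul_def x (y * z), WL1.lift_apply]
  refine tsum_congr fun g => ?_
  rw [translate_mul]
  rfl

instance : Ring (HAlg B L) :=
  { (inferInstance : AddCommGroup (HAlg B L)) with
    mul := (· * ·)
    one := 1
    left_distrib := fun x y z => by
      ext h
      have e : ∀ g, x g * (y + z) (g⁻¹ * h) = x g * y (g⁻¹ * h) + x g * z (g⁻¹ * h) :=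
        fun g => mul_add _ _ _
      rw [WL1.add_apply, mul_apply, mul_apply, mul_apply, tsum_congr e]
      exact (WL1.summable_kernel_apply _ (translate_bound y) x h).of_norm.tsum_add
        (WL1.summable_kernel_apply _ (translate_bound z) x h).of_norm
    right_distrib := fun x y z => map_add (WL1.lift _ (translate_bound z)) x y
    zero_mul := fun x => map_zero (WL1.lift _ (translate_bound x))
    mul_zero := fun x => by
      ext h
      simp [mul_apply]
    mul_assoc := mul_assoc'
    one_mul := fun x => by
      rw [one_def, delta_mul]
      ext h
      simp
    mul_one := mul_one' }

instance : Algebra ℂ (HAlg B L) :=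
  Algebra.ofModule
    (fun c x y => map_smul (WL1.lift _ (translate_bound y)) c x)
    (fun c x y => by
      ext h
      simp only [mul_apply, WL1.smul_apply]
      rw [← tsum_mul_left]
      refine tsum_congr fun g => ?_
      ring)

/-- The inclusion of the group into the completed group algebra. -/
def of : G →* HAlg B L where
  toFun g := WL1.delta g
  map_one' := rfl
  map_mul' g h := by
    rw [delta_mul]
    ext k
    rw [translate_apply]
    by_cases hk : k = g * h
    · simp [hk]
    · rw [WL1.delta_apply_ne hk, WL1.delta_apply_ne]
      intro h1
      exact hk (by rw [← h1, mul_inv_cancel_left])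

/-- The augmentation `x ↦ ∑ x g`. -/
def aug (x : HAlg B L) : ℂ := ∑' g, x g

theorem aug_of (g : G) : aug (of g : HAlg B L) = 1 := by
  have h : ∀ k, k ≠ g → (of g : HAlg B L) k = 0 := fun k hk => WL1.delta_apply_ne hk
  rw [aug, tsum_eq_single g h]
  exact WL1.delta_apply_self g

end HAlg

/-- `V` is a (complete, convex) bornological module over the bornological algebra `A`: the scalars
act compatibly and the action `A × V → V` is bounded. -/
class BornologicalModule (A : Type u) [Ring A] [Algebra ℂ A] [Bornology A] (V : Type v)
    [AddCommGroup V] [Module ℂ V] [Bornology V] [Module A V] : Prop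
    extends CompleteBornological V, IsScalarTower ℂ A V where
  isBoundedMap_smul : IsBoundedMap (fun p : A × V => p.1 • p.2)

/-! ### Cohomology and comparison maps -/

section Cohomology

variable {M N V : Type*} [Mul M] [Mul N] [AddCommGroup V] [Module ℂ V]

/-- The differential of inhomogeneous cochains, for an action `ρ` of `M` on `V` from the left and
an action from the right through an augmentation `ε`:
`(d f)(m₀, …, mₙ) = m₀ f(m₁, …, mₙ) + ∑ (-1)^(j+1) f(…, mⱼ mⱼ₊₁, …)
  + (-1)^(n+1) ε(mₙ) f(m₀, …, mₙ₋₁)`. -/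
def barD (ρ : M → V →ₗ[ℂ] V) (ε : M → ℂ) (n : ℕ) :
    ((Fin n → M) → V) →ₗ[ℂ] ((Fin (n + 1) → M) → V) where
  toFun f m := ρ (m 0) (f fun i => m i.succ) +
    ∑ j : Fin n, (-1 : ℂ) ^ ((j : ℕ) + 1) • f (Fin.contractNth j.castSucc (· * ·) m) +
    ((-1 : ℂ) ^ (n + 1) * ε (m (Fin.last n))) • f fun i => m i.castSucc
  map_add' f g := by
    ext m
    simp only [Pi.add_apply, map_add, smul_add, Finset.sum_add_distrib]
    abel
  map_smul' c f := by
    ext m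
    simp only [Pi.smul_apply, map_smul, smul_add, RingHom.id_apply, Finset.smul_sum,
      smul_comm c]

/-- The cocycles among the cochains in `C`. -/
def cocycles (ρ : M → V →ₗ[ℂ] V) (ε : M → ℂ) (C : ∀ n, Submodule ℂ ((Fin n → M) → V)) (n : ℕ) :
    Submodule ℂ ((Fin n → M) → V) :=
  C n ⊓ LinearMap.ker (barD ρ ε n)

/-- The coboundaries of the cochains in `C`. -/
def coboundaries (ρ : M → V →ₗ[ℂ] V) (ε : M → ℂ) (C : ∀ n, Submodule ℂ ((Fin n → M) → V)) :
    ∀ n, Submodule ℂ ((Fin n → M) → V)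
  | 0 => ⊥
  | n + 1 => (C n).map (barD ρ ε n)

/-- The `n`-th cohomology of the cochain complex `C`, cocycles modulo coboundaries (no closures
are taken). -/
abbrev Cohomology (ρ : M → V →ₗ[ℂ] V) (ε : M → ℂ) (C : ∀ n, Submodule ℂ ((Fin n → M) → V))
    (n : ℕ) : Type _ :=
  cocycles ρ ε C n ⧸ (coboundaries ρ ε C n).submoduleOf (cocycles ρ ε C n)

/-- Restriction of cochains along a map. -/
def restrict (θ : N → M) (n : ℕ) : ((Fin n → M) → V) →ₗ[ℂ] ((Fin n → N) → V) where
  toFun f m := f fun i => θ (m i)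
  map_add' _ _ := rfl
  map_smul' _ _ := rfl

theorem contractNth_comp (θ : N → M) (hθ : ∀ a b, θ (a * b) = θ a * θ b) {n : ℕ}
    (j : Fin (n + 1)) (m : Fin (n + 1) → N) :
    (fun i => θ (Fin.contractNth j (· * ·) m i)) =
      Fin.contractNth j (· * ·) (fun i => θ (m i)) := by
  funext i
  simp only [Fin.contractNth]
  split_ifs <;> simp [hθ]

variable {ρ : M → V →ₗ[ℂ] V} {ε : M → ℂ} {ρ' : N → V →ₗ[ℂ] V} {ε' : N → ℂ}

theorem barD_restrict (θ : N → M) (hmul : ∀ a b, θ (a * b) = θ a * θ b)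
    (hρ : ∀ a, ρ (θ a) = ρ' a) (hε : ∀ a, ε (θ a) = ε' a) (n : ℕ) (f : (Fin n → M) → V) :
    barD ρ' ε' n (restrict θ n f) = restrict θ (n + 1) (barD ρ ε n f) := by
  funext m
  simp [barD, restrict, contractNth_comp θ hmul, hρ, hε]

/-- The map on cohomology induced by the restriction of the cochains in `C` along `θ` to arbitrary
cochains. -/
def comparison (θ : N → M) (hmul : ∀ a b, θ (a * b) = θ a * θ b)
    (hρ : ∀ a, ρ (θ a) = ρ' a) (hε : ∀ a, ε (θ a) = ε' a)
    (C : ∀ n, Submodule ℂ ((Fin n → M) → V)) (n : ℕ) :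
    Cohomology ρ ε C n →ₗ[ℂ] Cohomology ρ' ε' (fun _ => ⊤) n :=
  Submodule.mapQ _ _
    ((restrict θ n).restrict (p := cocycles ρ ε C n) (q := cocycles ρ' ε' (fun _ => ⊤) n)
      (fun f hf => by
        refine ⟨trivial, ?_⟩
        have h1 : barD ρ ε n f = 0 := hf.2
        have h2 : barD ρ' ε' n (restrict θ n f) = 0 := by
          rw [barD_restrict θ hmul hρ hε, h1, map_zero]
        exact h2))
    (by
      rintro ⟨f, hf⟩ hfb
      have hfb' : f ∈ coboundaries ρ ε C n := hfb
      have goal : restrict θ n f ∈ coboundaries ρ' ε' (fun _ => ⊤) n := by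
        cases n with
        | zero =>
          have h0 : f = 0 := hfb'
          rw [h0, map_zero]
          exact Submodule.zero_mem _
        | succ n =>
          obtain ⟨b, -, rfl⟩ := hfb'
          exact ⟨restrict θ n b, trivial, barD_restrict θ hmul hρ hε n b⟩
      exact goal)

end Cohomology

section BCohomology

variable (B : BoundingClass) {G : Type u} [Group G] (L : LengthFunction G)
variable (V : Type v) [AddCommGroup V] [Module ℂ V] [Bornology V] [Module (HAlg B L) V]
  [BornologicalModule (HAlg B L) V]

/-- The action of the completed group algebra on `V` by linear maps. -/
def actH (x : HAlg B L) : V →ₗ[ℂ] V := Algebra.lsmul ℂ ℂ V x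

/-- The action of the group on `V`. -/
def actG (g : G) : V →ₗ[ℂ] V := actH B L V (HAlg.of g)

/-- Group cohomology `Hⁿ(G; V)`, by inhomogeneous cochains. -/
abbrev GroupCoh (n : ℕ) : Type (max u v) :=
  Cohomology (actG B L V) (fun _ : G => (1 : ℂ)) (fun _ => ⊤) n

/-- Bounded `n`-cochains with values in `V`: the bounded `n`-linear maps from the completed group
algebra `H` to `V`, that is, the bounded `H`-module homomorphisms to `V` from the `n`-th term
`H ⊗ ⋯ ⊗ H` (`n + 1` completed tensor factors) of the bar resolution of `ℂ` over `H`. -/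
def boundedCochains (n : ℕ) : Submodule ℂ ((Fin n → HAlg B L) → V) where
  carrier := {f | (∃ m : MultilinearMap ℂ (fun _ : Fin n => HAlg B L) V, ⇑m = f) ∧ IsBoundedMap f}
  zero_mem' := ⟨⟨0, rfl⟩, fun s _ => by
    refine (Bornology.isBounded_singleton (x := (0 : V))).subset ?_
    rintro _ ⟨x, -, rfl⟩
    rfl⟩
  add_mem' := by
    rintro _ _ ⟨⟨m, rfl⟩, hm⟩ ⟨⟨m', rfl⟩, hm'⟩
    refine ⟨⟨m + m', rfl⟩, fun s hs => ?_⟩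
    refine (CompleteBornological.isBounded_add (hm s hs) (hm' s hs)).subset ?_
    rintro _ ⟨x, hx, rfl⟩
    exact ⟨_, ⟨x, hx, rfl⟩, _, ⟨x, hx, rfl⟩, rfl⟩
  smul_mem' := by
    rintro c _ ⟨⟨m, rfl⟩, hm⟩
    refine ⟨⟨c • m, rfl⟩, fun s hs => ?_⟩
    refine (CompleteBornological.isBounded_smul c (hm s hs)).subset ?_
    rintro _ ⟨x, hx, rfl⟩
    exact ⟨_, ⟨x, hx, rfl⟩, rfl⟩

/-- The `B`-bounded cohomology `BHⁿ(G; V) = Extⁿ_H(ℂ, V)`, `H` the completed group algebra. -/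
abbrev BCoh (n : ℕ) : Type (max u v) :=
  Cohomology (actH B L V) HAlg.aug (boundedCochains B L V) n

/-- The comparison map `BHⁿ(G; V) → Hⁿ(G; V)`, restriction of cochains to the group. -/
def comparisonMap (n : ℕ) : BCoh B L V n →ₗ[ℂ] GroupCoh B L V n :=
  comparison (fun g : G => (HAlg.of g : HAlg B L)) (map_mul _) (fun _ => rfl) HAlg.aug_of
    (boundedCochains B L V) n

/-- The weight on the basis `g [h₁ | ⋯ | hₙ] = (g, g h₁, …, g h₁ ⋯ hₙ)` of the `n`-chains of the
bar construction `EG`: `L g + ∑ L hᵢ`. -/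
def weightEG (n : ℕ) (s : G × (Fin n → G)) : ℝ≥0 := L s.1 + ∑ i, L (s.2 i)

/-- The value of an equivariant cochain of `EG`, given by its values `f` on the basis elements
`1 [h₁ | ⋯ | hₙ]`, on a chain. -/
def evalEG (n : ℕ) (f : (Fin n → G) → V) (x : (G × (Fin n → G)) →₀ ℂ) : V :=
  x.sum fun s c => c • actG B L V s.1 (f s.2)

/-- Equivariant cochains of `EG` which are bounded for the bornology on chains given by the
weighted seminorms `∑ |x s| f (w s)`, `f ∈ B`. -/
def weightedCochains (n : ℕ) : Submodule ℂ ((Fin n → G) → V) where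
  carrier := {f | ∀ K : Set ((G × (Fin n → G)) →₀ ℂ),
    (∀ h ∈ B.carrier, ∃ R : ℝ, ∀ x ∈ K, wnorm (weightEG L n) h x ≤ R) →
      Bornology.IsBounded (evalEG B L V n f '' K)}
  zero_mem' := by
    intro K _
    refine (Bornology.isBounded_singleton (x := (0 : V))).subset ?_
    rintro _ ⟨x, -, rfl⟩
    simp [evalEG]
  add_mem' := by
    intro f f' hf hf' K hK
    refine (CompleteBornological.isBounded_add (hf K hK) (hf' K hK)).subset ?_
    rintro _ ⟨x, hx, rfl⟩
    refine ⟨_, ⟨x, hx, rfl⟩, _, ⟨x, hx, rfl⟩, ?_⟩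
    simp [evalEG, Finsupp.sum, Finset.sum_add_distrib]
  smul_mem' := by
    intro c f hf K hK
    refine (CompleteBornological.isBounded_smul c (hf K hK)).subset ?_
    rintro _ ⟨x, hx, rfl⟩
    refine ⟨_, ⟨x, hx, rfl⟩, ?_⟩
    simp [evalEG, Finsupp.sum, Finset.smul_sum, smul_comm c]

/-- The cohomology of the complex of weighted bounded cochains of `EG`. -/
abbrev WeightedBCoh (n : ℕ) : Type (max u v) :=
  Cohomology (actG B L V) (fun _ : G => (1 : ℂ)) (weightedCochains B L V) n

/-- The map induced by the inclusion of the weighted bounded cochains into all cochains. -/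
def weightedComparisonMap (n : ℕ) : WeightedBCoh B L V n →ₗ[ℂ] GroupCoh B L V n :=
  comparison (fun g : G => g) (fun _ _ => rfl) (fun _ => rfl) (fun _ => rfl)
    (weightedCochains B L V) n

end BCohomology

section Conditions

variable (B : BoundingClass) {G : Type u} [Group G] (L : LengthFunction G)

/-- `(G, L)` is strongly `B`-isocohomological: the comparison map is an isomorphism in all degrees
for all bornological modules over the completed group algebra. -/
def StronglyIsocohomological : Prop :=
  ∀ (V : Type (max u v)) [AddCommGroup V] [Module ℂ V] [Bornology V] [Module (HAlg B L) V]
    [BornologicalModule (HAlg B L) V] (n : ℕ), Function.Bijective (comparisonMap B L V n)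

/-- The comparison map is surjective in all degrees for all bornological modules. -/
def ComparisonSurjective : Prop :=
  ∀ (V : Type (max u v)) [AddCommGroup V] [Module ℂ V] [Bornology V] [Module (HAlg B L) V]
    [BornologicalModule (HAlg B L) V] (n : ℕ), Function.Surjective (comparisonMap B L V n)

/-- As `StronglyIsocohomological`, with the weighted bounded cochains of `EG`. -/
def WeightedStronglyIsocohomological : Prop :=
  ∀ (V : Type (max u v)) [AddCommGroup V] [Module ℂ V] [Bornology V] [Module (HAlg B L) V]
    [BornologicalModule (HAlg B L) V] (n : ℕ), Function.Bijective (weightedComparisonMap B L V n)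

/-- As `ComparisonSurjective`, with the weighted bounded cochains of `EG`. -/
def WeightedComparisonSurjective : Prop :=
  ∀ (V : Type (max u v)) [AddCommGroup V] [Module ℂ V] [Bornology V] [Module (HAlg B L) V]
    [BornologicalModule (HAlg B L) V] (n : ℕ), Function.Surjective (weightedComparisonMap B L V n)

end Conditions

/-! ### Finiteness conditions -/

/-- `G` is of type `FP^∞`: the trivial module `ℤ` has a resolution over `ℤ[G]` by finitely
generated projective modules. -/
def TypeFPInfty (G : Type u) [Group G] : Prop :=
  ∃ (P : ℕ → ModuleCat.{u} (MonoidAlgebra ℤ G))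
    (d : ∀ n, P (n + 1) →ₗ[MonoidAlgebra ℤ G] P n) (ε : P 0 →+ ℤ),
    (∀ n, Module.Finite (MonoidAlgebra ℤ G) (P n) ∧ Module.Projective (MonoidAlgebra ℤ G) (P n)) ∧
    (∀ (g : G) (x : P 0), ε (MonoidAlgebra.of ℤ G g • x) = ε x) ∧
    Function.Surjective ε ∧
    (∀ x, ε x = 0 ↔ ∃ y, d 0 y = x) ∧
    (∀ n x, d n x = 0 ↔ ∃ y, d (n + 1) y = x)

/-- The action of a group element on the free module with basis `T`, whose elements are finitely
supported functions on `G × T`. -/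
def shift {G T : Type*} [Group G] (g : G) (x : (G × T) →₀ ℤ) : (G × T) →₀ ℤ :=
  x.mapDomain fun s => (g * s.1, s.2)

/-- A nice resolution of `ℤ` over `ℤ[G]`: in each degree `n` the free module on a finite weighted
set `T n = Fin (rank n)`, with a proper weight function `w n` on the orbit `G × T n` of `T n` which
is comparable to the length function, and with linearly bounded boundary maps. -/
structure NiceResolution {G : Type u} [Group G] (L : LengthFunction G) where
  rank : ℕ → ℕ
  d : ∀ n, ((G × Fin (rank (n + 1))) →₀ ℤ) →ₗ[ℤ] ((G × Fin (rank n)) →₀ ℤ)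
  ε : ((G × Fin (rank 0)) →₀ ℤ) →ₗ[ℤ] ℤ
  d_shift : ∀ n g x, d n (shift g x) = shift g (d n x)
  ε_shift : ∀ g x, ε (shift g x) = ε x
  ε_surjective : Function.Surjective ε
  exact_zero : ∀ x, ε x = 0 ↔ ∃ y, d 0 y = x
  exact_succ : ∀ n x, d n x = 0 ↔ ∃ y, d (n + 1) y = x
  wT : ∀ n, Fin (rank n) → ℝ≥0
  w : ∀ n, G × Fin (rank n) → ℝ≥0
  proper : ∀ n (R : ℝ≥0), {s | w n s ≤ R}.Finite
  comparable : ∀ n, ∃ C₁ C₂ : ℝ≥0, 0 < C₁ ∧ C₁ ≤ C₂ ∧ ∀ g t,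
    C₁ * L g + wT n t ≤ w n (g, t) ∧ w n (g, t) ≤ C₂ * L g + wT n t
  linearlyBounded : ∀ n, ∃ a b : ℝ≥0, ∀ s,
    ((d n (Finsupp.single s 1)).sum fun t c => (c.natAbs : ℝ≥0) * w n t) ≤ a * w (n + 1) s + b

namespace NiceResolution

variable {G : Type u} [Group G] {L : LengthFunction G} (C : NiceResolution L) (B : BoundingClass)

/-- The completion of `ℂ ⊗ C n`. -/
abbrev BD (n : ℕ) : Type u := WL1 B (C.w n)

/-- The boundary of a basis element, with complex coefficients. -/
def dBasis (n : ℕ) (s : G × Fin (C.rank (n + 1))) : C.BD B n :=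
  WL1.ofFinsupp ((C.d n (Finsupp.single s 1)).mapRange (fun k : ℤ => (k : ℂ)) (by simp))

theorem exists_card_bound (n : ℕ) : ∃ N : ℝ, 0 ≤ N ∧ ∀ s,
    ((C.d n (Finsupp.single s 1)).sum fun _ c => ‖(c : ℂ)‖) ≤ N := by
  refine ⟨∑ t, ((C.d n (Finsupp.single (1, t) 1)).sum fun _ c => ‖(c : ℂ)‖),
    Finset.sum_nonneg fun t _ => Finset.sum_nonneg fun _ _ => norm_nonneg _, ?_⟩
  rintro ⟨g, t⟩
  have h1 : (Finsupp.single (g, t) 1 : (G × Fin (C.rank (n + 1))) →₀ ℤ) =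
      shift g (Finsupp.single (1, t) 1) := by
    simp [shift, Finsupp.mapDomain_single]
  have hinj : Function.Injective fun s : G × Fin (C.rank n) => (g * s.1, s.2) := by
    rintro ⟨a, b⟩ ⟨a', b'⟩ h
    simpa using h
  rw [h1, C.d_shift, shift, Finsupp.sum_mapDomain_index_inj hinj]
  exact Finset.single_le_sum
    (f := fun t => (C.d n (Finsupp.single (1, t) 1)).sum fun _ c => ‖(c : ℂ)‖)
    (fun t _ => Finset.sum_nonneg fun _ _ => norm_nonneg _) (Finset.mem_univ t)

theorem dBasis_bound (n : ℕ) : ∀ f ∈ B.carrier, ∃ h ∈ B.carrier, ∀ s,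
    wnorm (C.w n) f (C.dBasis B n s) ≤ h (C.w (n + 1) s) := by
  intro f hf
  obtain ⟨a, b, hab⟩ := C.linearlyBounded n
  obtain ⟨N, hN0, hN⟩ := C.exists_card_bound n
  obtain ⟨f2, hf2, hle2⟩ := B.exists_dilate hf a b
  obtain ⟨h, hh, hle⟩ := B.exists_mul_add hf2 hf2 N
  refine ⟨h, hh, fun s => ?_⟩
  set x := C.d n (Finsupp.single s 1) with hx
  have e1 : wnorm (C.w n) f (C.dBasis B n s) =
      ∑ t ∈ x.support, ‖((x t : ℤ) : ℂ)‖ * f (C.w n t) := by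
    rw [wnorm, tsum_eq_sum (s := x.support)]
    · rfl
    · intro t ht
      have h0 : x t = 0 := Finsupp.notMem_support_iff.mp ht
      have h1 : (C.dBasis B n s) t = ((x t : ℤ) : ℂ) := rfl
      rw [h1, h0]
      simp
  have hw : ∀ t ∈ x.support, C.w n t ≤ a * C.w (n + 1) s + b := fun t ht => by
    refine le_trans ?_ (hab s)
    have h1 : (1 : ℝ≥0) ≤ ((x t).natAbs : ℝ≥0) := by
      exact_mod_cast Int.natAbs_pos.mpr (Finsupp.mem_support_iff.mp ht)
    calc C.w n t ≤ ((x t).natAbs : ℝ≥0) * C.w n t := le_mul_of_one_le_left zero_le h1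
      _ ≤ _ := Finset.single_le_sum (f := fun t => ((x t).natAbs : ℝ≥0) * C.w n t)
        (fun _ _ => zero_le) ht
  have hf2s : 0 ≤ f2 (C.w (n + 1) s) := (B.pos f2 hf2 _).le
  calc wnorm (C.w n) f (C.dBasis B n s)
      ≤ ∑ t ∈ x.support, ‖((x t : ℤ) : ℂ)‖ * f2 (C.w (n + 1) s) := by
        rw [e1]
        exact Finset.sum_le_sum fun t ht => mul_le_mul_of_nonneg_left
          (le_trans (B.mono f hf (hw t ht)) (hle2 _)) (norm_nonneg _)
    _ = (x.sum fun _ c => ‖(c : ℂ)‖) * f2 (C.w (n + 1) s) := by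
        rw [Finsupp.sum, Finset.sum_mul]
    _ ≤ N * f2 (C.w (n + 1) s) := mul_le_mul_of_nonneg_right (hN s) hf2s
    _ ≤ N * (f2 (C.w (n + 1) s) + f2 (C.w (n + 1) s)) :=
        mul_le_mul_of_nonneg_left (by linarith) hN0
    _ ≤ _ := (hle _).2.2

/-- The boundary map on the completions. -/
def dHat (n : ℕ) : C.BD B (n + 1) →ₗ[ℂ] C.BD B n := WL1.lift (C.dBasis B n) (C.dBasis_bound B n)

/-- The augmentation on the completion in degree `0`. -/
def εHat (x : C.BD B 0) : ℂ := ∑' s, x s * (C.ε (Finsupp.single s 1) : ℂ)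

/-- The completed augmented complex `⋯ → BD 1 → BD 0 → ℂ → 0` has a bounded linear chain
contraction; `e` is the image of `1` under the contraction in degree `-1`. -/
def HasBoundedContraction : Prop :=
  ∃ (e : C.BD B 0) (s : ∀ n, C.BD B n →ₗ[ℂ] C.BD B (n + 1)),
    (∀ n, IsBoundedMap (s n)) ∧
    C.εHat B e = 1 ∧
    (∀ x, C.dHat B 0 (s 0 x) + C.εHat B x • e = x) ∧
    (∀ n x, C.dHat B (n + 1) (s (n + 1) x) + s n (C.dHat B n x) = x)

end NiceResolution

/-- `(G, L)` is of type `B FP^∞`: it is of type `FP^∞`, and the `B`-completion of a nice resolution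
has a bounded linear chain contraction in all degrees. -/
def TypeBFPInfty (B : BoundingClass) {G : Type u} [Group G] (L : LengthFunction G) : Prop :=
  TypeFPInfty G ∧ ∃ C : NiceResolution L, C.HasBoundedContraction B

end

/-! Let `H` be the completed group algebra. Type `FP^∞` provides a resolution `C` of `ℤ` by free
modules of finite rank, with completion `P n = H^(rank n)`. Because the ranks are finite, an
equivariant map from `C n` to `V` extends uniquely to an `H`-linear map on `P n`, and every such map
is bounded. Hence `Hom_H(P, V)` computes the group cohomology of `V`, even if the complex `P` is not
exact.

Bar cochains are compared with maps on the resolution in two double complexes: bounded maps `H^p × P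
q → V`, and all maps `G^p × C q → V` additive in the last variable. The rows (the bar direction) are
always exact, since the modules are free (`rowsExact_H`, `rowsExact_G`). The columns over `G` are
exact by an additive contraction (`colsExact_G`); those over `H` are exact if `P` has a bounded
contraction (`HasContraction.colsExact`). Zigzags then match bar cocycles with `H`-linear cocycles
on the resolution, in the bounded and in the algebraic setting, and compatibly with restriction.
This gives bijectivity of the comparison map.

Conversely, exactness of the rows alone moves a bounded bar cocycle of positive degree to an
`H`-linear map `F` on `P (n + 1)`, and the last step of the zigzag writes `F = σ ∘ d` with `σ`
bounded and linear, though not equivariant. If the comparison map is surjective, every `H`-linear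
cocycle `z` on `P (n + 1)` therefore factors as `σ ∘ d` (`exists_factorization_of_surjective`). This
is applied to projections onto quotients of `P (n + 1)`: the quotient by the kernel of `d` gives a
bounded `t` with `t ∘ d = d` and values in the image of `d`. Now the image of `d` is the kernel of
`1 - t`, so the quotient by it is complete too, and a second application gives the pieces of a
contraction (`hasContraction_of_comparisonSurjective`).

A nice resolution needs a proper weight, whereas `L` is arbitrary. A bounded contraction forces `L`
to be proper (`FreeRes.HasContraction.finite_setOf_le`), by testing boundaries against a truncated
word distance.

For the weighted cochains of `EG`, restriction from `H` to `G` identifies the two complexes. The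
tool is `BoundingClass.exists_dominating`: for a countable multiplicative class, each bounded set is
absorbed by one weight that dominates the whole class. -/

namespace IsBoundedMap

/-! ### Bounded maps and complete bornological spaces. -/

variable {X Y Z : Type*} [Bornology X] [Bornology Y] [Bornology Z]

theorem comp {g : Y → Z} {f : X → Y} (hg : IsBoundedMap g) (hf : IsBoundedMap f) :
    IsBoundedMap fun x => g (f x) := fun s hs => by
  have := hg _ (hf s hs)
  rwa [Set.image_image] at this

theorem self : IsBoundedMap fun x : X => x := fun s hs => by simpa using hs

theorem const (y : Y) : IsBoundedMap fun _ : X => y := fun s _ =>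
  (Bornology.isBounded_singleton (x := y)).subset (by rintro _ ⟨_, _, rfl⟩; rfl)

theorem prodMk {f : X → Y} {g : X → Z} (hf : IsBoundedMap f) (hg : IsBoundedMap g) :
    IsBoundedMap fun x => (f x, g x) := fun s hs => by
  rw [← Bornology.isBounded_image_fst_and_snd, Set.image_image, Set.image_image]
  exact ⟨hf s hs, hg s hs⟩

theorem fst : IsBoundedMap fun p : X × Y => p.1 := fun _ hs =>
  (Bornology.isBounded_image_fst_and_snd.2 hs).1

theorem snd : IsBoundedMap fun p : X × Y => p.2 := fun _ hs =>
  (Bornology.isBounded_image_fst_and_snd.2 hs).2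

theorem pi {ι : Type*} {Y : ι → Type*} [∀ i, Bornology (Y i)] {f : X → ∀ i, Y i}
    (hf : ∀ i, IsBoundedMap fun x => f x i) : IsBoundedMap f := fun s hs => by
  rw [← Bornology.forall_isBounded_image_eval_iff]
  intro i
  rw [Set.image_image]
  exact hf i s hs

theorem eval {ι : Type*} {Y : ι → Type*} [∀ i, Bornology (Y i)] (i : ι) :
    IsBoundedMap fun y : ∀ i, Y i => y i := fun _ hs =>
  (Bornology.forall_isBounded_image_eval_iff.2 hs) i

end IsBoundedMap

section CompleteBornological

variable {X : Type*} [Bornology X]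
variable {V : Type v} [AddCommGroup V] [Module ℂ V] [Bornology V] [CompleteBornological V]

theorem IsBoundedMap.add {f g : X → V} (hf : IsBoundedMap f) (hg : IsBoundedMap g) :
    IsBoundedMap fun x => f x + g x := fun s hs => by
  refine (CompleteBornological.isBounded_add (hf s hs) (hg s hs)).subset ?_
  rintro _ ⟨x, hx, rfl⟩
  exact ⟨_, ⟨x, hx, rfl⟩, _, ⟨x, hx, rfl⟩, rfl⟩

theorem isBoundedMap_complex_smul : IsBoundedMap fun p : ℂ × V => p.1 • p.2 := fun s hs => by
  obtain ⟨h1, h2⟩ := Bornology.isBounded_image_fst_and_snd.2 hs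
  obtain ⟨r, hr⟩ := h1.exists_norm_le
  obtain ⟨E, _, _, _, i, -, hb, hsub⟩ := CompleteBornological.exists_disc _ h2
  refine (hb r).subset ?_
  rintro _ ⟨⟨c, x⟩, hx, rfl⟩
  obtain ⟨x', hx', h3⟩ := hsub ⟨_, hx, rfl⟩
  have hc : ‖c‖ ≤ r := hr c ⟨_, hx, rfl⟩
  refine ⟨c • x', ?_, by simpa using congrArg (c • ·) h3⟩
  rw [mem_closedBall_zero_iff] at *
  rw [norm_smul]
  nlinarith [norm_nonneg c, norm_nonneg x']

theorem IsBoundedMap.complex_smul {f : X → ℂ} {g : X → V} (hf : IsBoundedMap f)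
    (hg : IsBoundedMap g) : IsBoundedMap fun x => f x • g x :=
  isBoundedMap_complex_smul.comp (hf.prodMk hg)

theorem IsBoundedMap.const_smul (c : ℂ) {g : X → V} (hg : IsBoundedMap g) :
    IsBoundedMap fun x => c • g x :=
  (IsBoundedMap.const c).complex_smul hg

theorem IsBoundedMap.sub {f g : X → V} (hf : IsBoundedMap f) (hg : IsBoundedMap g) :
    IsBoundedMap fun x => f x - g x := by
  simpa [sub_eq_add_neg] using hf.add (hg.const_smul (-1))

theorem IsBoundedMap.sum {ι : Type*} (s : Finset ι) {f : ι → X → V}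
    (hf : ∀ i ∈ s, IsBoundedMap (f i)) : IsBoundedMap fun x => ∑ i ∈ s, f i x := by
  classical
  induction s using Finset.induction_on with
  | empty => simpa using IsBoundedMap.const (0 : V)
  | insert a s ha ih =>
    simp only [Finset.sum_insert ha]
    exact (hf a (Finset.mem_insert_self a s)).add
      (ih fun i hi => hf i (Finset.mem_insert_of_mem hi))

/-- Complete bornological spaces are separated: a line contains no unbounded set which is
bounded. -/
theorem CompleteBornological.eq_zero_of_isBounded {v : V} {c : ℕ → ℝ}
    (hc : Filter.Tendsto c Filter.atTop Filter.atTop)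
    (hv : Bornology.IsBounded (Set.range fun n => (c n : ℂ) • v)) : v = 0 := by
  obtain ⟨E, _, _, _, i, hi, -, hsub⟩ := CompleteBornological.exists_disc _ hv
  obtain ⟨n₀, hn₀⟩ := (hc.eventually_ge_atTop 1).exists
  -- Dividing by `c n₀ ≥ 1` gives `v` itself a preimage `e` in the Banach space. By injectivity `|c
  -- n| * ‖e‖ ≤ 1` for all `n`, which forces `e = 0`.
  obtain ⟨y, -, hy⟩ := hsub ⟨n₀, rfl⟩
  have hne : (c n₀ : ℂ) ≠ 0 := by
    norm_cast; linarith
  set e : E := (c n₀ : ℂ)⁻¹ • y with he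
  have hev : i e = v := by
    rw [he, map_smul, hy]
    simp only [smul_smul, inv_mul_cancel₀ hne, one_smul]
  have hbd : ∀ n, |c n| * ‖e‖ ≤ 1 := fun n => by
    obtain ⟨z, hz, hz'⟩ := hsub ⟨n, rfl⟩
    have : z = (c n : ℂ) • e := hi (by rw [hz', map_smul, hev])
    rw [mem_closedBall_zero_iff, this, norm_smul, Complex.norm_real] at hz
    exact hz
  have he0 : e = 0 := by
    by_contra hne
    have hpos : 0 < ‖e‖ := norm_pos_iff.2 hne
    obtain ⟨n, hn⟩ := (hc.eventually_gt_atTop (‖e‖⁻¹)).exists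
    have h1 := hbd n
    have h2 : 1 < c n * ‖e‖ := by
      rwa [← div_lt_iff₀ hpos, one_div]
    have h3 := mul_le_mul_of_nonneg_right (le_abs_self (c n)) hpos.le
    linarith
  rw [← hev, he0, map_zero]

instance CompleteBornological.pi {ι : Type} [Fintype ι] {W : ι → Type v}
    [∀ i, AddCommGroup (W i)] [∀ i, Module ℂ (W i)] [∀ i, Bornology (W i)]
    [∀ i, CompleteBornological (W i)] : CompleteBornological (∀ i, W i) where
  exists_disc A hA := by
    have h := Bornology.forall_isBounded_image_eval_iff.2 hA
    choose E h1 h2 h3 j hj hb hsub using fun i => CompleteBornological.exists_disc _ (h i)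
    refine ⟨∀ i, E i, inferInstance, inferInstance, inferInstance,
      LinearMap.pi fun i => (j i) ∘ₗ LinearMap.proj i, ?_, fun r => ?_, fun x hx => ?_⟩
    · intro x y hxy
      funext i
      exact hj i (congrFun hxy i)
    · rw [← Bornology.forall_isBounded_image_eval_iff]
      intro i
      refine (hb i r).subset ?_
      rintro _ ⟨_, ⟨y, hy, rfl⟩, rfl⟩
      refine ⟨y i, ?_, rfl⟩
      rw [mem_closedBall_zero_iff] at *
      exact (norm_le_pi_norm y i).trans hy
    · choose y hy hy' using fun i => hsub i ⟨x, hx, rfl⟩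
      refine ⟨y, ?_, funext fun i => hy' i⟩
      rw [mem_closedBall_zero_iff]
      refine (pi_norm_le_iff_of_nonneg zero_le_one).2 fun i => ?_
      exact mem_closedBall_zero_iff.1 (hy i)

end CompleteBornological

/-! ### Completeness of the weighted completions. -/

namespace WL1

variable {B : BoundingClass} {S : Type u} {w : S → ℝ≥0}

theorem isBounded_iff {A : Set (WL1 B w)} :
    Bornology.IsBounded A ↔ ∀ f ∈ B.carrier, ∃ M : ℝ, ∀ x ∈ A, wnorm w f x ≤ M :=
  Bornology.isBounded_ofBounded_iff _

theorem wnorm_nonneg {f : ℝ≥0 → ℝ} (hf : f ∈ B.carrier) (x : WL1 B w) : 0 ≤ wnorm w f x :=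
  tsum_nonneg fun s => x.term_nonneg hf s

theorem isBoundedMap_of_wnorm_le {T : Type*} {w' : T → ℝ≥0} {φ : WL1 B w → WL1 B w'}
    (h : ∀ f ∈ B.carrier, ∃ g ∈ B.carrier, ∃ C : ℝ, 0 ≤ C ∧
      ∀ x, wnorm w' f (φ x) ≤ C * wnorm w g x) :
    IsBoundedMap φ := fun A hA => by
  rw [isBounded_iff] at *
  intro f hf
  obtain ⟨g, hg, C, hC, hle⟩ := h f hf
  obtain ⟨M, hM⟩ := hA g hg
  refine ⟨C * M, ?_⟩
  rintro _ ⟨x, hx, rfl⟩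
  exact (hle x).trans (mul_le_mul_of_nonneg_left (hM x hx) hC)

open scoped ENNReal in
-- If `|·|_f ≤ M f` on `A`, the Banach space is the set of `x` with `sup_f |x|_f / M f` finite. It
-- is realised as a closed subspace of an `ℓ^∞`-sum of copies of `ℓ¹(S)`, so that completeness is
-- inherited.
instance : CompleteBornological (WL1 B w) where
  exists_disc A hA := by
    rw [isBounded_iff] at hA
    have hA' : ∀ f : B.carrier, ∃ M : ℝ, 0 < M ∧ ∀ x ∈ A, wnorm w f.1 x ≤ M := fun f => by
      obtain ⟨M, hM⟩ := hA f.1 f.2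
      exact ⟨max M 1, by positivity, fun x hx => (hM x hx).trans (le_max_left _ _)⟩
    choose M hM0 hM using hA'
    let one : B.carrier := ⟨_, B.one_mem⟩
    let F := lp (fun _ : B.carrier => lp (fun _ : S => ℂ) 1) ∞
    let coord : B.carrier → S → F →ₗ[ℂ] ℂ := fun f s =>
      { toFun := fun x => x f s
        map_add' := fun _ _ => rfl
        map_smul' := fun _ _ => rfl }
    have hcoord : ∀ f s, Continuous (coord f s) := fun f s => by
      have h1 : Continuous fun x : F => x f :=
        (continuous_apply f).comp (lp.uniformContinuous_coe (p := ∞)).continuous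
      exact ((continuous_apply s).comp (lp.uniformContinuous_coe (p := 1)).continuous).comp h1
    -- The compatible families: the component at `f` is `x * f(w) / M f` for one function `x`, which
    -- is recovered from the component at the constant `1`.
    let E : Submodule ℂ F :=
      { carrier := {x | ∀ f s, coord f s x * M f = coord one s x * M one * (f.1 (w s) : ℝ)}
        zero_mem' := by intro f s; simp only [map_zero, zero_mul]
        add_mem' := by
          intro x y hx hy f s
          have h1 := hx f s
          have h2 := hy f s
          rw [map_add, map_add]
          linear_combination h1 + h2
        smul_mem' := by
          intro c x hx f s
          have h1 := hx f s
          rw [map_smul, map_smul, smul_eq_mul, smul_eq_mul]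
          linear_combination c * h1 }
    have hE : IsClosed (E : Set F) := by
      have : (E : Set F) = ⋂ f, ⋂ s,
          {x | coord f s x * M f = coord one s x * M one * (f.1 (w s) : ℝ)} := by
        ext x; simp [E]
      rw [this]
      refine isClosed_iInter fun f => isClosed_iInter fun s => isClosed_eq ?_ ?_
      · exact (hcoord f s).mul continuous_const
      · exact ((hcoord one s).mul continuous_const).mul continuous_const
    have hcE : CompleteSpace E := hE.completeSpace_coe
    have hterm : ∀ (x : E) (f : B.carrier) (s : S),
        ‖coord one s x * M one‖ * f.1 (w s) = M f * ‖coord f s x‖ := fun x f s => by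
      have h1 := congrArg norm (x.2 f s)
      rw [norm_mul, norm_mul _ ((f.1 (w s) : ℝ) : ℂ), Complex.norm_real, Complex.norm_real,
        Real.norm_of_nonneg (hM0 f).le, Real.norm_of_nonneg (B.pos f.1 f.2 _).le] at h1
      linarith
    have hl1 : ∀ y : lp (fun _ : S => ℂ) 1, Summable fun s => ‖y s‖ := fun y => by
      have := (lp.memℓp y).summable (by norm_num)
      simpa using this
    have hl1n : ∀ y : lp (fun _ : S => ℂ) 1, ‖y‖ = ∑' s, ‖y s‖ := fun y => by
      have := lp.norm_eq_tsum_rpow (p := 1) (by norm_num) y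
      simpa using this
    let i : E →ₗ[ℂ] WL1 B w :=
      { toFun := fun x => mk (fun s => coord one s x * M one) (fun f hf => by
          refine ((hl1 (x.1 ⟨f, hf⟩)).mul_left (M ⟨f, hf⟩)).congr fun s => ?_
          exact (hterm x ⟨f, hf⟩ s).symm)
        map_add' := by
          intro x y
          ext s
          rw [add_apply, mk_apply, mk_apply, mk_apply, Submodule.coe_add, map_add, add_mul]
        map_smul' := by
          intro c x
          ext s
          rw [RingHom.id_apply, smul_apply, mk_apply, mk_apply, Submodule.coe_smul, map_smul,
            smul_eq_mul, mul_assoc] }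
    have hi : ∀ (x : E) s, i x s = coord one s x * M one := fun _ _ => rfl
    refine ⟨E, inferInstance, inferInstance, hcE, i, ?_, fun r => ?_, fun x hx => ?_⟩
    · intro x y hxy
      have hMC : ∀ f, (M f : ℂ) ≠ 0 := fun f => by exact_mod_cast (hM0 f).ne'
      have h1 : ∀ s, coord one s x = coord one s y := fun s => by
        have : i x s = i y s := by rw [hxy]
        rw [hi, hi] at this
        exact mul_right_cancel₀ (hMC one) this
      apply Subtype.ext
      apply lp.ext
      funext f
      apply lp.ext
      funext s
      have hx' := x.2 f s
      have hy' := y.2 f s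
      rw [h1 s] at hx'
      exact mul_right_cancel₀ (hMC f) (hx'.trans hy'.symm)
    · rw [isBounded_iff]
      intro f hf
      refine ⟨M ⟨f, hf⟩ * r, ?_⟩
      rintro _ ⟨x, hx, rfl⟩
      have h1 : wnorm w f (i x) = M ⟨f, hf⟩ * ‖x.1 ⟨f, hf⟩‖ := by
        rw [hl1n, ← tsum_mul_left]
        exact tsum_congr fun s => hterm x ⟨f, hf⟩ s
      rw [h1]
      refine mul_le_mul_of_nonneg_left ?_ (hM0 _).le
      exact (lp.norm_apply_le_norm (by norm_num) x.1 _).trans (mem_closedBall_zero_iff.1 hx)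
    · have hmem : ∀ f : B.carrier,
          Memℓp (fun s => x s * (f.1 (w s) : ℝ) / (M f : ℂ)) 1 := fun f => by
        refine memℓp_gen ?_
        have := (x.summable f.2).div_const (M f)
        refine this.congr fun s => ?_
        simp [abs_of_pos (hM0 f), abs_of_pos (B.pos f.1 f.2 _)]
      let y : B.carrier → lp (fun _ : S => ℂ) 1 := fun f => ⟨_, hmem f⟩
      have hy : ∀ f, ‖y f‖ ≤ 1 := fun f => by
        have h1 : ‖y f‖ = wnorm w f.1 x / M f := by
          rw [hl1n, wnorm, ← tsum_div_const]
          refine tsum_congr fun s => ?_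
          simp [y, abs_of_pos (hM0 f), abs_of_pos (B.pos f.1 f.2 _)]
        rw [h1]
        exact (div_le_one (hM0 f)).2 (hM f x hx)
      have hym : Memℓp y ∞ := memℓp_infty ⟨1, by rintro _ ⟨f, rfl⟩; exact hy f⟩
      have hMC : ∀ f, (M f : ℂ) ≠ 0 := fun f => by exact_mod_cast (hM0 f).ne'
      have hyE : (⟨y, hym⟩ : F) ∈ E := fun f s => by
        change x s * (f.1 (w s) : ℝ) / (M f : ℂ) * M f =
          x s * ((1 : ℝ) : ℂ) / (M one : ℂ) * M one * (f.1 (w s) : ℝ)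
        rw [div_mul_cancel₀ _ (hMC _), div_mul_cancel₀ _ (hMC _)]
        simp
      refine ⟨⟨_, hyE⟩, ?_, ?_⟩
      · rw [mem_closedBall_zero_iff]
        exact lp.norm_le_of_forall_le zero_le_one hy
      · ext s
        change x s * ((1 : ℝ) : ℂ) / (M one : ℂ) * M one = x s
        rw [div_mul_cancel₀ _ (hMC _)]
        simp

end WL1

/-! ### Boundedness of the convolution product and of the augmentation. -/

namespace HAlg

variable {B : BoundingClass} {G : Type u} [Group G] {L : LengthFunction G}

/-- An explicit form of `translate_bound`: the dependence on `x` is visible, so the estimate is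
uniform on bounded sets. -/
theorem wnorm_translate_le {f f2 : ℝ≥0 → ℝ} (hf : f ∈ B.carrier) (hf2 : f2 ∈ B.carrier)
    (hle : ∀ x : ℝ≥0, f (2 * x + 0) ≤ f2 x) (g : G) (x : HAlg B L) :
    wnorm L f (translate g x) ≤ wnorm L (fun _ => 1) x * f2 (L g) + wnorm L f2 x := by
  have e1 : wnorm L f (translate g x) = ∑' k, ‖x k‖ * f (L (g * k)) := by
    rw [wnorm, ← (Equiv.mulLeft g).tsum_eq]
    simp
  have s1 : Summable fun k => ‖x k‖ * (1 : ℝ) * f2 (L g) :=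
    (x.summable B.one_mem).mul_right _
  have s2 : Summable fun k => ‖x k‖ * f2 (L k) := x.summable hf2
  have key : ∀ k, ‖x k‖ * f (L (g * k)) ≤ ‖x k‖ * 1 * f2 (L g) + ‖x k‖ * f2 (L k) := fun k => by
    have h1 : f (L (g * k)) ≤ f2 (L g) + f2 (L k) := by
      have p1 := B.pos f2 hf2 (L g)
      have p2 := B.pos f2 hf2 (L k)
      -- Since `L (g * k)` is at most twice the larger of the two lengths, doubling the argument
      -- replaces submultiplicativity of `f`.
      have h3 : f (L (g * k)) ≤ f2 (max (L g) (L k)) := by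
        refine le_trans (B.mono f hf ((L.mul_le g k).trans ?_)) (hle _)
        rw [add_zero, two_mul]
        exact add_le_add (le_max_left _ _) (le_max_right _ _)
      rcases max_choice (L g) (L k) with h | h <;> rw [h] at h3 <;> linarith
    calc ‖x k‖ * f (L (g * k)) ≤ ‖x k‖ * (f2 (L g) + f2 (L k)) :=
          mul_le_mul_of_nonneg_left h1 (norm_nonneg _)
      _ = _ := by ring
  calc wnorm L f (translate g x) ≤ ∑' k, (‖x k‖ * 1 * f2 (L g) + ‖x k‖ * f2 (L k)) := by
        rw [e1]
        exact (summable_translate g x hf).tsum_le_tsum key (s1.add s2)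
    _ = _ := by
        rw [s1.tsum_add s2, tsum_mul_right, wnorm, wnorm]

/-- The estimate behind this is `|x * y|_f ≤ |x|_f2 |y|_1 + |x|_1 |y|_f2`, where `f2` bounds `f (2
·)`. -/
theorem isBoundedMap_mul : IsBoundedMap fun p : HAlg B L × HAlg B L => p.1 * p.2 := by
  intro A hA
  obtain ⟨h1, h2⟩ := Bornology.isBounded_image_fst_and_snd.2 hA
  rw [WL1.isBounded_iff] at *
  intro f hf
  obtain ⟨f2, hf2, hle2⟩ := B.exists_dilate hf 2 0
  obtain ⟨M1, hM1⟩ := h1 _ B.one_mem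
  obtain ⟨M2, hM2⟩ := h1 _ hf2
  obtain ⟨N1, hN1⟩ := h2 _ B.one_mem
  obtain ⟨N2, hN2⟩ := h2 _ hf2
  refine ⟨M2 * N1 + M1 * N2, ?_⟩
  rintro _ ⟨⟨x, y⟩, hxy, rfl⟩
  have hx1 := hM1 x ⟨_, hxy, rfl⟩
  have hx2 := hM2 x ⟨_, hxy, rfl⟩
  have hy1 := hN1 y ⟨_, hxy, rfl⟩
  have hy2 := hN2 y ⟨_, hxy, rfl⟩
  have p1 := WL1.wnorm_nonneg B.one_mem x
  have p2 := WL1.wnorm_nonneg hf2 x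
  have q1 := WL1.wnorm_nonneg B.one_mem y
  have q2 := WL1.wnorm_nonneg hf2 y
  have hs := WL1.summable_kernel (fun g => translate g y) (translate_bound y) x hf
  have key : wnorm L f (WL1.coeff (x * y)) ≤ wnorm L f2 x * wnorm L (fun _ => 1) y +
      wnorm L (fun _ => 1) x * wnorm L f2 y := by
    calc wnorm L f (WL1.coeff (x * y)) ≤ ∑' t, ∑' s, ‖x s‖ * (‖translate s y t‖ * f (L t)) := by
          refine ((x * y).summable hf).tsum_le_tsum (fun t => ?_) hs.prod_symm.prod
          calc ‖WL1.coeff (x * y) t‖ * f (L t) ≤ (∑' s, ‖x s * translate s y t‖) * f (L t) :=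
                mul_le_mul_of_nonneg_right (norm_tsum_le_tsum_norm
                  (WL1.summable_kernel_apply _ (translate_bound y) x t)) (B.pos f hf _).le
            _ = ∑' s, ‖x s‖ * (‖translate s y t‖ * f (L t)) := by
                rw [← tsum_mul_right]
                simp only [norm_mul, mul_assoc]
      _ = ∑' s, ∑' t, ‖x s‖ * (‖translate s y t‖ * f (L t)) :=
          Summable.tsum_comm (f := fun s t => ‖x s‖ * (‖translate s y t‖ * f (L t))) hs
      _ ≤ ∑' s, (‖x s‖ * f2 (L s) * wnorm L (fun _ => 1) y + ‖x s‖ * 1 * wnorm L f2 y) := by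
          refine hs.prod.tsum_le_tsum (fun s => ?_)
            (((x.summable hf2).mul_right _).add ((x.summable B.one_mem).mul_right _))
          rw [tsum_mul_left]
          have := mul_le_mul_of_nonneg_left (wnorm_translate_le hf hf2 hle2 s y)
            (norm_nonneg (x s))
          refine this.trans (le_of_eq ?_)
          ring
      _ = _ := by
          rw [((x.summable hf2).mul_right _).tsum_add ((x.summable B.one_mem).mul_right _),
            tsum_mul_right, tsum_mul_right]
          rfl
  refine key.trans (add_le_add (mul_le_mul hx2 hy1 q1 (p2.trans hx2))
    (mul_le_mul hx1 hy2 q2 (p1.trans hx1)))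

instance : BornologicalModule (HAlg B L) (HAlg B L) where
  isBoundedMap_smul := isBoundedMap_mul

theorem aug_add (x y : HAlg B L) : aug (x + y) = aug x + aug y :=
  x.summable_norm.of_norm.tsum_add y.summable_norm.of_norm

theorem aug_smul (c : ℂ) (x : HAlg B L) : aug (c • x) = c * aug x := tsum_mul_left

theorem norm_aug_le (x : HAlg B L) : ‖aug x‖ ≤ wnorm L (fun _ => 1) x := by
  simpa [wnorm, aug] using norm_tsum_le_tsum_norm x.summable_norm

theorem isBoundedMap_aug : IsBoundedMap (aug : HAlg B L → ℂ) := fun A hA => by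
  obtain ⟨M, hM⟩ := WL1.isBounded_iff.1 hA _ B.one_mem
  refine isBounded_iff_forall_norm_le.2 ⟨M, ?_⟩
  rintro _ ⟨x, hx, rfl⟩
  exact (norm_aug_le x).trans (hM x hx)

theorem aug_mul (x y : HAlg B L) : aug (x * y) = aug x * aug y := by
  have hs : Summable fun p : G × G => x p.1 * translate p.1 y p.2 := by
    refine Summable.of_norm ((WL1.summable_kernel _ (translate_bound y) x B.one_mem).congr ?_)
    intro p
    simp
  calc aug (x * y) = ∑' t, ∑' s, x s * translate s y t := rfl
    _ = ∑' s, ∑' t, x s * translate s y t :=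
        Summable.tsum_comm (f := fun s t => x s * translate s y t) hs
    _ = ∑' s, x s * aug y := by
        refine tsum_congr fun s => ?_
        rw [tsum_mul_left]
        congr 1
        exact (Equiv.mulLeft s⁻¹).tsum_eq y
    _ = _ := tsum_mul_right

/-- The augmentation as a linear map. -/
noncomputable def augₗ : HAlg B L →ₗ[ℂ] ℂ where
  toFun := aug
  map_add' := aug_add
  map_smul' := aug_smul

end HAlg

section BornologicalModule

variable {B : BoundingClass} {G : Type u} [Group G] {L : LengthFunction G}
variable {V : Type v} [AddCommGroup V] [Module ℂ V] [Bornology V] [Module (HAlg B L) V]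
  [BornologicalModule (HAlg B L) V] {X : Type*} [Bornology X]

theorem IsBoundedMap.smul {f : X → HAlg B L} {g : X → V} (hf : IsBoundedMap f)
    (hg : IsBoundedMap g) : IsBoundedMap fun x => f x • g x :=
  (BornologicalModule.isBoundedMap_smul (A := HAlg B L) (V := V)).comp (hf.prodMk hg)

instance BornologicalModule.pi {ι : Type} [Fintype ι] :
    BornologicalModule (HAlg B L) (ι → V) where
  isBoundedMap_smul := IsBoundedMap.pi fun i =>
    IsBoundedMap.smul IsBoundedMap.fst ((IsBoundedMap.eval i).comp IsBoundedMap.snd)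

end BornologicalModule

/-! ### Zigzags in a double complex -/

section Zigzag

variable {A : ℕ → ℕ → Type*} [∀ p q, AddCommGroup (A p q)] [∀ p q, Module ℂ (A p q)]
  (S : ∀ p q, Submodule ℂ (A p q)) (δ : ∀ p q, A p q →ₗ[ℂ] A (p + 1) q)
  (d : ∀ p q, A p q →ₗ[ℂ] A p (q + 1))

/-- The submodules `S p q` form a double complex with differentials `δ` and `d`. -/
structure IsDoubleComplex : Prop where
  δ_mem : ∀ p q, ∀ u ∈ S p q, δ p q u ∈ S (p + 1) q
  d_mem : ∀ p q, ∀ u ∈ S p q, d p q u ∈ S p (q + 1)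
  δ_δ : ∀ p q, ∀ u ∈ S p q, δ (p + 1) q (δ p q u) = 0
  d_d : ∀ p q, ∀ u ∈ S p q, d p (q + 1) (d p q u) = 0
  comm : ∀ p q, ∀ u ∈ S p q, d (p + 1) q (δ p q u) = δ p (q + 1) (d p q u)

/-- Exactness of the rows of a double complex in positive degrees. -/
def RowsExact : Prop :=
  ∀ p q, ∀ u ∈ S (p + 1) q, δ (p + 1) q u = 0 → ∃ a ∈ S p q, δ p q a = u

/-- Exactness of the columns of a double complex in positive degrees. -/
def ColsExact : Prop :=
  ∀ p q, ∀ u ∈ S p (q + 1), d p (q + 1) u = 0 → ∃ a ∈ S p q, d p q a = u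

/-- The elements `u` and `z` are the ends of a zigzag in the double complex. -/
def Zigzag {n : ℕ} (z : A 0 n) : ∀ p q, q + p = n → A p q → Prop
  | 0, q, h, u => (show q = n from h) ▸ u = z
  | p + 1, q, h, u => ∃ a ∈ S p q, δ p q a = u ∧ Zigzag z p (q + 1) (by omega) (d p q a)

variable {S δ d} {n : ℕ}

theorem zigzag_zero_iff {u z : A 0 n} : Zigzag S δ d z 0 n rfl u ↔ u = z := Iff.rfl

theorem Zigzag.sub {z z' : A 0 n} : ∀ {p q} (h : q + p = n) {u u' : A p q},
    Zigzag S δ d z p q h u → Zigzag S δ d z' p q h u' →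
      Zigzag S δ d (z - z') p q h (u - u') := by
  intro p
  induction p with
  | zero =>
    intro q h u u' hu hu'
    obtain rfl : q = n := h
    rw [zigzag_zero_iff] at *
    rw [hu, hu']
  | succ p ih =>
    rintro q h _ _ ⟨a, ha, rfl, hz⟩ ⟨a', ha', rfl, hz'⟩
    refine ⟨a - a', sub_mem ha ha', map_sub _ _ _, ?_⟩
    rw [map_sub]
    exact ih _ hz hz'

theorem zigzag_zero : ∀ {p q} (h : q + p = n), Zigzag S δ d (0 : A 0 n) p q h 0 := by
  intro p
  induction p with
  | zero =>
    intro q h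
    obtain rfl : q = n := h
    rfl
  | succ p ih =>
    intro q h
    refine ⟨0, zero_mem _, map_zero _, ?_⟩
    rw [map_zero]
    exact ih _

/-- With `a` an augmented cochain, this lets a bar cocycle be changed by a coboundary without moving
the other end of the zigzag. -/
theorem zigzag_source_boundary {p q : ℕ} (h : q + (p + 1) = n) {a : A p q} (ha : a ∈ S p q)
    (hda : d p q a = 0) : Zigzag S δ d (0 : A 0 n) (p + 1) q h (δ p q a) :=
  ⟨a, ha, rfl, by rw [hda]; exact zigzag_zero _⟩

/-- The counterpart at the other end: the zigzag is zero except for its last step, which is `y`. -/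
theorem zigzag_target_boundary {y : A 0 n} (hy : y ∈ S 0 n) (hδy : δ 0 n y = 0) :
    ∀ {p q} (h : q + (p + 1) = n + 1), Zigzag S δ d (d 0 n y) (p + 1) q h 0 := by
  intro p
  induction p with
  | zero =>
    intro q h
    obtain rfl : q = n := by omega
    exact ⟨y, hy, hδy, rfl⟩
  | succ p ih =>
    intro q h
    refine ⟨0, zero_mem _, map_zero _, ?_⟩
    rw [map_zero]
    exact ih _

/-- The last step of a zigzag of positive length is itself the primitive. It need not be `δ`-closed,
that is, equivariant; this is how non-equivariant bounded maps arise. -/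
theorem Zigzag.exists_d_eq {z : A 0 (n + 1)} : ∀ {p q} (h : q + (p + 1) = n + 1) {u : A (p + 1) q},
    Zigzag S δ d z (p + 1) q h u → ∃ a ∈ S 0 n, d 0 n a = z := by
  intro p
  induction p with
  | zero =>
    rintro q h u ⟨a, ha, -, hz⟩
    obtain rfl : q = n := by omega
    exact ⟨a, ha, hz⟩
  | succ p ih =>
    rintro q h u ⟨a, -, -, hz⟩
    exact ih _ hz

/-- Each step lifts along `δ` and applies `d`; the commutation of the differentials keeps the new
element closed in both directions. -/
theorem RowsExact.exists_target (hr : RowsExact S δ) (hS : IsDoubleComplex S δ d) :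
    ∀ {p q} (h : q + p = n) {u : A p q}, u ∈ S p q → δ p q u = 0 → d p q u = 0 →
      ∃ z ∈ S 0 n, δ 0 n z = 0 ∧ d 0 n z = 0 ∧ Zigzag S δ d z p q h u := by
  intro p
  induction p with
  | zero =>
    intro q h u hu hδ hd
    obtain rfl : q = n := h
    exact ⟨u, hu, hδ, hd, rfl⟩
  | succ p ih =>
    intro q h u hu hδ hd
    obtain ⟨a, ha, rfl⟩ := hr p q u hu hδ
    obtain ⟨z, hz, h1, h2, h3⟩ := ih (q := q + 1) (by omega) (hS.d_mem p q a ha)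
      (by rw [← hS.comm p q a ha, hd]) (hS.d_d p q a ha)
    exact ⟨z, hz, h1, h2, a, ha, rfl, h3⟩

theorem ColsExact.exists_source (hc : ColsExact S d) (hS : IsDoubleComplex S δ d) {z : A 0 n}
    (hz : z ∈ S 0 n) (hδ : δ 0 n z = 0) (hd : d 0 n z = 0) :
    ∀ {p q} (h : q + p = n), ∃ u ∈ S p q, δ p q u = 0 ∧ d p q u = 0 ∧
      Zigzag S δ d z p q h u := by
  intro p
  induction p with
  | zero =>
    intro q h
    obtain rfl : q = n := h
    exact ⟨z, hz, hδ, hd, rfl⟩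
  | succ p ih =>
    intro q h
    obtain ⟨u, hu, h1, h2, h3⟩ := ih (q := q + 1) (by omega)
    obtain ⟨a, ha, rfl⟩ := hc p q u hu h2
    exact ⟨δ p q a, hS.δ_mem p q a ha, hS.δ_δ p q a ha, by rw [hS.comm p q a ha, h1],
      a, ha, rfl, h3⟩

theorem RowsExact.exists_eq_d_of_zigzag (hr : RowsExact S δ) (hS : IsDoubleComplex S δ d)
    {z : A 0 (n + 1)} : ∀ {p q} (h : q + 1 + p = n + 1) {a : A p q}, a ∈ S p q → δ p q a = 0 →
      Zigzag S δ d z p (q + 1) h (d p q a) → ∃ y ∈ S 0 n, δ 0 n y = 0 ∧ d 0 n y = z := by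
  intro p
  induction p with
  | zero =>
    intro q h a ha hδ hz
    obtain rfl : q = n := by omega
    exact ⟨a, ha, hδ, hz⟩
  | succ p ih =>
    intro q h a ha hδ hz
    obtain ⟨b, hb, rfl⟩ := hr p q a ha hδ
    obtain ⟨a', ha', h1, h2⟩ := hz
    have hdb := hS.d_mem p q b hb
    -- Both `a'` and `d b` are lifts of `d (δ b)` along `δ`. Their difference is `δ`-closed and has
    -- the same image under `d` as `a'`, so the argument moves one step down the zigzag.
    refine ih (q := q + 1) (by omega) (sub_mem ha' hdb) ?_ ?_
    · rw [map_sub, h1, hS.comm p q b hb, sub_self]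
    · rwa [map_sub, hS.d_d p q b hb, sub_zero]

theorem RowsExact.target_boundary (hr : RowsExact S δ) (hS : IsDoubleComplex S δ d)
    {z : A 0 (n + 1)} (h : Zigzag S δ d z (n + 1) 0 (zero_add _) 0) :
    ∃ y ∈ S 0 n, δ 0 n y = 0 ∧ d 0 n y = z := by
  obtain ⟨a, ha, h1, h2⟩ := h
  exact hr.exists_eq_d_of_zigzag hS _ ha h1 h2

/-- The transpose of `RowsExact.exists_eq_d_of_zigzag`: a primitive for `d` corrects the step `a` by
`δ b`, which does not change `δ a`. -/
theorem ColsExact.source_boundary (hc : ColsExact S d) (hS : IsDoubleComplex S δ d) :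
    ∀ {p q} (h : q + (p + 1) = n) {u : A (p + 1) q}, Zigzag S δ d (0 : A 0 n) (p + 1) q h u →
      ∃ a ∈ S p q, d p q a = 0 ∧ δ p q a = u := by
  intro p
  induction p with
  | zero =>
    rintro q h u ⟨a, ha, rfl, hz⟩
    obtain rfl : q + 1 = n := h
    exact ⟨a, ha, hz, rfl⟩
  | succ p ih =>
    rintro q h u ⟨a, ha, rfl, hz⟩
    obtain ⟨a', ha', h1, h2⟩ := ih (q := q + 1) (by omega) hz
    obtain ⟨b, hb, rfl⟩ := hc p q a' ha' h1
    have hδb := hS.δ_mem p q b hb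
    refine ⟨a - δ p q b, sub_mem ha hδb, ?_, ?_⟩
    · rw [map_sub, ← h2, hS.comm p q b hb, sub_self]
    · rw [map_sub, hS.δ_δ p q b hb, sub_zero]

theorem Zigzag.map {A' : ℕ → ℕ → Type*} [∀ p q, AddCommGroup (A' p q)]
    [∀ p q, Module ℂ (A' p q)] {S' : ∀ p q, Submodule ℂ (A' p q)}
    {δ' : ∀ p q, A' p q →ₗ[ℂ] A' (p + 1) q} {d' : ∀ p q, A' p q →ₗ[ℂ] A' p (q + 1)}
    (θ : ∀ p q, A p q →ₗ[ℂ] A' p q) (hS : ∀ p q, ∀ u ∈ S p q, θ p q u ∈ S' p q)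
    (hδ : ∀ p q, ∀ u ∈ S p q, θ (p + 1) q (δ p q u) = δ' p q (θ p q u))
    (hd : ∀ p q, ∀ u ∈ S p q, θ p (q + 1) (d p q u) = d' p q (θ p q u)) {z : A 0 n} :
    ∀ {p q} (h : q + p = n) {u : A p q}, Zigzag S δ d z p q h u →
      Zigzag S' δ' d' (θ 0 n z) p q h (θ p q u) := by
  intro p
  induction p with
  | zero =>
    intro q h u hu
    obtain rfl : q = n := h
    exact congrArg (θ 0 q) hu
  | succ p ih =>
    rintro q h _ ⟨a, ha, rfl, hz⟩
    refine ⟨θ p q a, hS p q a ha, (hδ p q a ha).symm, ?_⟩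
    rw [← hd p q a ha]
    exact ih _ hz

end Zigzag

/-! ### The bar differential with coefficients on both sides -/

section Bar

variable {M V X : Type*}

theorem contractNth_succ_zero {n : ℕ} (op : M → M → M) (m : Fin (n + 2) → M) (j : Fin (n + 1)) :
    Fin.contractNth j.succ op m 0 = m 0 := by
  simp [Fin.contractNth]

theorem contractNth_zero_zero {n : ℕ} (op : M → M → M) (m : Fin (n + 2) → M) :
    Fin.contractNth 0 op m 0 = op (m 0) (m 1) := by
  simp [Fin.contractNth]

theorem contractNth_zero_succ {n : ℕ} (op : M → M → M) (m : Fin (n + 2) → M) (i : Fin n) :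
    Fin.contractNth 0 op m i.succ = m i.succ.succ := by
  simp [Fin.contractNth]

theorem contractNth_succ_succ {n : ℕ} (op : M → M → M) (m : Fin (n + 2) → M) (j : Fin (n + 1))
    (i : Fin n) :
    Fin.contractNth j.succ op m i.succ = Fin.contractNth j op (fun i => m i.succ) i := by
  simp [Fin.contractNth]

theorem contractNth_castSucc_castSucc {n : ℕ} (op : M → M → M) (m : Fin (n + 2) → M)
    (j : Fin (n + 1)) (i : Fin n) :
    Fin.contractNth j.castSucc op m i.castSucc =
      Fin.contractNth j op (fun i => m i.castSucc) i := by
  simp [Fin.contractNth]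

theorem contractNth_castSucc_last {n : ℕ} (op : M → M → M) (m : Fin (n + 2) → M)
    (j : Fin n) :
    Fin.contractNth j.castSucc.castSucc op m (Fin.last n) = m (Fin.last (n + 1)) := by
  have := j.2
  simp only [Fin.contractNth, Fin.val_last, Fin.val_castSucc, Fin.succ_last]
  rw [if_neg (by omega), if_neg (by omega)]

theorem contractNth_last_last {n : ℕ} (op : M → M → M) (m : Fin (n + 2) → M) :
    Fin.contractNth (Fin.last n).castSucc op m (Fin.last n) =
      op (m (Fin.last n).castSucc) (m (Fin.last (n + 1))) := by
  simp [Fin.contractNth]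

theorem contractNth_last_castSucc {n : ℕ} (op : M → M → M) (m : Fin (n + 2) → M) (i : Fin n) :
    Fin.contractNth (Fin.last n).castSucc op m i.castSucc = m i.castSucc.castSucc := by
  simp [Fin.contractNth]

/-- The simplicial identity for inner faces; associativity enters only if `i = j`. -/
theorem contractNth_contractNth [Semigroup M] {n : ℕ} (m : Fin (n + 2) → M)
    {i j : ℕ} (hij : j ≤ i) (hi : i < n + 1) :
    Fin.contractNth (⟨i, hi⟩ : Fin (n + 1)) (· * ·)
        (Fin.contractNth (⟨j, by omega⟩ : Fin (n + 2)) (· * ·) m) =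
      Fin.contractNth (⟨j, by omega⟩ : Fin (n + 1)) (· * ·)
        (Fin.contractNth (⟨i + 1, by omega⟩ : Fin (n + 2)) (· * ·) m) := by
  funext k
  have hk := k.2
  simp only [Fin.contractNth, Fin.val_castSucc, Fin.val_succ]
  split_ifs <;> first | rfl | omega | skip
  all_goals try simp only [Fin.succ_castSucc, mul_assoc]

variable [AddCommGroup V] [Module ℂ V]

/-- The differential of inhomogeneous cochains with values in the functions from `X` to `V`, for
an action `ρ` of `M` on `V` and an action `a` of `M` on `X`. -/
def bar [Mul M] (ρ : M → V →ₗ[ℂ] V) (a : M → X → X) (n : ℕ) :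
    ((Fin n → M) → X → V) →ₗ[ℂ] ((Fin (n + 1) → M) → X → V) where
  toFun f m y := ρ (m 0) (f (fun i => m i.succ) y) +
    ∑ j : Fin n, (-1 : ℂ) ^ ((j : ℕ) + 1) • f (Fin.contractNth j.castSucc (· * ·) m) y +
    (-1 : ℂ) ^ (n + 1) • f (fun i => m i.castSucc) (a (m (Fin.last n)) y)
  map_add' f g := by
    ext m y
    simp only [Pi.add_apply, map_add, smul_add, Finset.sum_add_distrib]
    abel
  map_smul' c f := by
    ext m y
    simp only [Pi.smul_apply, map_smul, smul_add, RingHom.id_apply, Finset.smul_sum,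
      smul_comm c]

theorem bar_apply [Mul M] (ρ : M → V →ₗ[ℂ] V) (a : M → X → X) (n : ℕ)
    (f : (Fin n → M) → X → V) (m : Fin (n + 1) → M) (y : X) :
    bar ρ a n f m y = ρ (m 0) (f (fun i => m i.succ) y) +
    ∑ j : Fin n, (-1 : ℂ) ^ ((j : ℕ) + 1) • f (Fin.contractNth j.castSucc (· * ·) m) y +
    (-1 : ℂ) ^ (n + 1) • f (fun i => m i.castSucc) (a (m (Fin.last n)) y) := rfl

theorem sum_contractNth_contractNth [Semigroup M] {n : ℕ} (φ : (Fin n → M) → V)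
    (m : Fin (n + 2) → M) :
    ∑ j : Fin (n + 1), ∑ i : Fin n, (-1 : ℂ) ^ ((j : ℕ) + 1) • (-1 : ℂ) ^ ((i : ℕ) + 1) •
      φ (Fin.contractNth i.castSucc (· * ·) (Fin.contractNth j.castSucc (· * ·) m)) = 0 := by
  rw [← Finset.sum_product']
  -- The simplicial identity pairs `(j, i)` with `(i + 1, j)` if `j ≤ i`, and with `(i, j - 1)`
  -- otherwise. Paired terms are equal up to sign, and the signs are opposite.
  refine Finset.sum_involution (fun p _ => if h : (p.1 : ℕ) ≤ p.2 then
      (p.2.succ, (⟨p.1, by have := p.2.2; omega⟩ : Fin n)) else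
      (p.2.castSucc, (⟨p.1 - 1, by have := p.1.2; omega⟩ : Fin n))) ?_ ?_ ?_ ?_
  · rintro ⟨j, i⟩ -
    have hi := i.2
    have hj := j.2
    by_cases h : (j : ℕ) ≤ i
    · have e := contractNth_contractNth m h (by omega)
      simp only [h, dif_pos, Fin.val_succ]
      have e' : Fin.contractNth i.castSucc (· * ·) (Fin.contractNth j.castSucc (· * ·) m) =
        Fin.contractNth (⟨j, by omega⟩ : Fin n).castSucc (· * ·)
          (Fin.contractNth i.succ.castSucc (· * ·) m) := e
      rw [e', smul_smul, smul_smul, ← add_smul]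
      convert zero_smul ℂ _
      ring
    · have e := contractNth_contractNth m (i := (j : ℕ) - 1) (j := i) (by omega) (by omega)
      simp only [h, dif_neg, not_false_eq_true, Fin.val_castSucc]
      obtain ⟨k, hk⟩ : ∃ k, (j : ℕ) = k + 1 := ⟨(j : ℕ) - 1, by omega⟩
      have e' : Fin.contractNth i.castSucc (· * ·) (Fin.contractNth j.castSucc (· * ·) m) =
          Fin.contractNth (⟨(j : ℕ) - 1, by omega⟩ : Fin n).castSucc (· * ·)
          (Fin.contractNth i.castSucc.castSucc (· * ·) m) := by
        refine Eq.trans ?_ e.symm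
        have hj' : j.castSucc = (⟨(j : ℕ) - 1 + 1, by omega⟩ : Fin (n + 2)) :=
          Fin.ext (show (j : ℕ) = (j : ℕ) - 1 + 1 by omega)
        rw [hj']
        rfl
      rw [e', smul_smul, smul_smul, ← add_smul]
      convert zero_smul ℂ _
      simp only [hk, Nat.add_sub_cancel]
      ring
  · rintro ⟨j, i⟩ - - h
    by_cases h' : (j : ℕ) ≤ i
    · simp only [h', dif_pos, Prod.mk.injEq, Fin.ext_iff, Fin.val_succ] at h
      omega
    · simp only [h', dif_neg, not_false_eq_true, Prod.mk.injEq, Fin.ext_iff,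
        Fin.val_castSucc] at h
      omega
  · intros; simp
  · rintro ⟨j, i⟩ -
    by_cases h' : (j : ℕ) ≤ i
    · have : ¬ ((i : ℕ) + 1 ≤ j) := by omega
      simp [h', this]
    · have : (i : ℕ) ≤ j - 1 := by omega
      have hj : (j : ℕ) - 1 + 1 = j := by omega
      simp only [h', dif_neg, not_false_eq_true, Fin.val_castSucc, this, dif_pos]
      exact Prod.ext (Fin.ext hj) (Fin.ext rfl)

theorem bar_bar [Semigroup M] (ρ : M → V →ₗ[ℂ] V) (a : M → X → X)
    (hρ : ∀ g h v, ρ (g * h) v = ρ g (ρ h v)) (ha : ∀ g h y, a (g * h) y = a g (a h y)) (n : ℕ)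
    (f : (Fin n → M) → X → V) : bar ρ a (n + 1) (bar ρ a n f) = 0 := by
  funext m y
  have t1 : (fun i : Fin n => Fin.contractNth 0 (· * ·) m i.succ) = fun i => m i.succ.succ :=
    funext fun i => contractNth_zero_succ _ _ _
  have t2 : ∀ j : Fin n, (fun i : Fin n => Fin.contractNth j.castSucc.succ (· * ·) m i.succ) =
      Fin.contractNth j.castSucc (· * ·) fun i => m i.succ := fun j =>
    funext fun i => contractNth_succ_succ _ _ _ _
  have t3 : ∀ j : Fin n, (fun i : Fin n => Fin.contractNth j.castSucc.castSucc (· * ·) m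
      i.castSucc) = Fin.contractNth j.castSucc (· * ·) fun i => m i.castSucc := fun j =>
    funext fun i => contractNth_castSucc_castSucc _ _ _ _
  have t4 : (fun i : Fin n => Fin.contractNth (Fin.last n).castSucc (· * ·) m i.castSucc) =
      fun i => m i.castSucc.castSucc := funext fun i => contractNth_last_castSucc _ _ _
  have hmid := sum_contractNth_contractNth (fun k => f k y) m
  simp only [bar_apply, map_add, map_sum, map_smul, smul_add, Finset.smul_sum,
    Finset.sum_add_distrib]
  -- The inner faces cancel among themselves. The faces `j = 0` and `j = last` are split off: they
  -- contain `ρ (m 0 * m 1)` and `a` of the product of the last two entries, which cancel the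
  -- iterated outer faces.
  rw [hmid, Fin.sum_univ_succ (f := fun j : Fin (n + 1) => (-1 : ℂ) ^ ((j : ℕ) + 1) •
      ρ (Fin.contractNth j.castSucc (· * ·) m 0)
        (f (fun i => Fin.contractNth j.castSucc (· * ·) m i.succ) y)),
    Fin.sum_univ_castSucc (f := fun j : Fin (n + 1) => (-1 : ℂ) ^ ((j : ℕ) + 1) •
      (-1 : ℂ) ^ (n + 1) • f (fun i => Fin.contractNth j.castSucc (· * ·) m i.castSucc)
        (a (Fin.contractNth j.castSucc (· * ·) m (Fin.last n)) y))]
  simp only [← Fin.succ_castSucc, t2, contractNth_succ_zero, Fin.castSucc_zero, t1,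
    contractNth_zero_zero, t3, t4, contractNth_castSucc_last, contractNth_last_last, hρ, ha,
    Fin.val_zero, Fin.val_succ, Fin.val_castSucc, Fin.val_last, Fin.succ_last, Fin.succ_zero_eq_one,
    Pi.zero_apply, Fin.castSucc_zero, smul_smul]
  have e1 : ∀ j : Fin n, (-1 : ℂ) ^ ((j : ℕ) + 1 + 1) = -(-1 : ℂ) ^ ((j : ℕ) + 1) :=
    fun j => by ring
  have e2 : ∀ j : Fin n, (-1 : ℂ) ^ (n + 1 + 1) * (-1 : ℂ) ^ ((j : ℕ) + 1) =
    -((-1 : ℂ) ^ ((j : ℕ) + 1) * (-1 : ℂ) ^ (n + 1)) := fun j => by ring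
  simp only [e1, e2, neg_smul, Finset.sum_neg_distrib]
  have e3 : (-1 : ℂ) ^ (n + 1 + 1) = -(-1 : ℂ) ^ (n + 1) := by ring
  rw [e3]
  simp only [neg_smul, zero_add, pow_one, one_smul, neg_mul]
  abel

end Bar

section Bar

variable {M N V X X' : Type*} [AddCommGroup V] [Module ℂ V]

/-- Restriction of two-sided cochains along maps of both variables. -/
def pull (θ : N → M) (ι : X' → X) (n : ℕ) :
    ((Fin n → M) → X → V) →ₗ[ℂ] ((Fin n → N) → X' → V) where
  toFun f m y := f (fun i => θ (m i)) (ι y)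
  map_add' _ _ := rfl
  map_smul' _ _ := rfl

theorem bar_pull [Mul M] [Mul N] {ρ : M → V →ₗ[ℂ] V} {a : M → X → X} {ρ' : N → V →ₗ[ℂ] V}
    {a' : N → X' → X'} (θ : N → M) (ι : X' → X) (hθ : ∀ g h, θ (g * h) = θ g * θ h)
    (hρ : ∀ g, ρ (θ g) = ρ' g) (ha : ∀ g y, ι (a' g y) = a (θ g) (ι y)) (n : ℕ)
    (f : (Fin n → M) → X → V) :
    bar ρ' a' n (pull θ ι n f) = pull θ ι (n + 1) (bar ρ a n f) := by
  funext m y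
  simp [bar, pull, contractNth_comp θ hθ, hρ, ha]

/-- The two-sided cochain `f * e` for an ordinary cochain `f` and a function `e` of the second
variable. -/
def augment (e : X → ℂ) (n : ℕ) : ((Fin n → M) → V) →ₗ[ℂ] ((Fin n → M) → X → V) where
  toFun f m y := e y • f m
  map_add' f g := by ext m y; simp
  map_smul' c f := by ext m y; simp [smul_comm c]

/-- The hypothesis on `e` turns the action on the second variable into the scalar `ε`, so one-sided
cochains embed as the edge of the double complex. -/
theorem bar_augment [Mul M] {ρ : M → V →ₗ[ℂ] V} {a : M → X → X} {ε : M → ℂ} {e : X → ℂ}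
    (he : ∀ g y, e (a g y) = ε g * e y) (n : ℕ) (f : (Fin n → M) → V) :
    bar ρ a n (augment e n f) = augment e (n + 1) (barD ρ ε n f) := by
  funext m y
  simp only [bar, augment, barD, LinearMap.coe_mk, AddHom.coe_mk, he, map_smul, smul_add,
    Finset.smul_sum, smul_smul]
  congr 1
  · congr 1
    refine Finset.sum_congr rfl fun j _ => ?_
    rw [mul_comm]
  · congr 1
    ring

theorem augment_injective {e : X → ℂ} {y : X} (hy : e y = 1) (n : ℕ) :
    Function.Injective (augment (M := M) (V := V) e n) := fun f g h => by
  funext m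
  have := congrFun (congrFun h m) y
  simpa [augment, hy] using this

/-- Identifies the `δ`-closed elements of the column `p = 0` with equivariant maps. -/
theorem bar_zero_eq_zero_iff [Mul M] {ρ : M → V →ₗ[ℂ] V} {a : M → X → X}
    {f : (Fin 0 → M) → X → V} :
    bar ρ a 0 f = 0 ↔ ∀ x y, f default (a x y) = ρ x (f default y) := by
  constructor
  · intro h x y
    have h1 := congrFun (congrFun h fun _ => x) y
    rw [bar_apply] at h1
    simp only [Finset.univ_eq_empty, Finset.sum_empty, add_zero, zero_add, pow_one, neg_smul,
      one_smul, Pi.zero_apply] at h1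
    rw [Subsingleton.elim (fun _ : Fin 0 => x) default] at h1
    exact (add_neg_eq_zero.1 h1).symm
  · intro h
    funext m y
    rw [bar_apply, Subsingleton.elim (fun i : Fin 0 => m i.succ) default,
      Subsingleton.elim (fun i : Fin 0 => m i.castSucc) default]
    simp [h]

theorem contractNth_snoc_castSucc [Mul M] {n : ℕ} (m : Fin (n + 1) → M) (x : M) (j : Fin n) :
    Fin.contractNth j.castSucc.castSucc (· * ·) (Fin.snoc m x : Fin (n + 2) → M) =
      (Fin.snoc (Fin.contractNth j.castSucc (· * ·) m) x : Fin (n + 1) → M) := by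
  funext k
  refine Fin.lastCases ?_ (fun i => ?_) k
  · rw [contractNth_castSucc_last, Fin.snoc_last, Fin.snoc_last]
  · rw [contractNth_castSucc_castSucc, Fin.snoc_castSucc]
    simp only [Fin.snoc_castSucc]

theorem contractNth_snoc_last [Mul M] {n : ℕ} (m : Fin (n + 1) → M) (x : M) :
    Fin.contractNth (Fin.last n).castSucc (· * ·) (Fin.snoc m x : Fin (n + 2) → M) =
      (Fin.snoc (fun i => m i.castSucc) (m (Fin.last n) * x) : Fin (n + 1) → M) := by
  funext k
  refine Fin.lastCases ?_ (fun i => ?_) k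
  · rw [contractNth_last_last, Fin.snoc_last, Fin.snoc_last, Fin.snoc_castSucc]
  · rw [contractNth_last_castSucc, Fin.snoc_castSucc, Fin.snoc_castSucc]

theorem snoc_succ {n : ℕ} (m : Fin (n + 1) → M) (x : M) :
    (fun i : Fin (n + 1) => (Fin.snoc m x : Fin (n + 2) → M) i.succ) =
      (Fin.snoc (fun i => m i.succ) x : Fin (n + 1) → M) := by
  funext k
  refine Fin.lastCases ?_ (fun i => ?_) k
  · rw [Fin.succ_last, Fin.snoc_last, Fin.snoc_last]
  · rw [Fin.succ_castSucc, Fin.snoc_castSucc, Fin.snoc_castSucc]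

/-- Isolates the only face in which the last entry `x` acts on `y`. Solving for it when the left
side vanishes gives the row contraction. -/
theorem bar_snoc [Mul M] (ρ : M → V →ₗ[ℂ] V) (a : M → X → X) (n : ℕ)
    (f : (Fin (n + 1) → M) → X → V) (m : Fin (n + 1) → M) (x : M) (y : X) :
    bar ρ a (n + 1) f (Fin.snoc m x : Fin (n + 2) → M) y =
      ρ (m 0) (f (Fin.snoc (fun i => m i.succ) x : Fin (n + 1) → M) y) +
      ∑ j : Fin n, (-1 : ℂ) ^ ((j : ℕ) + 1) •
        f (Fin.snoc (Fin.contractNth j.castSucc (· * ·) m) x : Fin (n + 1) → M) y +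
      (-1 : ℂ) ^ (n + 1) • f (Fin.snoc (fun i => m i.castSucc) (m (Fin.last n) * x) :
        Fin (n + 1) → M) y + (-1 : ℂ) ^ n • f m (a x y) := by
  rw [bar_apply, Fin.sum_univ_castSucc, snoc_succ, contractNth_snoc_last]
  simp only [contractNth_snoc_castSucc, Fin.snoc_last, Fin.snoc_castSucc, Fin.val_castSucc,
    Fin.val_last]
  have h0 : (Fin.snoc m x : Fin (n + 2) → M) 0 = m 0 := by
    rw [← Fin.castSucc_zero, Fin.snoc_castSucc]
  have h1 : (-1 : ℂ) ^ (n + 1 + 1) = (-1 : ℂ) ^ n := by ring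
  rw [h0, h1]
  abel

/-- A two-sided cocycle is determined by its values at the basis elements of a free module. -/
theorem eq_of_bar_eq_zero [Mul M] {ρ : M → V →ₗ[ℂ] V} {a : M → X → X} {n : ℕ}
    {f : (Fin (n + 1) → M) → X → V} (hf : bar ρ a (n + 1) f = 0) (m : Fin (n + 1) → M) (x : M)
    (y : X) :
    f m (a x y) = (-1 : ℂ) ^ (n + 1) •
      (ρ (m 0) (f (Fin.snoc (fun i => m i.succ) x : Fin (n + 1) → M) y) +
      ∑ j : Fin n, (-1 : ℂ) ^ ((j : ℕ) + 1) •
        f (Fin.snoc (Fin.contractNth j.castSucc (· * ·) m) x : Fin (n + 1) → M) y +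
      (-1 : ℂ) ^ (n + 1) • f (Fin.snoc (fun i => m i.castSucc) (m (Fin.last n) * x) :
        Fin (n + 1) → M) y) := by
  have h := bar_snoc ρ a n f m x y
  rw [hf] at h
  have h2 : (-1 : ℂ) ^ (n + 1) * (-1 : ℂ) ^ n = -1 := by
    rw [← pow_add, show n + 1 + n = 2 * n + 1 by ring, pow_succ, pow_mul]
    simp
  have h3 := congrArg ((-1 : ℂ) ^ (n + 1) • ·) h
  simp only [Pi.zero_apply, smul_zero] at h3
  rw [smul_add _ _ ((-1 : ℂ) ^ n • _), smul_smul _ ((-1 : ℂ) ^ n), h2, neg_smul, one_smul,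
    ← sub_eq_add_neg] at h3
  exact (sub_eq_zero.1 h3.symm).symm

/-- The cochains which are additive in the second variable. -/
def additiveCochains [AddCommGroup X] (n : ℕ) : Submodule ℂ ((Fin n → M) → X → V) where
  carrier := {f | ∀ m y y', f m (y + y') = f m y + f m y'}
  zero_mem' := by intro m y y'; simp
  add_mem' := by
    intro f g hf hg m y y'
    simp only [Pi.add_apply, hf m y y', hg m y y']
    abel
  smul_mem' := by
    intro c f hf m y y'
    simp only [Pi.smul_apply, hf m y y', smul_add]

theorem additiveCochains.exists_hom [AddCommGroup X] {n : ℕ} {f : (Fin n → M) → X → V}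
    (hf : f ∈ additiveCochains n) (m : Fin n → M) : ∃ φ : X →+ V, ⇑φ = f m :=
  ⟨AddMonoidHom.mk' (f m) (hf m), rfl⟩

theorem pull_mem_additiveCochains [AddCommGroup X] [AddCommGroup X'] {n : ℕ}
    {f : (Fin n → M) → X → V} (hf : f ∈ additiveCochains n) (θ : N → M) (ι : X' →+ X) :
    pull θ ι n f ∈ additiveCochains n := fun m y y' => by
  simp only [pull, LinearMap.coe_mk, AddHom.coe_mk, map_add, hf _]

theorem bar_mem_additiveCochains [Mul M] [AddCommGroup X] {ρ : M → V →ₗ[ℂ] V} {a : M → X → X}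
    (ha : ∀ g y y', a g (y + y') = a g y + a g y') {n : ℕ} {f : (Fin n → M) → X → V}
    (hf : f ∈ additiveCochains n) : bar ρ a n f ∈ additiveCochains (n + 1) := fun m y y' => by
  simp only [bar_apply, hf _, ha, map_add, smul_add, Finset.sum_add_distrib]
  abel

/-- Precomposition with `s₀` is the contraction of the column: `f ∘ d₁ = 0` leaves `f = f ∘ s₀ ∘
d₀`. -/
theorem eq_pull_of_contraction {X₀ X₁ X₂ : Type*} [AddCommGroup X₁] {n : ℕ}
    {f : (Fin n → M) → X₁ → V} (hf : f ∈ additiveCochains n) {d₁ : X₂ → X₁} {d₀ : X₁ → X₀}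
    {s₁ : X₁ → X₂} {s₀ : X₀ → X₁} (hs : ∀ y, d₁ (s₁ y) + s₀ (d₀ y) = y)
    (h : pull (N := M) (fun g => g) d₁ n f = 0) :
    pull (fun g => g) d₀ n (pull (fun g => g) s₀ n f) = f := by
  funext m y
  have h1 : f m (d₁ (s₁ y)) = 0 := congrFun (congrFun h m) (s₁ y)
  calc f m (s₀ (d₀ y)) = f m (d₁ (s₁ y)) + f m (s₀ (d₀ y)) := by rw [h1, zero_add]
    _ = f m y := by rw [← hf, hs]

end Bar

/-! ### Free resolutions -/

/-- A resolution of `ℤ` over `ℤ[G]` by finitely generated free modules; the elements of the `n`-th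
module are the finitely supported functions on `G × Fin (rank n)`. -/
structure FreeRes (G : Type u) [Group G] where
  rank : ℕ → ℕ
  d : ∀ n, ((G × Fin (rank (n + 1))) →₀ ℤ) →ₗ[ℤ] ((G × Fin (rank n)) →₀ ℤ)
  ε : ((G × Fin (rank 0)) →₀ ℤ) →ₗ[ℤ] ℤ
  d_shift : ∀ n g x, d n (shift g x) = shift g (d n x)
  ε_shift : ∀ g x, ε (shift g x) = ε x
  ε_surjective : Function.Surjective ε
  exact_zero : ∀ x, ε x = 0 ↔ ∃ y, d 0 y = x
  exact_succ : ∀ n x, d n x = 0 ↔ ∃ y, d (n + 1) y = x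

section Shift

variable {G T : Type*} [Group G]

theorem shift_single (g h : G) (t : T) (c : ℤ) :
    shift g (Finsupp.single (h, t) c) = Finsupp.single (g * h, t) c := by
  simp [shift, Finsupp.mapDomain_single]

theorem single_eq_shift (g : G) (t : T) (c : ℤ) :
    (Finsupp.single (g, t) c : (G × T) →₀ ℤ) = shift g (Finsupp.single (1, t) c) := by
  rw [shift_single, mul_one]

theorem shift_add (g : G) (x y : (G × T) →₀ ℤ) : shift g (x + y) = shift g x + shift g y :=
  Finsupp.mapDomain_add

theorem shift_mul (g h : G) (x : (G × T) →₀ ℤ) : shift (g * h) x = shift g (shift h x) := by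
  simp only [shift, ← Finsupp.mapDomain_comp]
  congr 1
  funext s
  simp [mul_assoc]

theorem shift_apply (g h : G) (t : T) (x : (G × T) →₀ ℤ) : shift g x (h, t) = x (g⁻¹ * h, t) := by
  have hinj : Function.Injective fun s : G × T => (g * s.1, s.2) := by
    rintro ⟨a, b⟩ ⟨a', b'⟩ h
    simpa using h
  have := Finsupp.mapDomain_apply hinj x (g⁻¹ * h, t)
  simpa [shift] using this

theorem addHom_ext_single {S V : Type*} [AddCommGroup V] {φ ψ : (S →₀ ℤ) →+ V}
    (h : ∀ s, φ (Finsupp.single s 1) = ψ (Finsupp.single s 1)) : φ = ψ :=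
  Finsupp.addHom_ext' fun s => AddMonoidHom.ext_int (by simpa using h s)

end Shift

namespace FreeRes

variable {G : Type u} [Group G] (C : FreeRes G)

theorem d_d (n : ℕ) (x) : C.d n (C.d (n + 1) x) = 0 := (C.exact_succ n _).2 ⟨x, rfl⟩

theorem ε_d (x) : C.ε (C.d 0 x) = 0 := (C.exact_zero _).2 ⟨x, rfl⟩

/-- Projectivity over `ℤ` is enough, because the contraction built from it is only additive. -/
theorem exists_lift_of_forall_exists {X Y Z : Type*} [AddCommGroup X] [AddCommGroup Y]
    [AddCommGroup Z] [Module.Free ℤ Y] (f : X →ₗ[ℤ] Z) (φ : Y →ₗ[ℤ] Z)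
    (h : ∀ y, ∃ x, f x = φ y) : ∃ r : Y →ₗ[ℤ] X, ∀ y, f (r y) = φ y := by
  obtain ⟨r, hr⟩ := Module.projective_lifting_property f.rangeRestrict
    (φ.codRestrict (LinearMap.range f) h) f.surjective_rangeRestrict
  exact ⟨r, fun y => congrArg Subtype.val (LinearMap.congr_fun hr y)⟩

/-- A resolution by free modules has an additive contraction. -/
theorem exists_contraction : ∃ (e : (G × Fin (C.rank 0)) →₀ ℤ)
    (s : ∀ n, ((G × Fin (C.rank n)) →₀ ℤ) →ₗ[ℤ] ((G × Fin (C.rank (n + 1))) →₀ ℤ)),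
    C.ε e = 1 ∧ (∀ x, C.d 0 (s 0 x) + C.ε x • e = x) ∧
    ∀ n x, C.d (n + 1) (s (n + 1) x) + s n (C.d n x) = x := by
  obtain ⟨e, he⟩ := C.ε_surjective 1
  choose r hr using fun n φ (hφ : ∀ y, ∃ x, C.d (n + 1) x = φ y) =>
    exists_lift_of_forall_exists (Y := (G × Fin (C.rank (n + 1))) →₀ ℤ) (C.d (n + 1)) φ hφ
  obtain ⟨s₀, hs₀⟩ := exists_lift_of_forall_exists (C.d 0) (LinearMap.id - C.ε.smulRight e)
    (fun y => (C.exact_zero _).1 (by simp [he]))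
  replace hs₀ : ∀ x, C.d 0 (s₀ x) = x - C.ε x • e := hs₀
  have hstep : ∀ n (s : ((G × Fin (C.rank n)) →₀ ℤ) →ₗ[ℤ] ((G × Fin (C.rank (n + 1))) →₀ ℤ)),
      (∀ x, C.d n (s (C.d n x)) = C.d n x) →
      ∀ y, ∃ x, C.d (n + 1) x = (LinearMap.id - s ∘ₗ C.d n : _ →ₗ[ℤ] _) y := fun n s hs y =>
    (C.exact_succ n _).1 (by simp [hs y])
  -- The recursion carries the identity `d ∘ s ∘ d = d`: it says that `id - s ∘ d` takes values in
  -- cycles, so it lifts in the next degree.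
  let s : ∀ n, {s : ((G × Fin (C.rank n)) →₀ ℤ) →ₗ[ℤ] ((G × Fin (C.rank (n + 1))) →₀ ℤ) //
      ∀ x, C.d n (s (C.d n x)) = C.d n x} := fun n =>
    Nat.rec ⟨s₀, fun x => by rw [hs₀, C.ε_d, zero_smul, sub_zero]⟩
      (fun n s => ⟨r n _ (hstep n s.1 s.2), fun x => by
        rw [hr]
        simp [C.d_d]⟩) n
  refine ⟨e, fun n => (s n).1, he, fun x => ?_, fun n x => ?_⟩
  · change C.d 0 (s₀ x) + _ = x
    rw [hs₀, sub_add_cancel]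
  · have h1 : C.d (n + 1) ((s (n + 1)).1 x) = x - (s n).1 (C.d n x) :=
      hr n _ (hstep n (s n).1 (s n).2) x
    rw [h1, sub_add_cancel]

end FreeRes

noncomputable section

/-! ### Free modules of finite rank over the completed algebra, and completed resolutions. -/

section FreeHAlg

variable {G : Type u} [Group G] (B : BoundingClass) (L : LengthFunction G) {r : ℕ}
variable {V : Type v} [AddCommGroup V] [Module ℂ V] [Bornology V] [Module (HAlg B L) V]
  [BornologicalModule (HAlg B L) V]

/-- The inclusion of a free module over `ℤ[G]` into its completion. -/
def toHAlg : ((G × Fin r) →₀ ℤ) →+ (Fin r → HAlg B L) where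
  toFun x t := WL1.mk (fun g => ((x (g, t) : ℤ) : ℂ)) fun f _ => by
    classical
    refine summable_of_ne_finset_zero (s := x.support.image Prod.fst) fun g hg => ?_
    have : x (g, t) = 0 := by
      by_contra h
      exact hg (Finset.mem_image.2 ⟨(g, t), Finsupp.mem_support_iff.2 h, rfl⟩)
    simp [this]
  map_zero' := by
    funext t
    ext g
    simp
  map_add' x y := by
    funext t
    ext g
    simp

variable {B L}

@[simp] theorem toHAlg_apply (x : (G × Fin r) →₀ ℤ) (t : Fin r) (g : G) :
    (toHAlg B L x t) g = ((x (g, t) : ℤ) : ℂ) := rfl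

theorem of_mul_apply (g h : G) (x : HAlg B L) : WL1.coeff (HAlg.of g * x) h = x (g⁻¹ * h) := by
  change WL1.coeff (WL1.delta g * x : HAlg B L) h = _
  rw [HAlg.delta_mul, HAlg.translate_apply]

theorem toHAlg_shift (g : G) (x : (G × Fin r) →₀ ℤ) :
    toHAlg B L (shift g x) = (HAlg.of g : HAlg B L) • toHAlg B L x := by
  funext t
  ext h
  rw [toHAlg_apply, shift_apply, Pi.smul_apply, smul_eq_mul, of_mul_apply, toHAlg_apply]

theorem toHAlg_single (t : Fin r) :
    toHAlg B L (Finsupp.single (1, t) 1) = Pi.single t (1 : HAlg B L) := by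
  classical
  funext t'
  ext g
  rw [toHAlg_apply]
  by_cases ht : t' = t
  · subst ht
    rw [Pi.single_eq_same, HAlg.one_def]
    by_cases hg : g = 1
    · subst hg; simp
    · rw [WL1.delta_apply_ne hg, Finsupp.single_eq_of_ne (by simpa using hg), Int.cast_zero]
  · rw [Pi.single_eq_of_ne ht, Finsupp.single_eq_of_ne (by simp [ht])]
    simp

theorem hom_ext_toHAlg {W : Type*} [AddCommGroup W] [Module (HAlg B L) W]
    {z z' : (Fin r → HAlg B L) →ₗ[HAlg B L] W}
    (h : ∀ t, z (toHAlg B L (Finsupp.single (1, t) 1)) =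
      z' (toHAlg B L (Finsupp.single (1, t) 1))) : z = z' := by
  refine LinearMap.pi_ext' fun t => LinearMap.ext_ring ?_
  simpa [toHAlg_single] using h t

theorem eq_sum_smul_single (y : Fin r → HAlg B L) :
    y = ∑ t, y t • (Pi.single t 1 : Fin r → HAlg B L) := by
  funext t
  simp [Finset.sum_apply, Pi.single_apply]

/-- Finite rank is essential: `z y` is a finite sum of the bounded maps `y ↦ y t • z e_t`. -/
theorem isBoundedMap_of_linear (z : (Fin r → HAlg B L) →ₗ[HAlg B L] V) : IsBoundedMap z := by
  have : (z : (Fin r → HAlg B L) → V) = fun y => ∑ t, y t • z (Pi.single t 1) := by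
    funext y
    conv_lhs => rw [eq_sum_smul_single y]
    simp only [map_sum, map_smul]
  rw [this]
  exact IsBoundedMap.sum _ fun t _ => (IsBoundedMap.eval t).smul (IsBoundedMap.const _)

/-- An equivariant map out of a free module extends to its completion. -/
theorem exists_linear_extension {W : Type*} [AddCommGroup W] [Module (HAlg B L) W]
    (φ : ((G × Fin r) →₀ ℤ) →+ W)
    (hφ : ∀ g y, φ (shift g y) = (HAlg.of g : HAlg B L) • φ y) :
    ∃ z : (Fin r → HAlg B L) →ₗ[HAlg B L] W, ∀ y, z (toHAlg B L y) = φ y := by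
  refine ⟨Fintype.linearCombination _ fun t => φ (Finsupp.single (1, t) 1), fun y => ?_⟩
  refine DFunLike.congr_fun (f := (Fintype.linearCombination (HAlg B L)
    fun t => φ (Finsupp.single (1, t) 1)).toAddMonoidHom.comp (toHAlg B L)) (g := φ)
    (addHom_ext_single ?_) y
  rintro ⟨g, t⟩
  rw [single_eq_shift, hφ]
  simp [toHAlg_shift, toHAlg_single, Fintype.linearCombination_apply, Pi.single_apply]

end FreeHAlg

namespace FreeRes

variable {G : Type u} [Group G] (C : FreeRes G) (B : BoundingClass) (L : LengthFunction G)

/-- The completion of the `n`-th term of a free resolution. -/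
abbrev P (n : ℕ) : Type u := Fin (C.rank n) → HAlg B L

/-- The boundary maps on the completions. -/
def dP (n : ℕ) : C.P B L (n + 1) →ₗ[HAlg B L] C.P B L n :=
  Fintype.linearCombination _ fun t => toHAlg B L (C.d n (Finsupp.single (1, t) 1))

/-- The augmentation on the completion in degree `0`. -/
def εP : C.P B L 0 →ₗ[ℂ] ℂ :=
  ∑ t, ((C.ε (Finsupp.single (1, t) 1) : ℤ) : ℂ) • (HAlg.augₗ ∘ₗ LinearMap.proj t)

variable {B L}

theorem εP_apply (y : C.P B L 0) :
    C.εP B L y = ∑ t, ((C.ε (Finsupp.single (1, t) 1) : ℤ) : ℂ) * HAlg.aug (y t) := by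
  simp [εP, HAlg.augₗ]

theorem dP_toHAlg (n : ℕ) (x) : C.dP B L n (toHAlg B L x) = toHAlg B L (C.d n x) := by
  refine DFunLike.congr_fun (f := (C.dP B L n).toAddMonoidHom.comp (toHAlg B L))
    (g := (toHAlg B L).comp (C.d n).toAddMonoidHom) (addHom_ext_single ?_) x
  rintro ⟨g, t⟩
  rw [single_eq_shift]
  simp [dP, toHAlg_shift, toHAlg_single, Fintype.linearCombination_apply, Pi.single_apply,
    C.d_shift]

theorem dP_dP (n : ℕ) (x) : C.dP B L n (C.dP B L (n + 1) x) = 0 := by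
  refine LinearMap.congr_fun (f := C.dP B L n ∘ₗ C.dP B L (n + 1)) (g := 0)
    (hom_ext_toHAlg fun t => ?_) x
  simp [dP_toHAlg, C.d_d]

theorem εP_smul (x : HAlg B L) (y : C.P B L 0) :
    C.εP B L (x • y) = HAlg.aug x * C.εP B L y := by
  simp only [εP_apply, Finset.mul_sum, Pi.smul_apply, smul_eq_mul, HAlg.aug_mul]
  exact Finset.sum_congr rfl fun t _ => by ring

theorem εP_toHAlg (x) : C.εP B L (toHAlg B L x) = ((C.ε x : ℤ) : ℂ) := by
  refine DFunLike.congr_fun (f := (C.εP B L).toAddMonoidHom.comp (toHAlg B L))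
    (g := (Int.castAddHom ℂ).comp C.ε.toAddMonoidHom) (addHom_ext_single ?_) x
  rintro ⟨g, t⟩
  have h1 : HAlg.aug (1 : HAlg B L) = 1 := by
    rw [← map_one (HAlg.of (B := B) (L := L)), HAlg.aug_of]
  have h2 : ∀ t', HAlg.aug ((Pi.single t 1 : Fin (C.rank 0) → HAlg B L) t') =
      if t' = t then 1 else 0 := fun t' => by
    by_cases h : t' = t
    · subst h; simp [h1]
    · simp only [Pi.single_eq_of_ne h, h, if_false]
      exact map_zero HAlg.augₗ
  rw [single_eq_shift]
  simp only [AddMonoidHom.comp_apply, LinearMap.toAddMonoidHom_coe, toHAlg_shift, C.εP_smul,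
    HAlg.aug_of, one_mul, toHAlg_single, C.εP_apply, h2, C.ε_shift]
  simp

theorem εP_dP (x) : C.εP B L (C.dP B L 0 x) = 0 := by
  have hx := eq_sum_smul_single x
  rw [hx]
  simp only [map_sum, map_smul, εP_smul, ← toHAlg_single, dP_toHAlg, εP_toHAlg, C.ε_d]
  simp

theorem isBoundedMap_dP (n : ℕ) : IsBoundedMap (C.dP B L n) := isBoundedMap_of_linear _

theorem isBoundedMap_εP : IsBoundedMap (C.εP B L) := by
  have : (C.εP B L : C.P B L 0 → ℂ) = fun y =>
      ∑ t, HAlg.aug (y t) * ((C.ε (Finsupp.single (1, t) 1) : ℤ) : ℂ) := by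
    funext y
    rw [εP_apply]
    exact Finset.sum_congr rfl fun t _ => mul_comm _ _
  rw [this]
  intro s hs
  have hb : ∀ t, ∃ R : ℝ, ∀ y ∈ s, ‖HAlg.aug (y t)‖ ≤ R := fun t => by
    obtain ⟨R, hR⟩ := (HAlg.isBoundedMap_aug.comp (IsBoundedMap.eval t) s hs).exists_norm_le
    exact ⟨R, fun y hy => hR _ ⟨y, hy, rfl⟩⟩
  choose R hR using hb
  refine isBounded_iff_forall_norm_le.2
    ⟨∑ t, R t * ‖((C.ε (Finsupp.single (1, t) 1) : ℤ) : ℂ)‖, ?_⟩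
  rintro _ ⟨y, hy, rfl⟩
  refine (norm_sum_le _ _).trans (Finset.sum_le_sum fun t _ => ?_)
  rw [norm_mul]
  exact mul_le_mul_of_nonneg_right (hR t y hy) (norm_nonneg _)

/-- The completed augmented complex has a bounded linear contraction. -/
def HasContraction (B : BoundingClass) (L : LengthFunction G) : Prop :=
  ∃ (e : C.P B L 0) (s : ∀ n, C.P B L n →ₗ[ℂ] C.P B L (n + 1)),
    (∀ n, IsBoundedMap (s n)) ∧ C.εP B L e = 1 ∧
    (∀ x, C.dP B L 0 (s 0 x) + C.εP B L x • e = x) ∧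
    ∀ n x, C.dP B L (n + 1) (s (n + 1) x) + s n (C.dP B L n x) = x

end FreeRes

/-! ### Bounded multilinear cochains -/

section BoundedMultilinear

variable {G : Type u} [Group G] (B : BoundingClass) (L : LengthFunction G)
variable (V : Type v) [AddCommGroup V] [Module ℂ V] [Bornology V] [Module (HAlg B L) V]
  [BornologicalModule (HAlg B L) V]

variable {B L V} in
-- Linearity slot by slot is easier to verify for the bar differential and for extensions than the
-- existence of a bundled multilinear map.
theorem mem_boundedCochains_iff {n : ℕ} {f : (Fin n → HAlg B L) → V} :
    f ∈ boundedCochains B L V n ↔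
      (∀ m i, IsLinearMap ℂ fun x => f (Function.update m i x)) ∧ IsBoundedMap f := by
  refine and_congr_left fun _ => ⟨?_, fun h => ?_⟩
  · rintro ⟨φ, rfl⟩ m i
    exact ⟨φ.map_update_add m i, fun c x => φ.map_update_smul m i c x⟩
  · refine ⟨⟨f, fun m i x y => ?_, fun m i c x => ?_⟩, rfl⟩
    · convert (h m i).map_add x y
    · convert (h m i).map_smul c x

/-- The cochains of the double complex: bounded maps which are multilinear in the elements of the
algebra and linear in the last variable. -/
def boundedBicochains (n : ℕ) (X : Type*) [AddCommGroup X] [Module ℂ X] [Bornology X] :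
    Submodule ℂ ((Fin n → HAlg B L) → X → V) where
  carrier := {f | (∀ y m i, IsLinearMap ℂ fun x => f (Function.update m i x) y) ∧
    (∀ m, IsLinearMap ℂ (f m)) ∧ IsBoundedMap fun z : (Fin n → HAlg B L) × X => f z.1 z.2}
  zero_mem' := ⟨fun _ _ _ => ⟨by simp, by simp⟩, fun _ => ⟨by simp, by simp⟩,
    IsBoundedMap.const (0 : V)⟩
  add_mem' := by
    intro f g hf hg
    refine ⟨fun y m i => ⟨fun a b => ?_, fun c a => ?_⟩, fun m => ⟨fun a b => ?_, fun c a => ?_⟩,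
      hf.2.2.add hg.2.2⟩
    · simp only [Pi.add_apply, (hf.1 y m i).map_add a b, (hg.1 y m i).map_add a b]
      abel
    · simp only [Pi.add_apply, (hf.1 y m i).map_smul c a, (hg.1 y m i).map_smul c a, smul_add]
    · simp only [Pi.add_apply, (hf.2.1 m).map_add a b, (hg.2.1 m).map_add a b]
      abel
    · simp only [Pi.add_apply, (hf.2.1 m).map_smul c a, (hg.2.1 m).map_smul c a, smul_add]
  smul_mem' := by
    intro c f hf
    refine ⟨fun y m i => ⟨fun a b => ?_, fun c' a => ?_⟩,
      fun m => ⟨fun a b => ?_, fun c' a => ?_⟩, hf.2.2.const_smul c⟩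
    · simp only [Pi.smul_apply, (hf.1 y m i).map_add a b, smul_add]
    · simp only [Pi.smul_apply, (hf.1 y m i).map_smul c' a, smul_comm c]
    · simp only [Pi.smul_apply, (hf.2.1 m).map_add a b, smul_add]
    · simp only [Pi.smul_apply, (hf.2.1 m).map_smul c' a, smul_comm c]

variable {B L}

theorem update_succ_comp {M : Type*} {n : ℕ} (m : Fin (n + 1) → M) (i : Fin n) (x : M) :
    (fun k : Fin n => Function.update m i.succ x k.succ) =
      Function.update (fun k => m k.succ) i x := by
  funext k
  by_cases h : k = i
  · subst h; simp
  · rw [Function.update_of_ne h, Function.update_of_ne (by simpa using h)]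

theorem update_zero_comp {M : Type*} {n : ℕ} (m : Fin (n + 1) → M) (x : M) :
    (fun k : Fin n => Function.update m 0 x k.succ) = fun k => m k.succ := by
  funext k
  rw [Function.update_of_ne (Fin.succ_ne_zero k)]

theorem update_castSucc_comp {M : Type*} {n : ℕ} (m : Fin (n + 1) → M) (i : Fin n) (x : M) :
    (fun k : Fin n => Function.update m i.castSucc x k.castSucc) =
      Function.update (fun k => m k.castSucc) i x := by
  funext k
  by_cases h : k = i
  · subst h; simp
  · rw [Function.update_of_ne h, Function.update_of_ne (by simpa using h)]

theorem update_last_comp {M : Type*} {n : ℕ} (m : Fin (n + 1) → M) (x : M) :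
    (fun k : Fin n => Function.update m (Fin.last n) x k.castSucc) = fun k => m k.castSucc := by
  funext k
  rw [Function.update_of_ne (Fin.castSucc_lt_last k).ne]

/-- A change of one entry changes exactly one entry of the contracted tuple, and does so by a
one-sided multiplication or not at all. This makes inner faces of multilinear maps multilinear. -/
theorem contractNth_update_eq {M : Type*} [Mul M] {n : ℕ} (m : Fin (n + 1) → M) (j : Fin n)
    (i : Fin (n + 1)) : ∃ k : Fin n,
      ((i = j.castSucc ∧ ∀ x, Fin.contractNth j.castSucc (· * ·) (Function.update m i x) =
        Function.update (Fin.contractNth j.castSucc (· * ·) m) k (x * m j.succ)) ∨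
      (i = j.succ ∧ ∀ x, Fin.contractNth j.castSucc (· * ·) (Function.update m i x) =
        Function.update (Fin.contractNth j.castSucc (· * ·) m) k (m j.castSucc * x)) ∨
      ∀ x, Fin.contractNth j.castSucc (· * ·) (Function.update m i x) =
        Function.update (Fin.contractNth j.castSucc (· * ·) m) k x) := by
  have hj := j.2
  have hi := i.2
  rcases lt_trichotomy (i : ℕ) (j : ℕ) with h | h | h
  · refine ⟨⟨i, by omega⟩, Or.inr (Or.inr fun x => funext fun k => ?_)⟩
    simp only [Fin.contractNth, Function.update_apply, Fin.ext_iff, Fin.val_castSucc, Fin.val_succ]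
    split_ifs <;> first | rfl | omega
  · refine ⟨j, Or.inl ⟨Fin.ext h, fun x => funext fun k => ?_⟩⟩
    simp only [Fin.contractNth, Function.update_apply, Fin.ext_iff, Fin.val_castSucc, Fin.val_succ]
    split_ifs <;> first | rfl | omega | skip
    all_goals
      have : k = j := Fin.ext (by omega)
      rw [this]
  · rcases Nat.lt_or_ge (j + 1) i with h' | h'
    · refine ⟨⟨i - 1, by omega⟩, Or.inr (Or.inr fun x => funext fun k => ?_)⟩
      simp only [Fin.contractNth, Function.update_apply, Fin.ext_iff, Fin.val_castSucc,
        Fin.val_succ]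
      split_ifs <;> first | rfl | omega
    · have h2 : (i : ℕ) = j + 1 := by omega
      refine ⟨j, Or.inr (Or.inl ⟨Fin.ext h2, fun x => funext fun k => ?_⟩)⟩
      simp only [Fin.contractNth, Function.update_apply, Fin.ext_iff, Fin.val_castSucc,
        Fin.val_succ]
      split_ifs <;> first | rfl | omega | skip
      all_goals
        have : k = j := Fin.ext (by omega)
        rw [this]

theorem contractNth_update {n : ℕ} (m : Fin (n + 1) → HAlg B L) (j : Fin n) (i : Fin (n + 1)) :
    ∃ (k : Fin n) (l : HAlg B L →ₗ[ℂ] HAlg B L), ∀ x,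
      Fin.contractNth j.castSucc (· * ·) (Function.update m i x) =
        Function.update (Fin.contractNth j.castSucc (· * ·) m) k (l x) := by
  obtain ⟨k, ⟨-, h⟩ | ⟨-, h⟩ | h⟩ := contractNth_update_eq m j i
  · exact ⟨k, LinearMap.mulRight ℂ (m j.succ), h⟩
  · exact ⟨k, LinearMap.mulLeft ℂ (m j.castSucc), h⟩
  · exact ⟨k, LinearMap.id, h⟩

theorem isBoundedMap_contractNth {M : Type*} [Mul M] [Bornology M]
    (hM : IsBoundedMap fun p : M × M => p.1 * p.2) {n : ℕ} (j : Fin n) :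
    IsBoundedMap fun m : Fin (n + 1) → M => Fin.contractNth j.castSucc (· * ·) m := by
  have hev : ∀ i, IsBoundedMap fun m : Fin (n + 1) → M => m i := fun i =>
    IsBoundedMap.eval i
  refine IsBoundedMap.pi fun k => ?_
  rcases lt_trichotomy (k : ℕ) (j : ℕ) with h | h | h
  · simpa only [Fin.contractNth, Fin.val_castSucc, h, if_true] using hev k.castSucc
  · have hmul : IsBoundedMap fun m : Fin (n + 1) → M => m k.castSucc * m k.succ :=
      hM.comp ((hev k.castSucc).prodMk (hev k.succ))
    simpa only [Fin.contractNth, Fin.val_castSucc, h, lt_irrefl, if_false, if_true] using hmul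
  · simpa only [Fin.contractNth, Fin.val_castSucc, h.not_gt, h.ne', if_false] using hev k.succ

variable {V}

theorem IsLinearMap.comp_linear {X Y W : Type*} [AddCommGroup X] [Module ℂ X] [AddCommGroup Y]
    [Module ℂ Y] [AddCommGroup W] [Module ℂ W] {f : Y → W} (hf : IsLinearMap ℂ f)
    (l : X →ₗ[ℂ] Y) : IsLinearMap ℂ fun x => f (l x) :=
  ⟨fun a b => by rw [l.map_add, hf.map_add], fun c a => by rw [l.map_smul, hf.map_smul]⟩

theorem IsLinearMap.linear_comp {X Y W : Type*} [AddCommGroup X] [Module ℂ X] [AddCommGroup Y]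
    [Module ℂ Y] [AddCommGroup W] [Module ℂ W] {f : X → Y} (hf : IsLinearMap ℂ f)
    (l : Y →ₗ[ℂ] W) : IsLinearMap ℂ fun x => l (f x) :=
  ⟨fun a b => by rw [hf.map_add, l.map_add], fun c a => by rw [hf.map_smul, l.map_smul]⟩

theorem IsLinearMap.add' {X W : Type*} [AddCommGroup X] [Module ℂ X] [AddCommGroup W] [Module ℂ W]
    {f g : X → W} (hf : IsLinearMap ℂ f) (hg : IsLinearMap ℂ g) :
    IsLinearMap ℂ fun x => f x + g x :=
  ⟨fun a b => by rw [hf.map_add, hg.map_add]; abel,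
    fun c a => by rw [hf.map_smul, hg.map_smul, smul_add]⟩

theorem IsLinearMap.sum' {ι X W : Type*} [AddCommGroup X] [Module ℂ X] [AddCommGroup W]
    [Module ℂ W] (s : Finset ι) {f : ι → X → W} (hf : ∀ i ∈ s, IsLinearMap ℂ (f i)) :
    IsLinearMap ℂ fun x => ∑ i ∈ s, f i x :=
  ⟨fun a b => by
    rw [← Finset.sum_add_distrib]; exact Finset.sum_congr rfl fun i hi => (hf i hi).map_add a b,
    fun c a => by
    rw [Finset.smul_sum]; exact Finset.sum_congr rfl fun i hi => (hf i hi).map_smul c a⟩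

theorem IsLinearMap.const_smul {X W : Type*} [AddCommGroup X] [Module ℂ X] [AddCommGroup W]
    [Module ℂ W] {f : X → W} (hf : IsLinearMap ℂ f) (c : ℂ) : IsLinearMap ℂ fun x => c • f x :=
  ⟨fun a b => by rw [hf.map_add, smul_add], fun c' a => by rw [hf.map_smul, smul_comm]⟩

theorem isLinearMap_smul_left (w : V) : IsLinearMap ℂ fun x : HAlg B L => x • w :=
  ⟨fun a b => add_smul a b w, fun c a => smul_assoc c a w⟩

variable {X : Type*} [AddCommGroup X] [Module ℂ X] [Bornology X]

theorem boundedBicochains_le_additive {n : ℕ} {f : (Fin n → HAlg B L) → X → V}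
    (hf : f ∈ boundedBicochains B L V n X) : f ∈ additiveCochains n := fun m y y' =>
  (hf.2.1 m).map_add y y'

theorem pull_mem_boundedBicochains {Y : Type*} [AddCommGroup Y] [Module ℂ Y] [Bornology Y] {n : ℕ}
    {f : (Fin n → HAlg B L) → X → V} (hf : f ∈ boundedBicochains B L V n X) (s : Y →ₗ[ℂ] X)
    (hs : IsBoundedMap s) : pull (fun g => g) s n f ∈ boundedBicochains B L V n Y :=
  ⟨fun y m i => hf.1 (s y) m i, fun m => (hf.2.1 m).comp_linear s,
    hf.2.2.comp (IsBoundedMap.fst.prodMk (hs.comp IsBoundedMap.snd))⟩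

theorem augment_mem_boundedBicochains {n : ℕ} {f : (Fin n → HAlg B L) → V}
    (hf : f ∈ boundedCochains B L V n) (e : X →ₗ[ℂ] ℂ) (he : IsBoundedMap e) :
    augment e n f ∈ boundedBicochains B L V n X := by
  rw [mem_boundedCochains_iff] at hf
  refine ⟨fun y m i => (hf.1 m i).const_smul (e y), fun m => ⟨fun a b => ?_, fun c a => ?_⟩,
    (he.comp IsBoundedMap.snd).complex_smul (hf.2.comp IsBoundedMap.fst)⟩
  · simp [augment, add_smul]
  · simp [augment, mul_smul]

theorem apply_mem_boundedCochains {n : ℕ} {f : (Fin n → HAlg B L) → X → V}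
    (hf : f ∈ boundedBicochains B L V n X) (y : X) :
    (fun m => f m y) ∈ boundedCochains B L V n := by
  rw [mem_boundedCochains_iff]
  exact ⟨fun m i => hf.1 y m i,
    hf.2.2.comp (IsBoundedMap.self.prodMk (IsBoundedMap.const y))⟩

theorem bar_mem_boundedBicochains [Module (HAlg B L) X] [CompleteBornological X]
    [IsScalarTower ℂ (HAlg B L) X]
    (hX : IsBoundedMap fun p : HAlg B L × X => p.1 • p.2) {n : ℕ}
    {f : (Fin n → HAlg B L) → X → V} (hf : f ∈ boundedBicochains B L V n X) :
    bar (actH B L V) (fun x (y : X) => x • y) n f ∈ boundedBicochains B L V (n + 1) X := by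
  have hl : ∀ y, IsLinearMap ℂ fun x : HAlg B L => x • (y : X) := fun y =>
    ⟨fun a b => add_smul a b y, fun c a => smul_assoc c a y⟩
  have hr : ∀ x : HAlg B L, IsLinearMap ℂ fun y : X => x • y := fun x =>
    ⟨fun a b => smul_add x a b, fun c a => by rw [smul_algebra_smul_comm]⟩
  refine ⟨fun y m i => ?_, fun m => ?_, ?_⟩
  · simp only [bar_apply]
    refine ((?_ : IsLinearMap ℂ _).add' (IsLinearMap.sum' _ fun j _ => ?_)).add' ?_
    · refine Fin.cases ?_ (fun k => ?_) i
      · simp only [update_zero_comp, Function.update_self]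
        exact isLinearMap_smul_left _
      · simp only [update_succ_comp, Function.update_of_ne (Fin.succ_ne_zero k).symm]
        exact (hf.1 y _ k).linear_comp _
    · obtain ⟨k, l, h⟩ := contractNth_update m j i
      simp only [h]
      exact ((hf.1 y _ k).comp_linear l).const_smul _
    · refine IsLinearMap.const_smul ?_ _
      refine Fin.lastCases ?_ (fun k => ?_) i
      · simp only [update_last_comp, Function.update_self]
        exact (hf.2.1 _).comp_linear (IsLinearMap.mk' _ (hl y))
      · simp only [update_castSucc_comp, Function.update_of_ne (Fin.castSucc_lt_last k).ne']
        exact hf.1 _ _ k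
  · change IsLinearMap ℂ fun y => bar (actH B L V) (fun x (y : X) => x • y) n f m y
    simp only [bar_apply]
    refine (((hf.2.1 _).linear_comp _).add'
      (IsLinearMap.sum' _ fun j _ => (hf.2.1 _).const_smul _)).add' ?_
    exact ((hf.2.1 _).comp_linear (IsLinearMap.mk' _ (hr _))).const_smul _
  · simp only [bar_apply]
    refine (IsBoundedMap.add ?_ (IsBoundedMap.sum _ fun j _ => ?_)).add ?_
    · refine IsBoundedMap.smul ((IsBoundedMap.eval 0).comp IsBoundedMap.fst) ?_
      refine hf.2.2.comp (IsBoundedMap.prodMk ?_ IsBoundedMap.snd)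
      exact IsBoundedMap.pi fun i => (IsBoundedMap.eval i.succ).comp IsBoundedMap.fst
    · refine IsBoundedMap.const_smul _ ?_
      exact hf.2.2.comp (((isBoundedMap_contractNth HAlg.isBoundedMap_mul j).comp
        IsBoundedMap.fst).prodMk IsBoundedMap.snd)
    · refine IsBoundedMap.const_smul _ ?_
      refine hf.2.2.comp (IsBoundedMap.prodMk ?_ ?_)
      · exact IsBoundedMap.pi fun i => (IsBoundedMap.eval i.castSucc).comp IsBoundedMap.fst
      · have hl : IsBoundedMap fun z : (Fin (n + 1) → HAlg B L) × X => z.1 (Fin.last n) :=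
          (IsBoundedMap.eval (Fin.last n)).comp IsBoundedMap.fst
        exact hX.comp (hl.prodMk IsBoundedMap.snd)

end BoundedMultilinear

end

noncomputable section

/-! ### Comparison of bounded and group cohomology by double complexes. -/

section Comparison

variable {M N V : Type*} [Mul M] [Mul N] [AddCommGroup V] [Module ℂ V]
  {ρ : M → V →ₗ[ℂ] V} {ε : M → ℂ} {ρ' : N → V →ₗ[ℂ] V} {ε' : N → ℂ}

theorem comparison_surjective_iff (θ : N → M) (hmul : ∀ a b, θ (a * b) = θ a * θ b)
    (hρ : ∀ a, ρ (θ a) = ρ' a) (hε : ∀ a, ε (θ a) = ε' a)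
    (C : ∀ n, Submodule ℂ ((Fin n → M) → V)) (n : ℕ) :
    Function.Surjective (comparison θ hmul hρ hε C n) ↔
      ∀ f, barD ρ' ε' n f = 0 → ∃ c ∈ cocycles ρ ε C n,
        restrict θ n c - f ∈ coboundaries ρ' ε' (fun _ => ⊤) n := by
  constructor
  · intro h f hf
    obtain ⟨x, hx⟩ := h (Submodule.Quotient.mk ⟨f, trivial, hf⟩)
    obtain ⟨⟨c, hc⟩, rfl⟩ := Submodule.Quotient.mk_surjective _ x
    exact ⟨c, hc, (Submodule.Quotient.eq
      ((coboundaries ρ' ε' (fun _ => ⊤) n).submoduleOf (cocycles ρ' ε' (fun _ => ⊤) n))).1 hx⟩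
  · intro h x
    obtain ⟨⟨f, hf⟩, rfl⟩ := Submodule.Quotient.mk_surjective _ x
    obtain ⟨c, hc, h1⟩ := h f hf.2
    exact ⟨Submodule.Quotient.mk ⟨c, hc⟩, (Submodule.Quotient.eq _).2 h1⟩

theorem comparison_injective_iff (θ : N → M) (hmul : ∀ a b, θ (a * b) = θ a * θ b)
    (hρ : ∀ a, ρ (θ a) = ρ' a) (hε : ∀ a, ε (θ a) = ε' a)
    (C : ∀ n, Submodule ℂ ((Fin n → M) → V)) (n : ℕ) :
    Function.Injective (comparison θ hmul hρ hε C n) ↔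
      ∀ c ∈ cocycles ρ ε C n, restrict θ n c ∈ coboundaries ρ' ε' (fun _ => ⊤) n →
        c ∈ coboundaries ρ ε C n := by
  rw [injective_iff_map_eq_zero]
  constructor
  · intro h c hc h1
    have h2 := h (Submodule.Quotient.mk ⟨c, hc⟩)
      ((Submodule.Quotient.mk_eq_zero _).2 h1)
    exact (Submodule.Quotient.mk_eq_zero
      ((coboundaries ρ ε C n).submoduleOf (cocycles ρ ε C n))).1 h2
  · intro h x hx
    obtain ⟨⟨c, hc⟩, rfl⟩ := Submodule.Quotient.mk_surjective _ x
    refine (Submodule.Quotient.mk_eq_zero _).2 (h c hc ?_)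
    exact (Submodule.Quotient.mk_eq_zero
      ((coboundaries ρ' ε' (fun _ => ⊤) n).submoduleOf (cocycles ρ' ε' (fun _ => ⊤) n))).1 hx

end Comparison

namespace FreeRes

variable {G : Type u} [Group G] (C : FreeRes G) (B : BoundingClass) (L : LengthFunction G)
variable (V : Type v) [AddCommGroup V] [Module ℂ V] [Bornology V] [Module (HAlg B L) V]
  [BornologicalModule (HAlg B L) V]

/-- The bounded double complex of a free resolution. -/
abbrev SH (p q : ℕ) : Submodule ℂ ((Fin p → HAlg B L) → C.P B L q → V) :=
  boundedBicochains B L V p (C.P B L q)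

/-- The horizontal differential of the bounded double complex. -/
abbrev δH (p q : ℕ) : ((Fin p → HAlg B L) → C.P B L q → V) →ₗ[ℂ]
    ((Fin (p + 1) → HAlg B L) → C.P B L q → V) :=
  bar (actH B L V) (fun x y => x • y) p

/-- The vertical differential of the bounded double complex. -/
abbrev dH (p q : ℕ) : ((Fin p → HAlg B L) → C.P B L q → V) →ₗ[ℂ]
    ((Fin p → HAlg B L) → C.P B L (q + 1) → V) :=
  pull (fun g => g) (C.dP B L q) p

/-- The double complex of a free resolution over the group. -/
abbrev SG (p q : ℕ) : Submodule ℂ ((Fin p → G) → ((G × Fin (C.rank q)) →₀ ℤ) → V) :=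
  additiveCochains p

/-- The horizontal differential of the double complex over the group. -/
abbrev δG (p q : ℕ) : ((Fin p → G) → ((G × Fin (C.rank q)) →₀ ℤ) → V) →ₗ[ℂ]
    ((Fin (p + 1) → G) → ((G × Fin (C.rank q)) →₀ ℤ) → V) :=
  bar (actG B L V) shift p

/-- The vertical differential of the double complex over the group. -/
abbrev dG (p q : ℕ) : ((Fin p → G) → ((G × Fin (C.rank q)) →₀ ℤ) → V) →ₗ[ℂ]
    ((Fin p → G) → ((G × Fin (C.rank (q + 1))) →₀ ℤ) → V) :=
  pull (fun g => g) (C.d q) p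

/-- Restriction from the bounded double complex to the double complex over the group. -/
abbrev resHG (p q : ℕ) : ((Fin p → HAlg B L) → C.P B L q → V) →ₗ[ℂ]
    ((Fin p → G) → ((G × Fin (C.rank q)) →₀ ℤ) → V) :=
  pull (HAlg.of (B := B) (L := L)) (toHAlg B L) p

/-- The augmentation of a free resolution with complex values. -/
abbrev εC (y : (G × Fin (C.rank 0)) →₀ ℤ) : ℂ := ((C.ε y : ℤ) : ℂ)

theorem actH_mul (x y : HAlg B L) (v : V) :
    actH B L V (x * y) v = actH B L V x (actH B L V y v) := mul_smul x y v

theorem actG_mul (g h : G) (v : V) :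
    actG B L V (g * h) v = actG B L V g (actG B L V h v) := by
  change (HAlg.of (g * h) : HAlg B L) • v = _
  rw [map_mul, mul_smul]
  rfl

theorem isDoubleComplex_H :
    IsDoubleComplex (C.SH B L V) (C.δH B L V) (C.dH B L V) where
  δ_mem p q u hu := bar_mem_boundedBicochains
    (BornologicalModule.isBoundedMap_smul (A := HAlg B L) (V := C.P B L q)) hu
  d_mem p q u hu := pull_mem_boundedBicochains hu ((C.dP B L q).restrictScalars ℂ)
    (C.isBoundedMap_dP q)
  δ_δ p q u _ := bar_bar _ _ (actH_mul B L V) (fun g h y => mul_smul g h y) p u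
  d_d p q u hu := by
    funext m y
    change u m (C.dP B L q (C.dP B L (q + 1) y)) = 0
    rw [C.dP_dP]
    exact (hu.2.1 m).map_zero
  comm p q u _ := (bar_pull (fun g => g) (C.dP B L q) (fun _ _ => rfl) (fun _ => rfl)
    (fun g y => map_smul _ g y) p u).symm

theorem isDoubleComplex_G :
    IsDoubleComplex (C.SG V) (C.δG B L V) (C.dG V) where
  δ_mem p q u hu := bar_mem_additiveCochains shift_add hu
  d_mem p q u hu := pull_mem_additiveCochains hu (fun g => g) (C.d q).toAddMonoidHom
  δ_δ p q u _ := bar_bar _ _ (actG_mul B L V) shift_mul p u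
  d_d p q u hu := by
    funext m y
    change u m (C.d q (C.d (q + 1) y)) = 0
    rw [C.d_d]
    obtain ⟨φ, hφ⟩ := additiveCochains.exists_hom hu m
    rw [← hφ, map_zero]
  comm p q u _ := (bar_pull (fun g => g) (C.d q) (fun _ _ => rfl) (fun _ => rfl)
    (fun g y => C.d_shift q g y) p u).symm

/-- Since `P q` is free of finite rank, a `δ`-cocycle is determined by its values at the basis
elements, with the coefficient moved into the last algebra slot. Boundedness survives because only
finitely many coordinates occur. -/
theorem rowsExact_H : RowsExact (C.SH B L V) (C.δH B L V) := by
  intro p q u hu hδ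
  -- The contribution of the `t`-th coordinate to the primitive; the sign `(-1) ^ (p + 1)` comes
  -- from `eq_of_bar_eq_zero`.
  let a : Fin (C.rank q) → (Fin p → HAlg B L) → C.P B L q → V := fun t m y =>
    u (Fin.snoc m (y t) : Fin (p + 1) → HAlg B L) (Pi.single t 1)
  have ha : ∀ t, a t ∈ C.SH B L V p q := fun t => by
    refine ⟨fun y m i => ?_, fun m => ?_, ?_⟩
    · simp only [a, Fin.snoc_update]
      exact hu.1 _ _ _
    · have h1 := (hu.1 (Pi.single t 1) (Fin.snoc m 0) (Fin.last p)).comp_linear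
        (LinearMap.proj t : C.P B L q →ₗ[ℂ] HAlg B L)
      simp only [Fin.update_snoc_last] at h1
      exact h1
    · have h2 : IsBoundedMap fun z : (Fin p → HAlg B L) × C.P B L q =>
          (Fin.snoc z.1 (z.2 t) : Fin (p + 1) → HAlg B L) := by
        refine IsBoundedMap.pi fun i => ?_
        refine Fin.lastCases ?_ (fun k => ?_) i
        · simp only [Fin.snoc_last]
          exact (IsBoundedMap.eval t).comp IsBoundedMap.snd
        · simp only [Fin.snoc_castSucc]
          exact (IsBoundedMap.eval k).comp IsBoundedMap.fst
      exact hu.2.2.comp (h2.prodMk (IsBoundedMap.const _))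
  refine ⟨(-1 : ℂ) ^ (p + 1) • ∑ t, a t,
    Submodule.smul_mem _ _ (Submodule.sum_mem _ fun t _ => ha t), ?_⟩
  funext m y
  have h1 : u m y = ∑ t, u m (y t • (Pi.single t 1 : C.P B L q)) := by
    conv_lhs => rw [eq_sum_smul_single y]
    exact map_sum (IsLinearMap.mk' _ (hu.2.1 m)) _ _
  rw [h1, map_smul, map_sum, Pi.smul_apply, Pi.smul_apply, Finset.sum_apply, Finset.sum_apply,
    Finset.smul_sum]
  refine Finset.sum_congr rfl fun t _ => ?_
  rw [eq_of_bar_eq_zero hδ m (y t) (Pi.single t 1)]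
  rfl

theorem rowsExact_G : RowsExact (C.SG V) (C.δG B L V) := by
  intro p q u hu hδ
  let a : (Fin p → G) → ((G × Fin (C.rank q)) →₀ ℤ) → V := fun m y =>
    y.sum fun s c => c • u (Fin.snoc m s.1 : Fin (p + 1) → G) (Finsupp.single (1, s.2) 1)
  have ha : a ∈ C.SG V p q := fun m y y' =>
    Finsupp.sum_add_index' (fun _ => zero_smul _ _) (fun _ _ _ => add_smul _ _ _)
  have ha1 : ∀ m s, a m (Finsupp.single s 1) =
      u (Fin.snoc m s.1 : Fin (p + 1) → G) (Finsupp.single (1, s.2) 1) := fun m s => by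
    simp [a]
  have hmem : (-1 : ℂ) ^ (p + 1) • a ∈ C.SG V p q := Submodule.smul_mem _ _ ha
  refine ⟨_, hmem, ?_⟩
  funext m
  obtain ⟨φ, hφ⟩ := additiveCochains.exists_hom
    (bar_mem_additiveCochains (ρ := actG B L V) shift_add hmem) m
  obtain ⟨ψ, hψ⟩ := additiveCochains.exists_hom hu m
  rw [← hψ, ← hφ]
  congr 1
  -- For fixed `m` both sides are additive in the chain, so comparison at `g` times a basis element
  -- suffices.
  refine addHom_ext_single ?_
  rintro ⟨g, t⟩
  rw [hφ, hψ, map_smul, Pi.smul_apply, Pi.smul_apply]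
  conv_rhs => rw [single_eq_shift, eq_of_bar_eq_zero hδ m g (Finsupp.single (1, t) 1)]
  rw [bar_apply, shift_single]
  simp only [ha1]

omit [Bornology V] in
-- No finiteness of norms is at stake here, so the additive contraction of the uncompleted
-- resolution is enough.
theorem colsExact_G : ColsExact (C.SG V) (C.dG V) := by
  obtain ⟨e, s, -, -, hs⟩ := C.exists_contraction
  intro p q u hu hd
  exact ⟨pull (fun g => g) (s q) p u,
    pull_mem_additiveCochains hu (fun g => g) (s q).toAddMonoidHom,
    eq_pull_of_contraction hu (hs q) hd⟩

variable {C B L} in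
theorem HasContraction.colsExact (hC : C.HasContraction B L) :
    ColsExact (C.SH B L V) (C.dH B L V) := by
  obtain ⟨e, s, hsb, -, -, hs⟩ := hC
  intro p q u hu hd
  exact ⟨pull (fun g => g) (s q) p u, pull_mem_boundedBicochains hu (s q) (hsb q),
    eq_pull_of_contraction (boundedBicochains_le_additive hu) (hs q) hd⟩

variable {B L V}

omit [Bornology V] in
theorem exists_augment_G {p : ℕ} {u : (Fin p → G) → ((G × Fin (C.rank 0)) →₀ ℤ) → V}
    (hu : u ∈ C.SG V p 0) (hd : C.dG V p 0 u = 0) : ∃ c, augment C.εC p c = u := by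
  obtain ⟨e, s, -, hs, -⟩ := C.exists_contraction
  refine ⟨fun m => u m e, ?_⟩
  funext m y
  have h1 : u m (C.d 0 (s 0 y)) = 0 := congrFun (congrFun hd m) _
  obtain ⟨φ, hφ⟩ := additiveCochains.exists_hom hu m
  change ((C.ε y : ℤ) : ℂ) • u m e = u m y
  -- The contraction writes `y` as a boundary plus `ε y • e`, and `u` vanishes on boundaries. So `u`
  -- is the augmentation times its value at `e`.
  conv_rhs => rw [← hs y, hu, h1, zero_add]
  rw [← hφ, map_zsmul, Int.cast_smul_eq_zsmul]

theorem HasContraction.exists_augment {C : FreeRes G} (hC : C.HasContraction B L) {p : ℕ}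
    {u : (Fin p → HAlg B L) → C.P B L 0 → V} (hu : u ∈ C.SH B L V p 0)
    (hd : C.dH B L V p 0 u = 0) :
    ∃ c ∈ boundedCochains B L V p, augment (C.εP B L) p c = u := by
  obtain ⟨e, s, -, -, hs, -⟩ := hC
  refine ⟨fun m => u m e, apply_mem_boundedCochains hu e, ?_⟩
  funext m y
  have h1 : u m (C.dP B L 0 (s 0 y)) = 0 := congrFun (congrFun hd m) _
  change C.εP B L y • u m e = u m y
  conv_rhs => rw [← hs y, (hu.2.1 m).map_add, h1, zero_add]
  rw [(hu.2.1 m).map_smul]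

omit [Bornology V] [Module (HAlg B L) V] [BornologicalModule (HAlg B L) V] in
theorem dH_augment (p : ℕ) (c : (Fin p → HAlg B L) → V) :
    C.dH B L V p 0 (augment (C.εP B L) p c) = 0 := by
  funext m y
  change C.εP B L (C.dP B L 0 y) • c m = 0
  rw [C.εP_dP, zero_smul]

omit [Bornology V] in
theorem dG_augment (p : ℕ) (c : (Fin p → G) → V) :
    C.dG V p 0 (augment C.εC p c) = 0 := by
  funext m y
  change ((C.ε (C.d 0 y) : ℤ) : ℂ) • c m = 0
  rw [C.ε_d, Int.cast_zero, zero_smul]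

theorem δH_augment (p : ℕ) (c : (Fin p → HAlg B L) → V) :
    C.δH B L V p 0 (augment (C.εP B L) p c) =
      augment (C.εP B L) (p + 1) (barD (actH B L V) HAlg.aug p c) :=
  bar_augment C.εP_smul p c

theorem δG_augment (p : ℕ) (c : (Fin p → G) → V) :
    C.δG B L V p 0 (augment C.εC p c) =
      augment C.εC (p + 1) (barD (actG B L V) (fun _ => 1) p c) :=
  bar_augment (fun g y => by rw [εC, C.ε_shift, one_mul]) p c

omit [Bornology V] [Module (HAlg B L) V] [BornologicalModule (HAlg B L) V] in
theorem resHG_augment (p : ℕ) (c : (Fin p → HAlg B L) → V) :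
    C.resHG B L V p 0 (augment (C.εP B L) p c) =
      augment C.εC p (restrict (HAlg.of (B := B) (L := L)) p c) := by
  funext m y
  change C.εP B L (toHAlg B L y) • c (fun i => HAlg.of (m i)) = _
  rw [C.εP_toHAlg]
  rfl

theorem exists_εC_eq_one : ∃ y, C.εC y = 1 := by
  obtain ⟨y, hy⟩ := C.ε_surjective 1
  exact ⟨y, by simp [εC, hy]⟩

theorem exists_εP_eq_one : ∃ y, C.εP B L y = 1 := by
  obtain ⟨y, hy⟩ := C.exists_εC_eq_one
  exact ⟨toHAlg B L y, by rw [C.εP_toHAlg]; exact hy⟩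

omit [Bornology V] in
theorem augment_εC_injective (n : ℕ) :
    Function.Injective (augment (M := G) (V := V) C.εC n) := by
  obtain ⟨y, hy⟩ := C.exists_εC_eq_one
  exact augment_injective hy n

omit [Bornology V] [Module (HAlg B L) V] [BornologicalModule (HAlg B L) V] in
theorem augment_εP_injective (n : ℕ) :
    Function.Injective (augment (M := HAlg B L) (V := V) (C.εP B L) n) := by
  obtain ⟨y, hy⟩ := C.exists_εP_eq_one (B := B) (L := L)
  exact augment_injective hy n

omit [Bornology V] in
theorem augment_mem_SG (p : ℕ) (c : (Fin p → G) → V) : augment C.εC p c ∈ C.SG V p 0 :=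
  fun m y y' => by simp [augment, εC, add_smul]

theorem augment_mem_SH {p : ℕ} {c : (Fin p → HAlg B L) → V} (hc : c ∈ boundedCochains B L V p) :
    augment (C.εP B L) p c ∈ C.SH B L V p 0 :=
  augment_mem_boundedBicochains hc (C.εP B L) C.isBoundedMap_εP

theorem Zigzag.resHG {n : ℕ} {z : (Fin 0 → HAlg B L) → C.P B L n → V} {p q : ℕ} {h : q + p = n}
    {u : (Fin p → HAlg B L) → C.P B L q → V}
    (hz : Zigzag (C.SH B L V) (C.δH B L V) (C.dH B L V) z p q h u) :
    Zigzag (C.SG V) (C.δG B L V) (C.dG V) (C.resHG B L V 0 n z) p q h (C.resHG B L V p q u) := by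
  refine hz.map (C.resHG B L V) (fun p q u hu => ?_) (fun p q u _ => ?_) (fun p q u _ => ?_)
  · exact pull_mem_additiveCochains (boundedBicochains_le_additive hu) _ _
  · exact (bar_pull _ _ (map_mul _) (fun _ => rfl) toHAlg_shift p u).symm
  · funext m y
    change u _ (C.dP B L q (toHAlg B L y)) = u _ (toHAlg B L (C.d q y))
    rw [C.dP_toHAlg]

/-- The equivariant maps in the double complex over the group extend to the completions. -/
theorem exists_extension {n : ℕ} {z : (Fin 0 → G) → ((G × Fin (C.rank n)) →₀ ℤ) → V}
    (hz : z ∈ C.SG V 0 n) (hδ : C.δG B L V 0 n z = 0) :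
    ∃ φ : C.P B L n →ₗ[HAlg B L] V, C.resHG B L V 0 n (fun _ => φ) = z := by
  obtain ⟨ψ, hψ⟩ := additiveCochains.exists_hom hz default
  obtain ⟨φ, hφ⟩ := exists_linear_extension (B := B) (L := L) ψ (fun g y => by
    rw [hψ]
    exact bar_zero_eq_zero_iff.1 hδ g y)
  refine ⟨φ, funext fun m => funext fun y => ?_⟩
  rw [Subsingleton.elim m default, ← hψ]
  exact hφ y

theorem const_mem_SH {n : ℕ} (φ : C.P B L n →ₗ[HAlg B L] V) :
    (fun _ => φ : (Fin 0 → HAlg B L) → C.P B L n → V) ∈ C.SH B L V 0 n :=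
  ⟨fun _ _ i => i.elim0, fun _ => ⟨map_add φ, fun c y => map_smul (φ.restrictScalars ℂ) c y⟩,
    (isBoundedMap_of_linear φ).comp IsBoundedMap.snd⟩

theorem δH_const {n : ℕ} (φ : C.P B L n →ₗ[HAlg B L] V) :
    C.δH B L V 0 n (fun _ => φ) = 0 :=
  bar_zero_eq_zero_iff.2 fun x y => map_smul φ x y

theorem exists_eq_const {n : ℕ} {z : (Fin 0 → HAlg B L) → C.P B L n → V}
    (hz : z ∈ C.SH B L V 0 n) (hδ : C.δH B L V 0 n z = 0) :
    ∃ φ : C.P B L n →ₗ[HAlg B L] V, z = fun _ => ⇑φ :=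
  ⟨{ toFun := z default
     map_add' := (hz.2.1 default).map_add
     map_smul' := bar_zero_eq_zero_iff.1 hδ }, funext fun m => by
      rw [Subsingleton.elim m default]; rfl⟩

omit [Bornology V] [BornologicalModule (HAlg B L) V] in
theorem eq_of_resHG_eq {n : ℕ} {φ ψ : C.P B L n →ₗ[HAlg B L] V}
    (h : C.resHG B L V 0 n (fun _ => φ) = C.resHG B L V 0 n (fun _ => ψ)) : φ = ψ :=
  hom_ext_toHAlg fun t => congrFun (congrFun h default) (Finsupp.single (1, t) 1)

variable {C} in
-- A group cocycle is moved to an equivariant cocycle on the resolution by the rows over `G`; its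
-- `H`-linear extension is moved back to a bounded bar cocycle by the columns over `H`.
theorem HasContraction.comparisonMap_surjective (hC : C.HasContraction B L) (n : ℕ) :
    Function.Surjective (comparisonMap B L V n) := by
  refine (comparison_surjective_iff _ _ _ _ _ n).2 fun f hf => ?_
  replace hf : barD (actG B L V) (fun _ => 1) n f = 0 := hf
  have hG := C.isDoubleComplex_G B L V
  obtain ⟨zG, hz, hδz, hdz, hzig⟩ := (C.rowsExact_G B L V).exists_target hG (n := n)
    (p := n) (q := 0) (zero_add n) (C.augment_mem_SG n f) (by rw [C.δG_augment, hf, map_zero])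
    (C.dG_augment n f)
  obtain ⟨z, rfl⟩ := C.exists_extension (B := B) (L := L) hz hδz
  have hdz' : C.dH B L V 0 n (fun _ => z) = 0 := by
    have : z ∘ₗ C.dP B L n = 0 := hom_ext_toHAlg fun t => by
      rw [LinearMap.comp_apply, C.dP_toHAlg]
      exact congrFun (congrFun hdz default) (Finsupp.single (1, t) 1)
    funext m y
    exact LinearMap.congr_fun this y
  obtain ⟨w, hw, hδw, hdw, hzw⟩ := (hC.colsExact V).exists_source (C.isDoubleComplex_H B L V)
    (C.const_mem_SH z) (C.δH_const z) hdz' (p := n) (q := 0) (zero_add n)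
  obtain ⟨c, hc, rfl⟩ := hC.exists_augment hw hdw
  rw [C.δH_augment] at hδw
  refine ⟨c, ⟨hc, C.augment_εP_injective (n + 1) (hδw.trans (map_zero _).symm)⟩, ?_⟩
  -- Both zigzags over `G` end in the same equivariant map, so the difference of the bar cocycles is
  -- linked to zero and is a coboundary by exactness of the columns over `G`.
  have h1 := (Zigzag.resHG C hzw).sub _ hzig
  rw [sub_self, C.resHG_augment, ← map_sub] at h1
  cases n with
  | zero => exact C.augment_εC_injective 0 ((zigzag_zero_iff.1 h1).trans (map_zero _).symm)
  | succ n =>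
    obtain ⟨a, ha, hda, h2⟩ := (C.colsExact_G V).source_boundary hG _ h1
    obtain ⟨b, rfl⟩ := C.exists_augment_G ha hda
    rw [C.δG_augment] at h2
    exact ⟨b, trivial, C.augment_εC_injective (n + 1) h2⟩

variable {C} in
theorem HasContraction.comparisonMap_injective (hC : C.HasContraction B L) (n : ℕ) :
    Function.Injective (comparisonMap B L V n) := by
  refine (comparison_injective_iff _ _ _ _ _ n).2 fun c hc hres => ?_
  have hG := C.isDoubleComplex_G B L V
  have hH := C.isDoubleComplex_H B L V
  cases n with
  | zero =>
    -- In degree zero there are no coboundaries, and a cochain on the empty tuple is unchanged by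
    -- restriction.
    refine (Submodule.mem_bot ℂ).2 (funext fun m => ?_)
    have h1 : restrict (HAlg.of (B := B) (L := L)) 0 c = 0 := hres
    rw [Subsingleton.elim m fun i => (HAlg.of (B := B) (L := L)) ((default : Fin 0 → G) i)]
    exact congrFun h1 default
  | succ n =>
    obtain ⟨b, -, hb⟩ := hres
    replace hb : barD (actG B L V) (fun _ => 1) n b =
      restrict (HAlg.of (B := B) (L := L)) (n + 1) c := hb
    obtain ⟨F, hF, hδF, -, hzig⟩ := (C.rowsExact_H B L V).exists_target hH
      (p := n + 1) (q := 0) (zero_add _) (C.augment_mem_SH hc.1)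
      (by rw [C.δH_augment]; exact (congrArg _ hc.2).trans (map_zero _)) (C.dH_augment _ c)
    have h1 := Zigzag.resHG C hzig
    rw [C.resHG_augment, ← hb, ← C.δG_augment] at h1
    have h2 := h1.sub _ (zigzag_source_boundary (S := C.SG V) (δ := C.δG B L V) (d := C.dG V)
      (zero_add (n + 1)) (C.augment_mem_SG n b) (C.dG_augment n b))
    rw [sub_self, sub_zero] at h2
    -- The restriction of `F` is linked to zero, so it is the coboundary of an equivariant `y`. The
    -- `H`-linear extension `ψ` of `y` exhibits `F` as a coboundary over `H` as well, and exactness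
    -- of the columns carries this back to `c`.
    obtain ⟨y, hy, hδy, hdy⟩ := (C.rowsExact_G B L V).target_boundary hG h2
    obtain ⟨ψ, rfl⟩ := C.exists_extension (B := B) (L := L) hy hδy
    obtain ⟨φ, rfl⟩ := C.exists_eq_const hF hδF
    have h3 : ψ ∘ₗ C.dP B L n = φ := C.eq_of_resHG_eq (by
      rw [← hdy]
      funext m y
      change ψ (C.dP B L n (toHAlg B L y)) = ψ (toHAlg B L (C.d n y))
      rw [C.dP_toHAlg])
    have h4 := zigzag_target_boundary (S := C.SH B L V) (δ := C.δH B L V) (d := C.dH B L V)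
      (C.const_mem_SH ψ) (C.δH_const ψ) (p := n) (q := 0) (zero_add _)
    have h5 : C.dH B L V 0 n (fun _ => ψ) = fun _ => ⇑φ := by
      rw [← h3]; rfl
    rw [h5] at h4
    have h6 := hzig.sub _ h4
    rw [sub_self, sub_zero] at h6
    obtain ⟨a, ha, hda, h7⟩ := (hC.colsExact V).source_boundary hH _ h6
    obtain ⟨c', hc', rfl⟩ := hC.exists_augment ha hda
    rw [C.δH_augment] at h7
    exact ⟨c', hc', C.augment_εP_injective (n + 1) h7⟩

/-- The data which surjectivity of the comparison map provides for a cocycle on the completed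
resolution. -/
theorem exists_zigzag_of_surjective {n : ℕ} (hs : Function.Surjective (comparisonMap B L V n))
    (z : C.P B L n →ₗ[HAlg B L] V) (hz : ∀ y, z (C.dP B L n y) = 0) :
    ∃ (c : (Fin n → HAlg B L) → V) (f : (Fin n → G) → V) (F : C.P B L n →ₗ[HAlg B L] V),
      restrict (HAlg.of (B := B) (L := L)) n c - f ∈
        coboundaries (actG B L V) (fun _ => 1) (fun _ => ⊤) n ∧
      Zigzag (C.SH B L V) (C.δH B L V) (C.dH B L V) (fun _ => F) n 0 (zero_add n)
        (augment (C.εP B L) n c) ∧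
      Zigzag (C.SG V) (C.δG B L V) (C.dG V)
        (C.resHG B L V 0 n (fun _ => F) - C.resHG B L V 0 n (fun _ => z)) n 0 (zero_add n)
        (augment C.εC n (restrict (HAlg.of (B := B) (L := L)) n c - f)) := by
  have hG := C.isDoubleComplex_G B L V
  have hH := C.isDoubleComplex_H B L V
  obtain ⟨u, hu, hδu, hdu, hzu⟩ := (C.colsExact_G V).exists_source hG
    (z := C.resHG B L V 0 n (fun _ => z))
    (pull_mem_additiveCochains (boundedBicochains_le_additive (C.const_mem_SH z)) _ _)
    (bar_zero_eq_zero_iff.2 fun g y => by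
      change z (toHAlg B L (shift g y)) = (HAlg.of g : HAlg B L) • z (toHAlg B L y)
      rw [toHAlg_shift, map_smul])
    (by
      funext m y
      change z (toHAlg B L (C.d n y)) = 0
      rw [← C.dP_toHAlg, hz])
    (p := n) (q := 0) (zero_add n)
  obtain ⟨f, rfl⟩ := C.exists_augment_G hu hdu
  rw [C.δG_augment] at hδu
  obtain ⟨c, hc, hcf⟩ := (comparison_surjective_iff _ _ _ _ _ n).1 hs f
    (C.augment_εC_injective (n + 1) (hδu.trans (map_zero _).symm))
  obtain ⟨F, hF, hδF, -, hzF⟩ := (C.rowsExact_H B L V).exists_target hH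
    (p := n) (q := 0) (zero_add _) (C.augment_mem_SH hc.1)
    (by rw [C.δH_augment]; exact (congrArg _ hc.2).trans (map_zero _)) (C.dH_augment _ c)
  obtain ⟨φ, rfl⟩ := C.exists_eq_const hF hδF
  refine ⟨c, f, φ, hcf, hzF, ?_⟩
  have h1 := (Zigzag.resHG C hzF).sub _ hzu
  rw [C.resHG_augment] at h1
  rw [map_sub (augment C.εC n)]
  exact h1

theorem exists_eq_εP_smul_of_surjective (hs : Function.Surjective (comparisonMap B L V 0))
    (z : C.P B L 0 →ₗ[HAlg B L] V) (hz : ∀ y, z (C.dP B L 0 y) = 0) :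
    ∃ v, ∀ y, z y = C.εP B L y • v := by
  obtain ⟨c, f, F, h1, h2, h3⟩ := C.exists_zigzag_of_surjective hs z hz
  have h4 : restrict (HAlg.of (B := B) (L := L)) 0 c - f = 0 := h1
  rw [h4, map_zero] at h3
  have h5 : F = z := C.eq_of_resHG_eq (sub_eq_zero.1 (zigzag_zero_iff.1 h3).symm)
  refine ⟨c default, fun y => ?_⟩
  rw [← h5]
  exact (congrFun (congrFun (zigzag_zero_iff.1 h2) default) y).symm

/-- The cocycle `z` differs from `F` by an equivariant coboundary `ψ ∘ d`, and `F = a ∘ d` by the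
last step of the zigzag. So `σ = a - ψ`, bounded but only `ℂ`-linear. -/
theorem exists_factorization_of_surjective {n : ℕ}
    (hs : Function.Surjective (comparisonMap B L V (n + 1)))
    (z : C.P B L (n + 1) →ₗ[HAlg B L] V) (hz : ∀ y, z (C.dP B L (n + 1) y) = 0) :
    ∃ σ : C.P B L n →ₗ[ℂ] V, IsBoundedMap σ ∧ ∀ y, σ (C.dP B L n y) = z y := by
  obtain ⟨c, f, F, ⟨b, -, hb⟩, h2, h3⟩ := C.exists_zigzag_of_surjective hs z hz
  rw [← hb, ← C.δG_augment] at h3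
  have h4 := h3.sub _ (zigzag_source_boundary (S := C.SG V) (δ := C.δG B L V) (d := C.dG V)
      (zero_add (n + 1)) (C.augment_mem_SG n b) (C.dG_augment n b))
  rw [sub_self, sub_zero] at h4
  obtain ⟨y, hy, hδy, hdy⟩ :=
    (C.rowsExact_G B L V).target_boundary (C.isDoubleComplex_G B L V) h4
  obtain ⟨ψ, rfl⟩ := C.exists_extension (B := B) (L := L) hy hδy
  have h5 : F = z + ψ ∘ₗ C.dP B L n := C.eq_of_resHG_eq (by
    rw [eq_add_of_sub_eq hdy.symm]
    funext m y
    change ψ (toHAlg B L (C.d n y)) + z (toHAlg B L y) =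
      z (toHAlg B L y) + ψ (C.dP B L n (toHAlg B L y))
    rw [C.dP_toHAlg, add_comm])
  obtain ⟨a, ha, hda⟩ := h2.exists_d_eq
  refine ⟨IsLinearMap.mk' _ (ha.2.1 default) - ψ.restrictScalars ℂ, ?_, fun y => ?_⟩
  · exact (ha.2.2.comp ((IsBoundedMap.const default).prodMk IsBoundedMap.self)).sub
      (isBoundedMap_of_linear ψ)
  · have h6 : a default (C.dP B L n y) = F y := congrFun (congrFun hda default) y
    change a default (C.dP B L n y) - ψ (C.dP B L n y) = z y
    rw [h6, h5]
    simp

end FreeRes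

end

noncomputable section

/-! ### Quotients of bornological modules. -/

section Quotient

variable {A : Type u} [Ring A] [Algebra ℂ A] [Bornology A]
variable {X : Type u} [AddCommGroup X] [Module ℂ X] [Bornology X] [Module A X]
  [BornologicalModule A X]

/-- The quotient of a bornological module, in a possibly larger universe. -/
def BornQuotient (N : Submodule A X) : Type (max u v) := ULift.{v} (X ⧸ N)

namespace BornQuotient

variable (N : Submodule A X)

instance : AddCommGroup (BornQuotient.{u, v} N) := inferInstanceAs (AddCommGroup (ULift (X ⧸ N)))

instance : Module A (BornQuotient.{u, v} N) := inferInstanceAs (Module A (ULift (X ⧸ N)))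

instance : Module ℂ (BornQuotient.{u, v} N) := inferInstanceAs (Module ℂ (ULift (X ⧸ N)))

instance : IsScalarTower ℂ A (BornQuotient.{u, v} N) :=
  inferInstanceAs (IsScalarTower ℂ A (ULift (X ⧸ N)))

/-- The projection to the quotient. -/
def proj : X →ₗ[A] BornQuotient.{u, v} N := ULift.moduleEquiv.symm.toLinearMap ∘ₗ N.mkQ

omit [Algebra ℂ A] [Bornology A] [Module ℂ X] [Bornology X] [BornologicalModule A X] in
theorem proj_surjective : Function.Surjective (proj.{u, v} N) :=
  ULift.moduleEquiv.symm.surjective.comp N.mkQ_surjective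

variable {N} in
omit [Algebra ℂ A] [Bornology A] [Module ℂ X] [Bornology X] [BornologicalModule A X] in
theorem proj_eq_zero_iff {x : X} : proj.{u, v} N x = 0 ↔ x ∈ N := by
  rw [← Submodule.Quotient.mk_eq_zero]
  exact ULift.moduleEquiv.symm.map_eq_zero_iff (x := (Submodule.Quotient.mk x : X ⧸ N))

theorem proj_smul (c : ℂ) (x : X) : proj.{u, v} N (c • x) = c • proj N x := rfl

/-- The bounded sets of the quotient are the subsets of images of bounded sets. -/
instance : Bornology (BornQuotient.{u, v} N) :=
  Bornology.ofBounded {S | ∃ S' : Set X, Bornology.IsBounded S' ∧ S ⊆ proj N '' S'}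
    ⟨∅, Bornology.isBounded_empty, Set.empty_subset _⟩
    (fun _ ⟨S', h, h1⟩ _ h2 => ⟨S', h, h2.trans h1⟩)
    (fun _ ⟨S', h, h1⟩ _ ⟨T', h', h2⟩ => ⟨S' ∪ T', h.union h', by
      rw [Set.image_union]; exact Set.union_subset_union h1 h2⟩)
    (fun y => by
      obtain ⟨x, rfl⟩ := proj_surjective N y
      exact ⟨{x}, Bornology.isBounded_singleton, by simp⟩)

variable {N}

theorem isBounded_iff {S : Set (BornQuotient.{u, v} N)} :
    Bornology.IsBounded S ↔ ∃ S' : Set X, Bornology.IsBounded S' ∧ S ⊆ proj N '' S' :=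
  Bornology.isBounded_ofBounded_iff _

theorem isBoundedMap_proj : IsBoundedMap (proj.{u, v} N) := fun S hS =>
  isBounded_iff.2 ⟨S, hS, subset_rfl⟩

theorem isBoundedMap_of_comp_proj {Y : Type*} [Bornology Y] {f : BornQuotient.{u, v} N → Y}
    (hf : IsBoundedMap fun x => f (proj N x)) : IsBoundedMap f := fun S hS => by
  obtain ⟨S', h, h1⟩ := isBounded_iff.1 hS
  refine (hf S' h).subset ((Set.image_mono h1).trans ?_)
  rw [Set.image_image]

/-- The quotient by the kernel of a bounded map to a complete space is complete. -/
theorem bornologicalModule {Y : Type u} [AddCommGroup Y] [Module ℂ Y] [Bornology Y]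
    [CompleteBornological Y] (f : X →ₗ[ℂ] Y) (hf : IsBoundedMap f) (hN : ∀ x, x ∈ N ↔ f x = 0) :
    BornologicalModule A (BornQuotient.{u, v} N) where
  exists_disc S hS := by
    obtain ⟨S', h, h1⟩ := isBounded_iff.1 hS
    obtain ⟨E, _, _, _, i, -, hb, hsub⟩ := CompleteBornological.exists_disc S' h
    let K : Submodule ℂ E := LinearMap.ker (f ∘ₗ i)
    have hK : IsClosed (K : Set E) := by
      refine isClosed_of_closure_subset fun x hx => ?_
      refine CompleteBornological.eq_zero_of_isBounded (c := fun n => (n : ℝ))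
        tendsto_natCast_atTop_atTop ((hf _ (hb 1)).subset ?_)
      rintro _ ⟨n, rfl⟩
      -- With `k` in the kernel at distance below `1 / (n + 1)` from `x`, the vector `n • (x - k)`
      -- is in the unit ball and has image `n • f (i x)`. These multiples form a bounded set, so `f
      -- (i x) = 0` by separation.
      obtain ⟨k, hk, hxk⟩ := Metric.mem_closure_iff.1 hx (1 / ((n : ℝ) + 1)) (by positivity)
      refine ⟨i ((n : ℂ) • (x - k)), ⟨_, ?_, rfl⟩, ?_⟩
      · rw [mem_closedBall_zero_iff, norm_smul, Complex.norm_natCast, ← dist_eq_norm]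
        have : (n : ℝ) * (1 / ((n : ℝ) + 1)) ≤ 1 := by
          rw [mul_one_div, div_le_one (by positivity)]
          linarith
        exact (mul_le_mul_of_nonneg_left hxk.le (by positivity)).trans this
      · have hk0 : f (i k) = 0 := hk
        simp [hk0]
    have := hK
    let q : E →ₗ[ℂ] BornQuotient.{u, v} N :=
      { toFun := fun e => proj N (i e)
        map_add' := fun a b => by rw [map_add, map_add]
        map_smul' := fun c a => by rw [map_smul, proj_smul, RingHom.id_apply] }
    have hq : LinearMap.ker q = K := by
      ext e
      exact proj_eq_zero_iff.trans (hN _)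
    let j : (E ⧸ K) →ₗ[ℂ] BornQuotient.{u, v} N := K.liftQ q hq.ge
    have hj : ∀ e, j (Submodule.Quotient.mk e) = proj N (i e) := fun e => rfl
    refine ⟨ULift.{v} (E ⧸ K), inferInstance, inferInstance, inferInstance,
      j ∘ₗ ULift.moduleEquiv.toLinearMap, ?_, fun r => ?_, ?_⟩
    · refine Function.Injective.comp (g := j) ?_ (ULift.moduleEquiv (R := ℂ)).injective
      rw [← LinearMap.ker_eq_bot]
      exact Submodule.ker_liftQ_eq_bot _ _ _ hq.le
    · refine (isBoundedMap_proj _ (hb (r + 1))).subset ?_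
      rintro _ ⟨⟨e⟩, he, rfl⟩
      rw [mem_closedBall_zero_iff] at he
      obtain ⟨e', rfl, he'⟩ := Submodule.Quotient.norm_mk_lt e zero_lt_one
      have he2 : ‖(Submodule.Quotient.mk e' : E ⧸ K)‖ ≤ r := he
      exact ⟨i e', ⟨e', by rw [mem_closedBall_zero_iff]; linarith, rfl⟩, (hj e').symm⟩
    · intro s hs
      obtain ⟨x, hx, rfl⟩ := h1 hs
      obtain ⟨e, he, rfl⟩ := hsub hx
      refine ⟨ULift.up (Submodule.Quotient.mk e), ?_, hj e⟩
      rw [mem_closedBall_zero_iff] at *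
      exact (Submodule.Quotient.norm_mk_le (S := K) e).trans he
  isBoundedMap_smul S hS := by
    obtain ⟨h1, h2⟩ := Bornology.isBounded_image_fst_and_snd.2 hS
    obtain ⟨T, hT, hsub⟩ := isBounded_iff.1 h2
    refine isBounded_iff.2 ⟨_,
      BornologicalModule.isBoundedMap_smul (A := A) (V := X) _ (h1.prod hT), ?_⟩
    rintro _ ⟨⟨a, y⟩, hp, rfl⟩
    obtain ⟨x, hx, hxy⟩ := hsub ⟨_, hp, rfl⟩
    refine ⟨a • x, ⟨(a, x), ⟨⟨_, hp, rfl⟩, hx⟩, rfl⟩, ?_⟩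
    rw [map_smul, hxy]

theorem exists_descend {Y : Type*} [AddCommGroup Y] [Module ℂ Y] [Bornology Y] (f : X →ₗ[ℂ] Y)
    (hf : IsBoundedMap f) (hN : ∀ x ∈ N, f x = 0) :
    ∃ g : BornQuotient.{u, v} N →ₗ[ℂ] Y, IsBoundedMap g ∧ ∀ x, g (proj N x) = f x := by
  let g : (X ⧸ N) →+ Y := QuotientAddGroup.lift N.toAddSubgroup f.toAddMonoidHom hN
  have hg : ∀ x : X, g (Submodule.Quotient.mk x) = f x := fun _ => rfl
  let g' : BornQuotient.{u, v} N →ₗ[ℂ] Y :=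
    { toFun := fun y => g y.down
      map_add' := fun a b => g.map_add _ _
      map_smul' := fun c y => by
        obtain ⟨x, rfl⟩ := proj_surjective N y
        exact f.map_smul c x }
  exact ⟨g', isBoundedMap_of_comp_proj hf, hg⟩

end BornQuotient

end Quotient

/-! ### A bounded contraction from surjectivity of the comparison map. -/

namespace FreeRes

variable {G : Type u} [Group G] (C : FreeRes G) {B : BoundingClass} {L : LengthFunction G}

theorem exists_εP_smul_eq (hs : ComparisonSurjective.{u, v} B L) {k : ℕ}
    (f : C.P B L 0 →ₗ[ℂ] C.P B L k) (hf : IsBoundedMap f) (N : Submodule (HAlg B L) (C.P B L 0))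
    (hN : ∀ x, x ∈ N ↔ f x = 0) (hd : ∀ x, f (C.dP B L 0 x) = 0) :
    ∃ v, ∀ y, f y = C.εP B L y • v := by
  have := BornQuotient.bornologicalModule.{u, v} f hf hN
  obtain ⟨w, hw⟩ := C.exists_eq_εP_smul_of_surjective (hs (BornQuotient.{u, v} N) 0)
    (BornQuotient.proj N) fun y => BornQuotient.proj_eq_zero_iff.2 ((hN _).2 (hd y))
  obtain ⟨g, -, hg⟩ := BornQuotient.exists_descend.{u, v} f hf fun x hx => (hN x).1 hx
  exact ⟨g w, fun y => by rw [← hg, hw, map_smul]⟩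

/-- The coefficients are the quotient by the kernel of `f`, complete because `f` is bounded. The
projection factors as `σ ∘ d`, and composing `σ` with the map induced by `f` keeps the values in the
image of `f`. -/
theorem exists_factorization (hs : ComparisonSurjective.{u, v} B L) {m k : ℕ}
    (f : C.P B L (m + 1) →ₗ[ℂ] C.P B L k) (hf : IsBoundedMap f)
    (N : Submodule (HAlg B L) (C.P B L (m + 1)))
    (hN : ∀ x, x ∈ N ↔ f x = 0) (hd : ∀ x, f (C.dP B L (m + 1) x) = 0) :
    ∃ t : C.P B L m →ₗ[ℂ] C.P B L k, IsBoundedMap t ∧ (∀ y, t (C.dP B L m y) = f y) ∧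
      ∀ x, ∃ y, t x = f y := by
  have := BornQuotient.bornologicalModule.{u, v} f hf hN
  obtain ⟨σ, hσ, h1⟩ := C.exists_factorization_of_surjective (hs (BornQuotient.{u, v} N) (m + 1))
    (BornQuotient.proj N) fun y => BornQuotient.proj_eq_zero_iff.2 ((hN _).2 (hd y))
  obtain ⟨g, hgb, hg⟩ := BornQuotient.exists_descend.{u, v} f hf fun x hx => (hN x).1 hx
  refine ⟨g ∘ₗ σ, hgb.comp hσ, fun y => ?_, fun x => ?_⟩
  · rw [LinearMap.comp_apply, h1, hg]
  · obtain ⟨y, hy⟩ := BornQuotient.proj_surjective N (σ x)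
    exact ⟨y, by rw [LinearMap.comp_apply, ← hy, hg]⟩

/-- Surjectivity of the comparison maps makes every completed free resolution contractible. -/
theorem hasContraction_of_comparisonSurjective (hs : ComparisonSurjective.{u, v} B L) :
    C.HasContraction B L := by
  have h1 : ∀ n, ∃ t : C.P B L n →ₗ[ℂ] C.P B L n, IsBoundedMap t ∧
      (∀ y, t (C.dP B L n y) = C.dP B L n y) ∧ ∀ x, ∃ y, t x = C.dP B L n y := fun n =>
    C.exists_factorization hs ((C.dP B L n).restrictScalars ℂ) (C.isBoundedMap_dP n)
      (LinearMap.ker (C.dP B L n)) (fun _ => Iff.rfl) (C.dP_dP n)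
  choose t htb htd htr using h1
  let f : ∀ n, C.P B L n →ₗ[ℂ] C.P B L n := fun n => LinearMap.id - t n
  have hf : ∀ n x, f n x = x - t n x := fun _ _ => rfl
  -- The image of `d` becomes the kernel of the bounded map `id - t`, which makes the quotient by it
  -- complete and permits the second factorization.
  have hk : ∀ n x, x ∈ LinearMap.range (C.dP B L n) ↔ f n x = 0 := fun n x => by
    rw [hf, sub_eq_zero]
    constructor
    · rintro ⟨y, rfl⟩
      exact (htd n y).symm
    · intro h
      obtain ⟨y, hy⟩ := htr n x
      exact ⟨y, by rw [← hy, ← h]⟩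
  have hb : ∀ n, IsBoundedMap (f n) := fun n => IsBoundedMap.self.sub (htb n)
  have hd : ∀ n x, f n (C.dP B L n x) = 0 := fun n x => (hk n _).1 ⟨x, rfl⟩
  have h2 : ∀ n, ∃ s : C.P B L n →ₗ[ℂ] C.P B L (n + 1), IsBoundedMap s ∧
      (∀ y, s (C.dP B L n y) = f (n + 1) y) ∧ ∀ x, ∃ y, s x = f (n + 1) y := fun n =>
    C.exists_factorization hs _ (hb (n + 1)) (LinearMap.range (C.dP B L (n + 1))) (hk (n + 1))
      (hd (n + 1))
  choose s hsb hsd hsr using h2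
  obtain ⟨e, he⟩ := C.exists_εP_smul_eq hs _ (hb 0) (LinearMap.range (C.dP B L 0)) (hk 0) (hd 0)
  -- Write `t x = d y`. Then `s (d y) = y - t y`, and `t y` is a boundary, so applying `d` returns
  -- `d y`.
  have hds : ∀ n x, C.dP B L n (s n (t n x)) = t n x := fun n x => by
    obtain ⟨y, hy⟩ := htr n x
    obtain ⟨y', hy'⟩ := htr (n + 1) y
    rw [hy, hsd, hf, map_sub, hy', C.dP_dP, sub_zero]
  -- Composing with `t` makes `d ∘ s ∘ t = t` hold on the whole module, while `s ∘ t ∘ d = s ∘ d =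
  -- id - t`. The two add up to the identity.
  refine ⟨e, fun n => s n ∘ₗ t n, fun n => (hsb n).comp (htb n), ?_, fun x => ?_, fun n x => ?_⟩
  · obtain ⟨y, hy⟩ := C.exists_εP_eq_one (B := B) (L := L)
    obtain ⟨y', hy'⟩ := htr 0 y
    have h3 := congrArg (C.εP B L) (he y)
    rw [hf, map_sub, hy', C.εP_dP, hy, one_smul] at h3
    rw [← h3, sub_zero]
  · rw [LinearMap.comp_apply, hds, ← he, hf]
    abel
  · rw [LinearMap.comp_apply, hds, LinearMap.comp_apply, htd, hsd, LinearMap.sub_apply,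
      LinearMap.id_apply]
    abel

end FreeRes

end

noncomputable section

open scoped Pointwise

/-! ### Properness of the length function. -/

section Pairing

variable {B : BoundingClass} {G : Type u} [Group G] {L : LengthFunction G} {D : G → ℕ} {m : ℕ}

theorem summable_pairing (hD : ∀ g, D g ≤ m) (x : HAlg B L) :
    Summable fun h => x h * (D h : ℂ) := by
  refine Summable.of_norm_bounded (x.summable_norm.mul_right (m : ℝ)) fun h => ?_
  rw [norm_mul, Complex.norm_natCast]
  exact mul_le_mul_of_nonneg_left (by exact_mod_cast hD h) (norm_nonneg _)

/-- Integration of a bounded function on the group. -/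
def pairing (hD : ∀ g, D g ≤ m) : HAlg B L →ₗ[ℂ] ℂ where
  toFun x := ∑' h, x h * (D h : ℂ)
  map_add' x y := by
    rw [← (summable_pairing hD x).tsum_add (summable_pairing hD y)]
    exact tsum_congr fun h => add_mul _ _ _
  map_smul' c x := by
    rw [RingHom.id_apply, smul_eq_mul, ← tsum_mul_left]
    exact tsum_congr fun h => mul_assoc _ _ _

theorem mul_of_apply (x : HAlg B L) (k h : G) :
    WL1.coeff (x * HAlg.of k) h = x (h * k⁻¹) := by
  rw [HAlg.mul_apply, tsum_eq_single (h * k⁻¹)]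
  · have : (HAlg.of k : HAlg B L) ((h * k⁻¹)⁻¹ * h) = 1 := by
      rw [mul_inv_rev, inv_inv, inv_mul_cancel_right]
      exact WL1.delta_apply_self k
    rw [this, mul_one]
  · intro g hg
    have : (HAlg.of k : HAlg B L) (g⁻¹ * h) = 0 := WL1.delta_apply_ne fun h1 => hg (by
      rw [← h1]; group)
    rw [this, mul_zero]

/-- The difference pairs `x` with `h ↦ D (h * k) - D h`, which is at most `1` in absolute value. The
bound is thus independent of the truncation `m`. -/
theorem norm_pairing_mul_of_sub_le (hD : ∀ g, D g ≤ m) {k : G}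
    (hk : ∀ g, D (g * k) ≤ D g + 1 ∧ D g ≤ D (g * k) + 1) (x : HAlg B L) :
    ‖pairing hD (x * HAlg.of k) - pairing hD x‖ ≤ wnorm L (fun _ => 1) x := by
  have h1 : pairing hD (x * HAlg.of k) = ∑' h, x h * (D (h * k) : ℂ) := by
    change ∑' h, WL1.coeff (x * HAlg.of k) h * (D h : ℂ) = _
    rw [← (Equiv.mulRight k).tsum_eq]
    exact tsum_congr fun h => by simp [mul_of_apply]
  have h2 : Summable fun h => x h * (D (h * k) : ℂ) :=
    summable_pairing (D := fun h => D (h * k)) (fun g => hD _) x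
  have h3 : pairing hD x = ∑' h, x h * (D h : ℂ) := rfl
  rw [h1, h3, ← h2.tsum_sub (summable_pairing hD x)]
  have hle : ∀ h, ‖x h * (D (h * k) : ℂ) - x h * (D h : ℂ)‖ ≤ ‖x h‖ * 1 := fun h => by
    rw [← mul_sub, norm_mul]
    refine mul_le_mul_of_nonneg_left ?_ (norm_nonneg _)
    have h4 : ((D (h * k) : ℤ) - (D h : ℤ)).natAbs ≤ 1 := by
      have := hk h
      omega
    have h5 : (D (h * k) : ℂ) - (D h : ℂ) = (((D (h * k) : ℤ) - (D h : ℤ) : ℤ) : ℂ) := by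
      push_cast; rfl
    rw [h5, Complex.norm_intCast, ← Int.cast_abs, Int.abs_eq_natAbs]
    exact_mod_cast h4
  exact tsum_of_norm_bounded (x.summable B.one_mem).hasSum hle

/-- The distance from `1` in the Cayley graph of `U`, truncated at `m`. -/
def truncDist (U : Set G) (m : ℕ) (g : G) : ℕ := sInf {j | g ∈ U ^ j ∨ j = m}

theorem truncDist_mem (U : Set G) (m : ℕ) (g : G) :
    g ∈ U ^ truncDist U m g ∨ truncDist U m g = m :=
  Nat.sInf_mem (s := {j | g ∈ U ^ j ∨ j = m}) ⟨m, Or.inr rfl⟩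

theorem truncDist_le (U : Set G) (m : ℕ) (g : G) : truncDist U m g ≤ m :=
  Nat.sInf_le (Or.inr rfl)

theorem truncDist_mul_le {U : Set G} (m : ℕ) (g : G) {k : G} (hk : k ∈ U) :
    truncDist U m (g * k) ≤ truncDist U m g + 1 := by
  rcases truncDist_mem U m g with h | h
  · exact Nat.sInf_le (Or.inl (by rw [pow_succ]; exact Set.mul_mem_mul h hk))
  · rw [h]
    exact (truncDist_le U m _).trans (Nat.le_succ m)

theorem truncDist_one (U : Set G) (m : ℕ) : truncDist U m 1 = 0 :=
  Nat.le_zero.1 (Nat.sInf_le (Or.inl (by simp)))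

end Pairing

namespace FreeRes

variable {G : Type u} [Group G] {C : FreeRes G} {B : BoundingClass} {L : LengthFunction G}

theorem exists_ε_single_ne_zero (C : FreeRes G) : ∃ t, C.ε (Finsupp.single (1, t) 1) ≠ 0 := by
  by_contra! h
  have h0 : C.ε.toAddMonoidHom = 0 := addHom_ext_single fun s => by
    rw [show s = (s.1, s.2) from rfl, single_eq_shift]
    exact (C.ε_shift _ _).trans (h _)
  obtain ⟨x, hx⟩ := C.ε_surjective 1
  have := DFunLike.congr_fun h0 x
  exact one_ne_zero (hx.symm.trans this)

/-- The length function is proper if a completed free resolution is contractible. -/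
theorem HasContraction.finite_setOf_le (hC : C.HasContraction B L) (R : ℝ≥0) :
    {g | L g ≤ R}.Finite := by
  classical
  obtain ⟨e, s, hs, -, hs0, -⟩ := hC
  obtain ⟨t₀, ht₀⟩ := C.exists_ε_single_ne_zero
  let ε' : Fin (C.rank 0) → ℤ := fun t => C.ε (Finsupp.single (1, t) 1)
  -- The finitely many group elements in the boundaries of the basis `1`-chains, with their
  -- inverses, define the word distance. Including `L 1` in the radius below puts the elements for
  -- `g = 1` into `A`.
  let c : ∀ t : Fin (C.rank 1), (G × Fin (C.rank 0)) →₀ ℤ := fun t =>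
    C.d 0 (Finsupp.single (1, t) 1)
  let S : Set G := ⋃ t, ((c t).support.image Prod.fst : Finset G)
  have hS : S.Finite := Set.finite_iUnion fun t => Finset.finite_toSet _
  let U : Set G := S ∪ S⁻¹
  have hU : U.Finite := hS.union hS.inv
  let K : Fin (C.rank 1) → ℝ := fun t => ∑ p ∈ (c t).support, |((c t p * ε' p.2 : ℤ) : ℝ)|
  have hK : ∀ t, 0 ≤ K t := fun t => Finset.sum_nonneg fun _ _ => abs_nonneg _
  let A : Set (C.P B L 0) := {y | ∃ g, L g ≤ max R (L 1) ∧ y = Pi.single t₀ (HAlg.of g)}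
  have hA : Bornology.IsBounded A := by
    rw [← Bornology.forall_isBounded_image_eval_iff]
    intro t
    rw [WL1.isBounded_iff]
    intro f hf
    refine ⟨f (max R (L 1)), ?_⟩
    rintro _ ⟨_, ⟨g, hg, rfl⟩, rfl⟩
    by_cases ht : t = t₀
    · subst ht
      rw [Function.eval, Pi.single_eq_same, wnorm, tsum_eq_single g]
      · have : WL1.coeff (HAlg.of g : HAlg B L) g = 1 := WL1.delta_apply_self g
        rw [this, norm_one, one_mul]
        exact B.mono f hf hg
      · intro h hh
        have : WL1.coeff (HAlg.of g : HAlg B L) h = 0 := WL1.delta_apply_ne hh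
        rw [this, norm_zero, zero_mul]
    · rw [Function.eval, Pi.single_eq_of_ne ht]
      simpa [wnorm] using (B.pos f hf _).le
  have hM : ∀ t, ∃ M : ℝ, ∀ y ∈ A, wnorm L (fun _ => 1) (WL1.coeff (s 0 y t)) ≤ M := fun t => by
    obtain ⟨M, hM⟩ := WL1.isBounded_iff.1
      ((IsBoundedMap.eval t).comp (hs 0) A hA) _ B.one_mem
    exact ⟨M, fun y hy => hM _ ⟨y, hy, rfl⟩⟩
  choose M hM using hM
  -- The constants `K` and `M` do not involve `m`, so the truncation level may be chosen beyond the
  -- bound they give.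
  obtain ⟨m, hm⟩ := exists_nat_gt (2 * ∑ t, K t * M t)
  let D := truncDist U m
  have hD : ∀ g, D g ≤ m := truncDist_le U m
  have hstep : ∀ t, ∀ p ∈ (c t).support, ∀ g, D (g * p.1) ≤ D g + 1 ∧ D g ≤ D (g * p.1) + 1 := by
    intro t p hp g
    have hp1 : p.1 ∈ S := Set.mem_iUnion.2 ⟨t, by
      rw [Finset.mem_coe]; exact Finset.mem_image_of_mem _ hp⟩
    refine ⟨truncDist_mul_le m g (Or.inl hp1), ?_⟩
    have := truncDist_mul_le m (g * p.1) (k := p.1⁻¹) (U := U) (Or.inr (by simpa using hp1))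
    rwa [mul_inv_cancel_right] at this
  let φ : C.P B L 0 →ₗ[ℂ] ℂ := ∑ t, (ε' t : ℂ) • (pairing hD ∘ₗ LinearMap.proj t)
  have hφ : ∀ y, φ y = ∑ t, (ε' t : ℂ) * pairing hD (y t) := fun y => by simp [φ]
  have hφs : ∀ t (x : HAlg B L), φ (Pi.single t x) = (ε' t : ℂ) * pairing hD x := fun t x => by
    rw [hφ, Finset.sum_eq_single t]
    · rw [Pi.single_eq_same]
    · intro t' _ ht'
      rw [Pi.single_eq_of_ne ht', map_zero, mul_zero]
    · simp
  have hεc : ∀ y : (G × Fin (C.rank 0)) →₀ ℤ, C.ε y = ∑ p ∈ y.support, y p * ε' p.2 := by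
    intro y
    conv_lhs => rw [← Finsupp.sum_single y, Finsupp.sum, map_sum]
    refine Finset.sum_congr rfl fun p _ => ?_
    rw [show p = (p.1, p.2) from rfl, single_eq_shift, C.ε_shift,
      ← mul_one (y (p.1, p.2)), ← smul_eq_mul, ← Finsupp.smul_single, map_smul]
    simp [ε']
  have hsingle : ∀ (x : HAlg B L) (p : G × Fin (C.rank 0)) (a : ℤ),
      φ (x • toHAlg B L (Finsupp.single p a)) =
        ((a * ε' p.2 : ℤ) : ℂ) * pairing hD (x * HAlg.of p.1) := by
    rintro x ⟨g, t⟩ a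
    have h1 : toHAlg B L (Finsupp.single (g, t) a) = (a : ℂ) • Pi.single t (HAlg.of g) := by
      have h2 : (Finsupp.single (g, t) a : (G × Fin (C.rank 0)) →₀ ℤ) =
        a • shift g (Finsupp.single (1, t) 1) := by rw [shift_single]; simp
      rw [h2, map_zsmul, toHAlg_shift, toHAlg_single, Int.cast_smul_eq_zsmul]
      congr 1
      rw [← Pi.single_smul', smul_eq_mul, mul_one]
    rw [h1, smul_algebra_smul_comm, map_smul, ← Pi.single_smul', hφs, smul_eq_mul, smul_eq_mul]
    push_cast
    ring
  have hbound : ∀ t (x : HAlg B L), ‖φ (x • toHAlg B L (c t))‖ ≤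
      K t * wnorm L (fun _ => 1) x := by
    intro t x
    -- The augmentation of a boundary is zero, so `pairing hD x` may be subtracted in every term;
    -- only differences of `D` along generators remain.
    have h1 : φ (x • toHAlg B L (c t)) =
        ∑ p ∈ (c t).support, ((c t p * ε' p.2 : ℤ) : ℂ) *
          (pairing hD (x * HAlg.of p.1) - pairing hD x) := by
      conv_lhs => rw [← Finsupp.sum_single (c t), Finsupp.sum, map_sum, Finset.smul_sum, map_sum]
      simp only [mul_sub, Finset.sum_sub_distrib, hsingle]
      rw [← Finset.sum_mul, ← Int.cast_sum, ← hεc, C.ε_d]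
      simp
    rw [h1, Finset.sum_mul]
    refine (norm_sum_le _ _).trans (Finset.sum_le_sum fun p hp => ?_)
    rw [norm_mul, Complex.norm_intCast]
    exact mul_le_mul_of_nonneg_left (norm_pairing_mul_of_sub_le hD (hstep t p hp) x)
      (abs_nonneg _)
  have hd : ∀ y ∈ A, ‖φ (C.dP B L 0 (s 0 y))‖ ≤ ∑ t, K t * M t := by
    intro y hy
    have h1 : C.dP B L 0 (s 0 y) = ∑ t, s 0 y t • toHAlg B L (c t) := by
      simp [dP, Fintype.linearCombination_apply, c]
    rw [h1, map_sum]
    refine (norm_sum_le _ _).trans (Finset.sum_le_sum fun t _ => (hbound t _).trans ?_)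
    exact mul_le_mul_of_nonneg_left (hM t y hy) (hK t)
  have hεA : ∀ g, C.εP B L (Pi.single t₀ (HAlg.of g)) = (ε' t₀ : ℂ) := fun g => by
    have : (Pi.single t₀ (HAlg.of g) : C.P B L 0) =
        (HAlg.of g : HAlg B L) • toHAlg B L (Finsupp.single (1, t₀) 1) := by
      rw [toHAlg_single, ← Pi.single_smul', smul_eq_mul, mul_one]
    rw [this, C.εP_smul, C.εP_toHAlg, HAlg.aug_of, one_mul]
  have hpair : ∀ g, pairing hD (HAlg.of g : HAlg B L) = (D g : ℂ) := fun g => by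
    change ∑' h, WL1.coeff (HAlg.of g : HAlg B L) h * (D h : ℂ) = _
    rw [tsum_eq_single g]
    · have : WL1.coeff (HAlg.of g : HAlg B L) g = 1 := WL1.delta_apply_self g
      rw [this, one_mul]
    · intro h hh
      have : WL1.coeff (HAlg.of g : HAlg B L) h = 0 := WL1.delta_apply_ne hh
      rw [this, zero_mul]
  have hval : ∀ g, L g ≤ max R (L 1) →
      ‖(ε' t₀ : ℂ) * (D g : ℂ) - ε' t₀ * φ e‖ ≤ ∑ t, K t * M t := by
    intro g hg
    have h1 := hs0 (Pi.single t₀ (HAlg.of g))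
    have h2 := congrArg φ (eq_sub_of_add_eq h1)
    rw [map_sub, map_smul, hεA, hφs, hpair, smul_eq_mul] at h2
    rw [← h2]
    exact hd _ ⟨g, hg, rfl⟩
  have hUp : ∀ j, (U ^ j).Finite := fun j => by
    induction j with
    | zero => simp
    | succ j ih => rw [pow_succ]; exact ih.mul hU
  refine (Set.Finite.biUnion (Set.finite_lt_nat m) fun j _ => hUp j).subset fun g hg => ?_
  -- Comparison with `g = 1`, where `D` vanishes, eliminates `φ e`. Since `ε' t₀` is a nonzero
  -- integer, `D g < m`; the truncation is not reached and `g` lies in the finite set `U ^ D g`.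
  have h1 := hval g (le_max_of_le_left hg)
  have h2 := hval 1 (le_max_right _ _)
  have h0 : D 1 = 0 := truncDist_one U m
  rw [h0, Nat.cast_zero, mul_zero] at h2
  have h3 : (D g : ℝ) < m := by
    have h4 : ‖(ε' t₀ : ℂ) * (D g : ℂ)‖ ≤ 2 * ∑ t, K t * M t := by
      have h5 := norm_sub_le ((ε' t₀ : ℂ) * (D g : ℂ) - ε' t₀ * φ e) (0 - ε' t₀ * φ e)
      rw [sub_sub_sub_cancel_right, sub_zero] at h5
      linarith
    rw [norm_mul, Complex.norm_natCast, Complex.norm_intCast] at h4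
    have h6 : (1 : ℝ) ≤ |((ε' t₀ : ℤ) : ℝ)| := by
      rw [← Int.cast_abs]
      exact_mod_cast Int.one_le_abs ht₀
    nlinarith [Nat.cast_nonneg (α := ℝ) (D g)]
  have h4 : D g < m := by exact_mod_cast h3
  refine Set.mem_biUnion h4 ?_
  exact (truncDist_mem U m g).resolve_right h4.ne

end FreeRes

end

noncomputable section

open scoped Pointwise

/-! ### Nice resolutions as completed free resolutions. -/

namespace WL1

variable {B : BoundingClass} {G : Type u} [Group G] {L : LengthFunction G} {r : ℕ}
  {w : G × Fin r → ℝ≥0}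

theorem exists_coord_bound (hw : ∃ a : ℝ≥0, ∀ g t, L g ≤ a * w (g, t)) {f : ℝ≥0 → ℝ}
    (hf : f ∈ B.carrier) : ∃ h ∈ B.carrier, ∀ g t, f (L g) ≤ h (w (g, t)) := by
  obtain ⟨a, ha⟩ := hw
  obtain ⟨h, hh, hle⟩ := B.exists_dilate hf a 0
  exact ⟨h, hh, fun g t => (B.mono f hf (by simpa using ha g t)).trans (hle _)⟩

theorem exists_basis_bound (hw : ∃ a b : ℝ≥0, ∀ g t, w (g, t) ≤ a * L g + b) {f : ℝ≥0 → ℝ}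
    (hf : f ∈ B.carrier) : ∃ h ∈ B.carrier, ∀ g t, f (w (g, t)) ≤ h (L g) := by
  obtain ⟨a, b, hab⟩ := hw
  obtain ⟨h, hh, hle⟩ := B.exists_dilate hf a b
  exact ⟨h, hh, fun g t => (B.mono f hf (hab g t)).trans (hle _)⟩

/-- A weight on a free module of finite rank which is comparable to the length function gives the
same completion as the length function. -/
def equivPi (h₁ : ∃ a : ℝ≥0, ∀ g t, L g ≤ a * w (g, t))
    (h₂ : ∃ a b : ℝ≥0, ∀ g t, w (g, t) ≤ a * L g + b) :
    WL1 B w ≃ₗ[ℂ] (Fin r → HAlg B L) where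
  toFun x t := mk (fun g => x (g, t)) fun f hf => by
    obtain ⟨h, hh, hle⟩ := exists_coord_bound h₁ hf
    refine Summable.of_nonneg_of_le (fun g => mul_nonneg (norm_nonneg _) (B.pos f hf _).le)
      (fun g => mul_le_mul_of_nonneg_left (hle g t) (norm_nonneg _))
      ((x.summable hh).comp_injective (i := fun g => (g, t)) fun a b hab => (Prod.ext_iff.1 hab).1)
  invFun y := mk (fun s => y s.2 s.1) fun f hf => by
    obtain ⟨h, hh, hle⟩ := exists_basis_bound h₂ hf
    rw [← (Equiv.prodComm _ _).summable_iff, summable_prod_of_nonneg]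
    · exact ⟨fun t => Summable.of_nonneg_of_le
        (fun g => mul_nonneg (norm_nonneg _) (B.pos f hf _).le)
        (fun g => mul_le_mul_of_nonneg_left (hle g t) (norm_nonneg _)) ((y t).summable hh),
        Summable.of_finite⟩
    · exact fun s => mul_nonneg (norm_nonneg _) (B.pos f hf _).le
  map_add' _ _ := rfl
  map_smul' _ _ := rfl
  left_inv _ := rfl
  right_inv _ := rfl

variable {h₁ : ∃ a : ℝ≥0, ∀ g t, L g ≤ a * w (g, t)}
  {h₂ : ∃ a b : ℝ≥0, ∀ g t, w (g, t) ≤ a * L g + b}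

theorem isBoundedMap_equivPi : IsBoundedMap (equivPi (B := B) h₁ h₂) := by
  refine IsBoundedMap.pi fun t => isBoundedMap_of_wnorm_le fun f hf => ?_
  obtain ⟨h, hh, hle⟩ := exists_coord_bound h₁ hf
  refine ⟨h, hh, 1, zero_le_one, fun x => ?_⟩
  rw [one_mul]
  have hinj : Function.Injective fun g : G => (g, t) := fun a b hab => (Prod.ext_iff.1 hab).1
  refine Summable.tsum_le_tsum_of_inj _ hinj (fun s _ => x.term_nonneg hh s)
    (fun g => mul_le_mul_of_nonneg_left (hle g t) (norm_nonneg _)) ?_ (x.summable hh)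
  exact (equivPi h₁ h₂ x t).summable hf

theorem isBoundedMap_equivPi_symm : IsBoundedMap (equivPi (B := B) h₁ h₂).symm := fun A hA => by
  rw [← Bornology.forall_isBounded_image_eval_iff] at hA
  rw [isBounded_iff]
  intro f hf
  obtain ⟨h, hh, hle⟩ := exists_basis_bound h₂ hf
  choose M hM using fun t => isBounded_iff.1 (hA t) h hh
  refine ⟨∑ t, M t, ?_⟩
  rintro _ ⟨y, hy, rfl⟩
  have hs := ((equivPi (B := B) h₁ h₂).symm y).summable hf
  rw [wnorm, ← (Equiv.prodComm _ _).tsum_eq, Summable.tsum_prod, tsum_fintype]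
  · refine Finset.sum_le_sum fun t _ => le_trans ?_ (hM t _ ⟨y, hy, rfl⟩)
    refine Summable.tsum_le_tsum
      (fun g => mul_le_mul_of_nonneg_left (hle g t) (norm_nonneg _)) ?_ ((y t).summable hh)
    exact hs.comp_injective (i := fun g => (g, t)) fun a b hab => (Prod.ext_iff.1 hab).1
  · exact (Equiv.prodComm _ _).summable_iff.2 hs

theorem tsum_prod_fin {β : Type u} {φ : β × Fin r → ℂ} (h : Summable φ) :
    ∑' s, φ s = ∑ t, ∑' g, φ (g, t) := by
  rw [← (Equiv.prodComm _ _).tsum_eq, Summable.tsum_prod, tsum_fintype]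
  · rfl
  · exact (Equiv.prodComm _ _).summable_iff.2 h

end WL1

namespace NiceResolution

variable {G : Type u} [Group G] {L : LengthFunction G} (C : NiceResolution L) (B : BoundingClass)

/-- The resolution without its weights. -/
def toFreeRes : FreeRes G := { C with }

theorem length_le (n : ℕ) : ∃ a : ℝ≥0, ∀ g t, L g ≤ a * C.w n (g, t) := by
  obtain ⟨C₁, C₂, h1, -, h⟩ := C.comparable n
  refine ⟨C₁⁻¹, fun g t => ?_⟩
  rw [le_inv_mul_iff₀ h1]
  exact le_self_add.trans (h g t).1

theorem weight_le (n : ℕ) : ∃ a b : ℝ≥0, ∀ g t, C.w n (g, t) ≤ a * L g + b := by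
  obtain ⟨C₁, C₂, -, -, h⟩ := C.comparable n
  exact ⟨C₂, ∑ t, C.wT n t, fun g t => (h g t).2.trans (add_le_add_right
    (Finset.single_le_sum (f := C.wT n) (fun _ _ => zero_le) (Finset.mem_univ t)) _)⟩

/-- The completion of a nice resolution as a completed free resolution. -/
def equivP (n : ℕ) : C.BD B n ≃ₗ[ℂ] C.toFreeRes.P B L n :=
  WL1.equivPi (C.length_le n) (C.weight_le n)

theorem εP_equivP (x : C.BD B 0) : C.toFreeRes.εP B L (C.equivP B 0 x) = C.εHat B x := by
  have h1 : ∀ g t, C.ε (Finsupp.single (g, t) 1) = C.ε (Finsupp.single (1, t) 1) := fun g t => by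
    rw [single_eq_shift, C.ε_shift]
  have hs : Summable fun s => x s * (C.ε (Finsupp.single s 1) : ℂ) := by
    refine Summable.of_norm_bounded (x.summable_norm.mul_right
      (∑ t, ‖(C.ε (Finsupp.single (1, t) 1) : ℂ)‖)) ?_
    rintro ⟨g, t⟩
    rw [norm_mul, h1]
    exact mul_le_mul_of_nonneg_left (Finset.single_le_sum
      (f := fun t => ‖(C.ε (Finsupp.single (1, t) 1) : ℂ)‖) (fun _ _ => norm_nonneg _)
      (Finset.mem_univ t)) (norm_nonneg _)
  rw [C.toFreeRes.εP_apply, εHat, WL1.tsum_prod_fin hs]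
  refine Finset.sum_congr rfl fun t _ => ?_
  rw [HAlg.aug, ← tsum_mul_left]
  refine tsum_congr fun g => ?_
  have h2 := congrArg (fun k : ℤ => x (g, t) * (k : ℂ)) (h1 g t)
  exact (mul_comm _ _).trans h2.symm

/-- By equivariance, both sides are convolution on the right with the matrix of boundaries of the
basis elements `(1, t)`. -/
theorem dP_equivP (n : ℕ) (x : C.BD B (n + 1)) :
    C.toFreeRes.dP B L n (C.equivP B (n + 1) x) = C.equivP B n (C.dHat B n x) := by
  refine funext fun t : Fin (C.rank n) => ?_
  ext k
  have h1 : WL1.coeff (C.equivP B n (C.dHat B n x) t) k =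
      ∑' s, x s * WL1.coeff (C.dBasis B n s) (k, t) := rfl
  have h2 : ∀ s, WL1.coeff (C.dBasis B n s) (k, (t : Fin (C.rank n))) =
      ((C.d n (Finsupp.single (1, s.2) 1) (s.1⁻¹ * k, t) : ℤ) : ℂ) := fun s => by
    change ((C.d n (Finsupp.single s 1) (k, t) : ℤ) : ℂ) = _
    rw [show s = (s.1, s.2) from rfl, single_eq_shift, C.d_shift, shift_apply]
  have hs := (WL1.summable_kernel_apply (C.dBasis B n) (C.dBasis_bound B n) x (k, t)).of_norm
  rw [h1, WL1.tsum_prod_fin hs]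
  have h3 : C.toFreeRes.dP B L n (C.equivP B (n + 1) x) t =
      ∑ t', C.equivP B (n + 1) x t' * toHAlg B L (C.d n (Finsupp.single (1, t') 1)) t := by
    rw [FreeRes.dP, Fintype.linearCombination_apply]
    exact Finset.sum_apply (t : Fin (C.toFreeRes.rank n)) _ _
  have h4 : ∀ (ι : Finset (Fin (C.rank (n + 1)))) (y : Fin (C.rank (n + 1)) → HAlg B L),
      WL1.coeff (∑ t ∈ ι, y t) k = ∑ t ∈ ι, WL1.coeff (y t) k := fun ι y => by
    classical
    induction ι using Finset.induction_on with
    | empty => rfl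
    | insert a s ha ih => rw [Finset.sum_insert ha, Finset.sum_insert ha, WL1.add_apply, ih]
  rw [h3]
  refine (h4 _ _).trans (Finset.sum_congr rfl fun t' _ => ?_)
  rw [HAlg.mul_apply]
  refine tsum_congr fun g => ?_
  exact congrArg (x (g, t') * ·) (h2 (g, t')).symm

/-- A contraction is conjugated by `equivP`, which is bounded in both directions. The weights of a
nice resolution therefore do not affect contractibility. -/
theorem hasBoundedContraction_iff :
    C.HasBoundedContraction B ↔ C.toFreeRes.HasContraction B L := by
  have hb : ∀ n, IsBoundedMap (C.equivP B n) := fun n => WL1.isBoundedMap_equivPi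
  have hb' : ∀ n, IsBoundedMap (C.equivP B n).symm := fun n => WL1.isBoundedMap_equivPi_symm
  constructor
  · rintro ⟨e, s, hs, he, h0, h1⟩
    refine ⟨C.equivP B 0 e, fun n => (C.equivP B (n + 1)).toLinearMap ∘ₗ s n ∘ₗ
      (C.equivP B n).symm.toLinearMap, fun n => (hb _).comp ((hs n).comp (hb' n)), ?_,
      fun x => ?_, fun n x => ?_⟩
    · rw [εP_equivP, he]
    · obtain ⟨x, rfl⟩ := (C.equivP B 0).surjective x
      conv_rhs => rw [← h0 x]
      simp [dP_equivP, εP_equivP]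
    · obtain ⟨x, rfl⟩ := (C.equivP B (n + 1)).surjective x
      conv_rhs => rw [← h1 n x]
      simp [dP_equivP]
  · rintro ⟨e, s, hs, he, h0, h1⟩
    have hd : ∀ n y, C.dHat B n ((C.equivP B (n + 1)).symm y) =
        (C.equivP B n).symm (C.toFreeRes.dP B L n y) := fun n y => by
      rw [LinearEquiv.eq_symm_apply, ← dP_equivP, LinearEquiv.apply_symm_apply]
    refine ⟨(C.equivP B 0).symm e, fun n => (C.equivP B (n + 1)).symm.toLinearMap ∘ₗ s n ∘ₗ
      (C.equivP B n).toLinearMap, fun n => (hb' _).comp ((hs n).comp (hb n)), ?_,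
      fun x => ?_, fun n x => ?_⟩
    · rw [← εP_equivP, LinearEquiv.apply_symm_apply, he]
    · apply (C.equivP B 0).injective
      rw [← h0 (C.equivP B 0 x)]
      simp [hd, εP_equivP]
    · apply (C.equivP B (n + 1)).injective
      rw [← h1 n (C.equivP B (n + 1) x)]
      simp [hd, dP_equivP]

end NiceResolution

namespace FreeRes

variable {G : Type u} [Group G] (C : FreeRes G) {L : LengthFunction G}

/-- A free resolution is nice for the weights given by a proper length function. -/
def toNiceResolution (hL : ∀ R : ℝ≥0, {g | L g ≤ R}.Finite) : NiceResolution L :=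
  { C with
    wT := fun _ _ => 0
    w := fun _ s => L s.1
    proper := fun n R => ((hL R).prod (Set.toFinite (Set.univ : Set (Fin (C.rank n))))).subset
      fun s hs => ⟨hs, trivial⟩
    comparable := fun _ => ⟨1, 1, one_pos, le_rfl, fun _ _ => by simp⟩
    linearlyBounded := fun n => by
      -- By equivariance only the boundaries of the elements `(1, t)` matter. Subadditivity of `L`
      -- gives a slope from their coefficients and a constant from their weighted coefficients;
      -- summing over `t` makes both uniform.
      refine ⟨∑ t, (C.d n (Finsupp.single (1, t) 1)).sum fun _ c => (c.natAbs : ℝ≥0),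
        ∑ t, (C.d n (Finsupp.single (1, t) 1)).sum fun s c => (c.natAbs : ℝ≥0) * L s.1, ?_⟩
      rintro ⟨g, t⟩
      have hinj : Function.Injective fun s : G × Fin (C.rank n) => (g * s.1, s.2) := by
        rintro ⟨a, b⟩ ⟨a', b'⟩ h
        simpa using h
      rw [single_eq_shift, C.d_shift, shift, Finsupp.sum_mapDomain_index_inj hinj]
      have h1 : ((C.d n (Finsupp.single (1, t) 1)).sum fun s c => (c.natAbs : ℝ≥0) * L (g * s.1)) ≤
          ((C.d n (Finsupp.single (1, t) 1)).sum fun _ c => (c.natAbs : ℝ≥0)) * L g +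
            (C.d n (Finsupp.single (1, t) 1)).sum fun s c => (c.natAbs : ℝ≥0) * L s.1 := by
        rw [Finsupp.sum, Finsupp.sum, Finsupp.sum, Finset.sum_mul, ← Finset.sum_add_distrib]
        refine Finset.sum_le_sum fun s _ => ?_
        rw [← mul_add]
        exact mul_le_mul_right (L.mul_le g s.1) _
      refine h1.trans (add_le_add (mul_le_mul_left ?_ _) ?_)
      · exact Finset.single_le_sum (f := fun t =>
          (C.d n (Finsupp.single (1, t) 1)).sum fun _ c => (c.natAbs : ℝ≥0))
          (fun _ _ => zero_le) (Finset.mem_univ t)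
      · exact Finset.single_le_sum (f := fun t =>
          (C.d n (Finsupp.single (1, t) 1)).sum fun s c => (c.natAbs : ℝ≥0) * L s.1)
          (fun _ _ => zero_le) (Finset.mem_univ t) }

end FreeRes

end

noncomputable section

open scoped Pointwise

/-! ### From projective to free resolutions, and the first equivalence. -/

section Projective

/-- A finitely generated projective module has a finitely generated projective complement in a
free module. -/
theorem Module.exists_projective_complement (R : Type u) [Ring R] (M : Type u) [AddCommGroup M]
    [Module R M] [Module.Finite R M] [Module.Projective R M] :
    ∃ Q : ModuleCat.{u} R, (Module.Finite R Q ∧ Module.Projective R Q) ∧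
      ∃ r, Nonempty ((M × Q) ≃ₗ[R] (Fin r → R)) := by
  obtain ⟨r, f, g, -, -, hfg⟩ := Module.Finite.exists_comp_eq_id_of_projective R M
  replace hfg : ∀ x, f (g x) = x := fun x => LinearMap.congr_fun hfg x
  let p : (Fin r → R) →ₗ[R] LinearMap.ker f :=
    (LinearMap.id - g ∘ₗ f).codRestrict (LinearMap.ker f) fun x => by
      rw [LinearMap.mem_ker, LinearMap.sub_apply, LinearMap.comp_apply, map_sub, hfg,
        LinearMap.id_apply, sub_self]
  have hpv : ∀ x, (p x : Fin r → R) = x - g (f x) := fun _ => rfl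
  have hp : ∀ x : LinearMap.ker f, p x = x := fun x => Subtype.ext (by
    rw [hpv, LinearMap.mem_ker.1 x.2, map_zero, sub_zero])
  refine ⟨ModuleCat.of R (LinearMap.ker f), ⟨?_, ?_⟩, r, ⟨?_⟩⟩
  · exact Module.Finite.of_surjective p fun x => ⟨x, hp x⟩
  · exact Module.Projective.of_split (LinearMap.ker f).subtype p (LinearMap.ext hp)
  · exact
      { toFun := fun x => g x.1 + (x.2 : LinearMap.ker f).1
        map_add' := fun x y => by
          rw [Prod.fst_add, Prod.snd_add, map_add, Submodule.coe_add]
          abel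
        map_smul' := fun c x => by
          rw [Prod.smul_fst, Prod.smul_snd, map_smul, Submodule.coe_smul, RingHom.id_apply,
            smul_add]
        invFun := fun x => (f x, p x)
        left_inv := fun x => by
          have h : f (x.2 : LinearMap.ker f).1 = 0 := LinearMap.mem_ker.1 x.2.2
          refine Prod.ext ?_ (Subtype.ext ?_)
          · simp only [map_add, hfg, h, add_zero]
          · rw [hpv, map_add, hfg, h, add_zero, add_sub_cancel_left]
        right_inv := fun x => by
          simp only [hpv, add_sub_cancel] }

end Projective

section GroupRing

variable {G : Type u} [Group G]

/-- Elements of a free module over the group ring as finitely supported functions. -/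
def freeEquiv (G : Type u) [Group G] (r : ℕ) :
    (Fin r → MonoidAlgebra ℤ G) ≃+ ((G × Fin r) →₀ ℤ) :=
  (AddEquiv.piCongrRight fun _ => MonoidAlgebra.coeffAddEquiv).trans
    (Finsupp.addEquivFunOnFinite.symm.trans
      (Finsupp.curryAddEquiv.symm.trans (Finsupp.domCongr (Equiv.prodComm _ _))))

theorem freeEquiv_apply {r : ℕ} (x : Fin r → MonoidAlgebra ℤ G) (g : G) (t : Fin r) :
    freeEquiv G r x (g, t) = (x t).coeff g := rfl

theorem freeEquiv_smul {r : ℕ} (g : G) (x : Fin r → MonoidAlgebra ℤ G) :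
    freeEquiv G r (MonoidAlgebra.of ℤ G g • x) = shift g (freeEquiv G r x) := by
  ext ⟨h, t⟩
  rw [shift_apply, freeEquiv_apply, freeEquiv_apply, Pi.smul_apply, smul_eq_mul,
    MonoidAlgebra.of_apply, MonoidAlgebra.coeff_single_mul_apply, one_mul]

theorem freeEquiv_symm_shift {r : ℕ} (g : G) (x : (G × Fin r) →₀ ℤ) :
    (freeEquiv G r).symm (shift g x) = MonoidAlgebra.of ℤ G g • (freeEquiv G r).symm x := by
  rw [AddEquiv.symm_apply_eq, freeEquiv_smul, AddEquiv.apply_symm_apply]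

/-- A group of type `FP^∞` has a resolution by finitely generated free modules. -/
theorem TypeFPInfty.exists_freeRes (hG : TypeFPInfty G) : Nonempty (FreeRes G) := by
  obtain ⟨P, d, ε, hP, hε, hεs, h0, h1⟩ := hG
  let FP : Type (u + 1) := {Q : ModuleCat.{u} (MonoidAlgebra ℤ G) //
    Module.Finite (MonoidAlgebra ℤ G) Q ∧ Module.Projective (MonoidAlgebra ℤ G) Q}
  have hc : ∀ n (A : FP), ∃ Q : FP, ∃ r,
      Nonempty (((P n × A.1) × Q.1) ≃ₗ[MonoidAlgebra ℤ G] (Fin r → MonoidAlgebra ℤ G)) := by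
    intro n A
    have := (hP n).1
    have := (hP n).2
    have := A.2.1
    have := A.2.2
    obtain ⟨Q, hQ, r, h⟩ := Module.exists_projective_complement (MonoidAlgebra ℤ G) (P n × A.1)
    exact ⟨⟨Q, hQ⟩, r, h⟩
  choose next rk he using hc
  -- `A (n + 1)` is a complement of `P n × A n`, so `F n` is free. The differential sends the
  -- summand `A (n + 1)` of `F (n + 1)` identically to that of `F n`: contractible pieces are added,
  -- and the start `A 0 = 0` leaves nothing unpaired in degree zero.
  let A : ℕ → FP := fun n => Nat.rec
    ⟨ModuleCat.of (MonoidAlgebra ℤ G) PUnit.{u + 1},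
      inferInstanceAs (Module.Finite (MonoidAlgebra ℤ G) PUnit.{u + 1}),
      inferInstanceAs (Module.Projective (MonoidAlgebra ℤ G) PUnit.{u + 1})⟩ next n
  let F : ℕ → Type u := fun n => (P n × (A n).1) × (A (n + 1)).1
  let D : ∀ n, F (n + 1) →ₗ[MonoidAlgebra ℤ G] F n := fun n =>
    (((d n).comp (LinearMap.fst _ _ _)).prod 0).comp (LinearMap.fst _ _ _) |>.prod
      ((LinearMap.snd _ _ _).comp (LinearMap.fst _ _ _))
  have hD : ∀ n x, D n x = ((d n x.1.1, 0), x.1.2) := fun _ _ => rfl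
  let E : F 0 →+ ℤ := ε.comp ((AddMonoidHom.fst _ _).comp (AddMonoidHom.fst _ _))
  have hE : ∀ x, E x = ε x.1.1 := fun _ => rfl
  have hA0 : ∀ a : (A 0).1, a = 0 := fun a => Subsingleton.elim (α := PUnit.{u + 1}) a 0
  let e : ∀ n, F n ≃+ ((G × Fin (rk n (A n))) →₀ ℤ) := fun n =>
    (he n (A n)).some.toAddEquiv.trans (freeEquiv G _)
  have heg : ∀ n g x, (e n).symm (shift g x) = MonoidAlgebra.of ℤ G g • (e n).symm x := by
    intro n g x
    change (he n (A n)).some.symm ((freeEquiv G _).symm (shift g x)) = _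
    rw [freeEquiv_symm_shift, map_smul]
    rfl
  have heg' : ∀ n g x, e n (MonoidAlgebra.of ℤ G g • x) = shift g (e n x) := by
    intro n g x
    rw [← (e n).eq_symm_apply, heg, AddEquiv.symm_apply_apply]
  refine ⟨{
    rank := fun n => rk n (A n)
    d := fun n => ((e n).toAddMonoidHom.comp
      ((D n).toAddMonoidHom.comp (e (n + 1)).symm.toAddMonoidHom)).toIntLinearMap
    ε := (E.comp (e 0).symm.toAddMonoidHom).toIntLinearMap
    d_shift := fun n g x => ?_
    ε_shift := fun g x => ?_
    ε_surjective := fun k => ?_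
    exact_zero := fun x => ?_
    exact_succ := fun n x => ?_ }⟩
  · change e n (D n ((e (n + 1)).symm (shift g x))) = shift g (e n (D n ((e (n + 1)).symm x)))
    rw [heg, map_smul, heg']
  · change E ((e 0).symm (shift g x)) = E ((e 0).symm x)
    rw [heg, hE, hE]
    exact hε g _
  · obtain ⟨p, hp⟩ := hεs k
    refine ⟨e 0 ((p, 0), 0), ?_⟩
    change E ((e 0).symm (e 0 ((p, 0), 0))) = k
    rw [AddEquiv.symm_apply_apply, hE, hp]
  · change E ((e 0).symm x) = 0 ↔ ∃ y, e 0 (D 0 ((e 1).symm y)) = x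
    rw [hE, h0, ← (e 1).toEquiv.exists_congr_right]
    constructor
    · rintro ⟨p, hp⟩
      refine ⟨((p, ((e 0).symm x).2), 0), ?_⟩
      change e 0 (D 0 ((e 1).symm (e 1 _))) = x
      rw [AddEquiv.symm_apply_apply, ← (e 0).eq_symm_apply, hD]
      exact Prod.ext (Prod.ext hp (hA0 _).symm) rfl
    · rintro ⟨y, hy⟩
      refine ⟨y.1.1, ?_⟩
      change e 0 (D 0 ((e 1).symm (e 1 y))) = x at hy
      rw [AddEquiv.symm_apply_apply, ← (e 0).eq_symm_apply, hD] at hy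
      rw [← hy]
  · change e n (D n ((e (n + 1)).symm x)) = 0 ↔
      ∃ y, e (n + 1) (D (n + 1) ((e (n + 2)).symm y)) = x
    rw [(e n).map_eq_zero_iff, hD, ← (e (n + 2)).toEquiv.exists_congr_right]
    constructor
    · intro hx
      have hx1 : d n ((e (n + 1)).symm x).1.1 = 0 := congrArg (fun z => z.1.1) hx
      have hx2 : ((e (n + 1)).symm x).1.2 = 0 := congrArg (fun z => z.2) hx
      obtain ⟨p, hp⟩ := (h1 n _).1 hx1
      refine ⟨((p, ((e (n + 1)).symm x).2), 0), ?_⟩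
      change e (n + 1) (D (n + 1) ((e (n + 2)).symm (e (n + 2) _))) = x
      rw [AddEquiv.symm_apply_apply, ← (e (n + 1)).eq_symm_apply, hD]
      exact Prod.ext (Prod.ext hp hx2.symm) rfl
    · rintro ⟨y, hy⟩
      change e (n + 1) (D (n + 1) ((e (n + 2)).symm (e (n + 2) y))) = x at hy
      rw [AddEquiv.symm_apply_apply, ← (e (n + 1)).eq_symm_apply, hD] at hy
      rw [← hy]
      exact Prod.ext (Prod.ext ((h1 n _).2 ⟨_, rfl⟩) rfl) rfl

end GroupRing

/-- `B`-finiteness in terms of an arbitrary free resolution. -/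
theorem FreeRes.HasContraction.typeBFPInfty {G : Type u} [Group G] {L : LengthFunction G}
    {B : BoundingClass} {C : FreeRes G} (hC : C.HasContraction B L) (hG : TypeFPInfty G) :
    TypeBFPInfty B L :=
  ⟨hG, C.toNiceResolution hC.finite_setOf_le,
    ((C.toNiceResolution hC.finite_setOf_le).hasBoundedContraction_iff B).2 hC⟩

theorem ComparisonSurjective.typeBFPInfty {G : Type u} [Group G] {L : LengthFunction G}
    {B : BoundingClass} (hs : ComparisonSurjective.{u, v} B L) (hG : TypeFPInfty G) :
    TypeBFPInfty B L := by
  obtain ⟨C⟩ := hG.exists_freeRes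
  exact (C.hasContraction_of_comparisonSurjective hs).typeBFPInfty hG

theorem TypeBFPInfty.stronglyIsocohomological {G : Type u} [Group G] {L : LengthFunction G}
    {B : BoundingClass} (h : TypeBFPInfty B L) : StronglyIsocohomological.{u, v} B L := by
  obtain ⟨-, C, hC⟩ := h
  have hC' := (C.hasBoundedContraction_iff B).1 hC
  intro V _ _ _ _ _ n
  exact ⟨hC'.comparisonMap_injective n, hC'.comparisonMap_surjective n⟩

theorem isocohomological_tfae {G : Type u} [Group G] (L : LengthFunction G) (B : BoundingClass)
    (hG : TypeFPInfty G) :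
    [StronglyIsocohomological.{u, v} B L, ComparisonSurjective.{u, v} B L,
      TypeBFPInfty B L].TFAE := by
  tfae_have 1 → 2 := fun h V _ _ _ _ _ n => (h V n).2
  tfae_have 2 → 3 := fun h => h.typeBFPInfty hG
  tfae_have 3 → 1 := fun h => h.stronglyIsocohomological
  tfae_finish

end

noncomputable section

/-! ### Absolutely summable families in bornological spaces. -/

section BornHasSum

variable {V : Type v} [AddCommGroup V] [Module ℂ V] [Bornology V] {ι : Type*}

/-- The family `a` is absolutely summable with sum `v` in the Banach space of some bounded disc. -/
def BornHasSum (a : ι → V) (v : V) : Prop :=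
  ∃ (E : Type v) (_ : NormedAddCommGroup E) (_ : NormedSpace ℂ E) (_ : CompleteSpace E)
    (i : E →ₗ[ℂ] V) (η : ι → E), Bornology.IsBounded (i '' Metric.closedBall 0 1) ∧
      (∀ s, i (η s) = a s) ∧ (Summable fun s => ‖η s‖) ∧ i (∑' s, η s) = v

omit [Bornology V] in
/-- A disc maps continuously to each disc which contains it. -/
theorem exists_clm_of_subset {E F : Type*} [NormedAddCommGroup E] [NormedSpace ℂ E]
    [NormedAddCommGroup F] [NormedSpace ℂ F] (i : E →ₗ[ℂ] V) (j : F →ₗ[ℂ] V)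
    (hj : Function.Injective j)
    (h : i '' Metric.closedBall 0 1 ⊆ j '' Metric.closedBall 0 1) :
    ∃ k : E →L[ℂ] F, ∀ e, j (k e) = i e := by
  have h1 : ∀ e, ∃ z, j z = i e ∧ ‖z‖ ≤ 1 * ‖e‖ := fun e => by
    by_cases he : e = 0
    · exact ⟨0, by simp [he], by simp⟩
    have hn : (‖e‖ : ℂ) ≠ 0 := by simpa using he
    obtain ⟨z, hz, hz'⟩ := h ⟨(‖e‖ : ℂ)⁻¹ • e, by
      rw [mem_closedBall_zero_iff, norm_smul, norm_inv, Complex.norm_real, norm_norm,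
        inv_mul_cancel₀ (by simpa using he)], rfl⟩
    rw [mem_closedBall_zero_iff] at hz
    refine ⟨(‖e‖ : ℂ) • z, ?_, ?_⟩
    · rw [map_smul, hz', map_smul, smul_inv_smul₀ hn]
    · rw [norm_smul, Complex.norm_real, norm_norm, one_mul]
      exact mul_le_of_le_one_right (norm_nonneg _) hz
  choose k hk hkn using h1
  let k' : E →ₗ[ℂ] F :=
    { toFun := k
      map_add' := fun a b => hj (by rw [map_add, hk, hk, hk, map_add])
      map_smul' := fun c a => hj (by rw [RingHom.id_apply, map_smul, hk, hk, map_smul]) }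
  exact ⟨k'.mkContinuous 1 hkn, hk⟩

variable [CompleteBornological V]

/-- A disc containing both unit balls receives continuous maps from both Banach spaces, and these
preserve absolutely convergent sums. Its inclusion is injective, which `BornHasSum` does not demand;
uniqueness of sums rests on this. -/
theorem BornHasSum.exists_common {a b : ι → V} {v w : V} (ha : BornHasSum a v)
    (hb : BornHasSum b w) :
    ∃ (E : Type v) (_ : NormedAddCommGroup E) (_ : NormedSpace ℂ E) (_ : CompleteSpace E)
      (i : E →ₗ[ℂ] V) (η θ : ι → E), Function.Injective i ∧
        Bornology.IsBounded (i '' Metric.closedBall 0 1) ∧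
        ((∀ s, i (η s) = a s) ∧ (Summable fun s => ‖η s‖) ∧ i (∑' s, η s) = v) ∧
        ((∀ s, i (θ s) = b s) ∧ (Summable fun s => ‖θ s‖) ∧ i (∑' s, θ s) = w) := by
  obtain ⟨E₁, _, _, _, i₁, η, hb₁, h1, h2, h3⟩ := ha
  obtain ⟨E₂, _, _, _, i₂, θ, hb₂, k1, k2, k3⟩ := hb
  obtain ⟨E, _, _, _, i, hi, hbd, hsub⟩ := CompleteBornological.exists_disc _ (hb₁.union hb₂)
  obtain ⟨p, hp⟩ := exists_clm_of_subset i₁ i hi (Set.subset_union_left.trans hsub)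
  obtain ⟨q, hq⟩ := exists_clm_of_subset i₂ i hi (Set.subset_union_right.trans hsub)
  refine ⟨E, _, _, ‹_›, i, fun s => p (η s), fun s => q (θ s), hi, hbd 1,
    ⟨fun s => by rw [hp, h1], ?_, ?_⟩, ⟨fun s => by rw [hq, k1], ?_, ?_⟩⟩
  · exact Summable.of_nonneg_of_le (fun _ => norm_nonneg _) (fun s => p.le_opNorm _)
      (h2.mul_left _)
  · rw [← p.map_tsum h2.of_norm, hp, h3]
  · exact Summable.of_nonneg_of_le (fun _ => norm_nonneg _) (fun s => q.le_opNorm _)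
      (k2.mul_left _)
  · rw [← q.map_tsum k2.of_norm, hq, k3]

theorem BornHasSum.unique {a : ι → V} {v w : V} (ha : BornHasSum a v) (hb : BornHasSum a w) :
    v = w := by
  obtain ⟨E, _, _, _, i, η, θ, hi, -, ⟨h1, -, h3⟩, ⟨k1, -, k3⟩⟩ := ha.exists_common hb
  rw [← h3, ← k3, show η = θ from funext fun s => hi ((h1 s).trans (k1 s).symm)]

theorem BornHasSum.add {a b : ι → V} {v w : V} (ha : BornHasSum a v) (hb : BornHasSum b w) :
    BornHasSum (fun s => a s + b s) (v + w) := by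
  obtain ⟨E, _, _, _, i, η, θ, hi, hbd, ⟨h1, h2, h3⟩, ⟨k1, k2, k3⟩⟩ := ha.exists_common hb
  refine ⟨E, _, _, ‹_›, i, fun s => η s + θ s, hbd, fun s => by rw [map_add, h1, k1], ?_, ?_⟩
  · exact Summable.of_nonneg_of_le (fun _ => norm_nonneg _) (fun s => norm_add_le _ _) (h2.add k2)
  · rw [h2.of_norm.tsum_add k2.of_norm, map_add, h3, k3]

omit [CompleteBornological V] in
theorem BornHasSum.smul (c : ℂ) {a : ι → V} {v : V} (ha : BornHasSum a v) :
    BornHasSum (fun s => c • a s) (c • v) := by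
  obtain ⟨E, _, _, _, i, η, hbd, h1, h2, h3⟩ := ha
  refine ⟨E, _, _, ‹_›, i, fun s => c • η s, hbd, fun s => by rw [map_smul, h1], ?_, ?_⟩
  · simpa only [norm_smul] using h2.mul_left ‖c‖
  · rw [tsum_const_smul'' c, map_smul, h3]

end BornHasSum

/-! ### Dominating functions for a countable multiplicative class. -/

namespace BoundingClass

variable {B : BoundingClass}

theorem IsFrechet.exists_cofinal (hB : B.IsFrechet) : ∃ F : ℕ → ℝ≥0 → ℝ,
    (∀ k, F k ∈ B.carrier) ∧ ∀ f ∈ B.carrier, ∃ k, ∀ x, f x ≤ F k x := by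
  obtain ⟨B', hc, h1, h2⟩ := hB
  obtain ⟨e, he⟩ := hc.exists_eq_range ⟨_, B'.one_mem⟩
  have he' : ∀ k, e k ∈ B'.carrier := fun k => by rw [he]; exact ⟨k, rfl⟩
  choose F hF hle using fun k => h2 (e k) (he' k)
  refine ⟨F, hF, fun f hf => ?_⟩
  obtain ⟨g, hg, hfg⟩ := h1 f hf
  rw [he] at hg
  obtain ⟨k, rfl⟩ := hg
  exact ⟨k, fun x => (hfg x).trans (hle k x)⟩

theorem Multiplicative.exists_pow_le (hB : B.Multiplicative) {f : ℝ≥0 → ℝ} (hf : f ∈ B.carrier)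
    (N : ℕ) : ∃ g ∈ B.carrier, ∀ x, f x ^ N ≤ g x := by
  induction N with
  | zero => exact ⟨_, B.one_mem, fun x => by simp⟩
  | succ N ih =>
    obtain ⟨g, hg, hle⟩ := ih
    obtain ⟨h, hh, hle'⟩ := hB g hg f hf
    refine ⟨h, hh, fun x => le_trans ?_ (hle' x)⟩
    rw [pow_succ]
    exact mul_le_mul_of_nonneg_right (hle x) (B.pos f hf x).le

/-- A function which dominates a countable class, and a power of which is still integrable against
the elements of a given bounded set. -/
theorem exists_dominating (hF : B.IsFrechet) (hm : B.Multiplicative) {N : ℕ} (hN : N ≠ 0)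
    (R : (ℝ≥0 → ℝ) → ℝ) :
    ∃ Λ : ℝ≥0 → ℝ, Monotone Λ ∧ (∀ r, 0 < Λ r) ∧
      (∀ f ∈ B.carrier, ∃ C : ℝ, 0 ≤ C ∧ ∀ r, f r ≤ C * Λ r) ∧
      ∀ {S : Type u} (w : S → ℝ≥0) (x : S → ℝ) (T : Finset S),
        (∀ f ∈ B.carrier, ∑ s ∈ T, x s * f (w s) ≤ R f) → ∑ s ∈ T, x s * Λ (w s) ^ N ≤ 1 := by
  obtain ⟨F, hFB, hcof⟩ := hF.exists_cofinal
  choose M hMB hM using fun k => hm.exists_pow_le (hFB k) N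
  -- The summand `M k k` makes the series below converge everywhere, because `M k r ≤ M k k` for `k
  -- ≥ r`. The summand `|R (M k)|` bounds its `k`-th term, summed against `x`, by `(1 / 2) ^ (k +
  -- 1)`.
  let c : ℕ → ℝ := fun k => (1 / 2) ^ (k + 1) / (1 + |R (M k)| + M k k)
  have hden : ∀ k, 0 < 1 + |R (M k)| + M k k := fun k => by
    have := B.pos _ (hMB k) k
    positivity
  have hc : ∀ k, 0 < c k := fun k => div_pos (by positivity) (hden k)
  have hc1 : ∀ k y, y ≤ 1 + |R (M k)| + M k k → c k * y ≤ (1 / 2) ^ (k + 1) := fun k y hy => by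
    rw [div_mul_eq_mul_div, div_le_iff₀ (hden k)]
    exact mul_le_mul_of_nonneg_left hy (by positivity)
  have hgeo : HasSum (fun k : ℕ => (1 / 2 : ℝ) ^ (k + 1)) 1 := by
    have := hasSum_geometric_two.mul_left (1 / 2)
    simpa only [pow_succ', one_div, inv_mul_cancel₀ (two_ne_zero' ℝ)] using this
  have hs : ∀ r, Summable fun k => c k * M k r := fun r => by
    obtain ⟨n, hn⟩ := exists_nat_ge r
    refine Summable.of_norm_bounded_eventually_nat hgeo.summable ?_
    filter_upwards [Filter.eventually_ge_atTop n] with k hk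
    rw [Real.norm_of_nonneg (mul_nonneg (hc k).le (B.pos _ (hMB k) _).le)]
    refine hc1 k _ ?_
    have h1 : M k r ≤ M k k := B.mono _ (hMB k) (hn.trans (by exact_mod_cast hk))
    have := abs_nonneg (R (M k))
    linarith
  -- `Λ` is the `N`-th root of `Ω`. Since `M k` bounds the `N`-th power of the cofinal function `F
  -- k`, the root still dominates the class up to constants.
  let Ω : ℝ≥0 → ℝ := fun r => ∑' k, c k * M k r
  have hterm : ∀ k r, 0 < c k * M k r := fun k r => mul_pos (hc k) (B.pos _ (hMB k) r)
  have hle : ∀ k r, c k * M k r ≤ Ω r := fun k r =>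
    (hs r).le_tsum k fun j _ => (hterm j r).le
  have hΩ : ∀ r, 0 < Ω r := fun r => (hterm 0 r).trans_le (hle 0 r)
  have hpow : ∀ r, (Ω r ^ (N : ℝ)⁻¹) ^ N = Ω r := fun r => Real.rpow_inv_natCast_pow (hΩ r).le hN
  refine ⟨fun r => Ω r ^ (N : ℝ)⁻¹, fun r r' h => ?_, fun r => Real.rpow_pos_of_pos (hΩ r) _,
    fun f hf => ?_, fun w x T hx => ?_⟩
  · refine Real.rpow_le_rpow (hΩ r).le ?_ (by positivity)
    exact (hs r).tsum_le_tsum (fun k => mul_le_mul_of_nonneg_left (B.mono _ (hMB k) h) (hc k).le)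
      (hs r')
  · obtain ⟨k, hk⟩ := hcof f hf
    -- The maximum with `1` ensures that the constant is at most its own `N`-th power, as needed
    -- when `N`-th powers are compared.
    refine ⟨max 1 (c k)⁻¹, by positivity, fun r => (hk r).trans ?_⟩
    have hr := Real.rpow_pos_of_pos (hΩ r) (N : ℝ)⁻¹
    refine le_of_pow_le_pow_left₀ hN (by positivity) ?_
    rw [mul_pow, hpow]
    have h1 : (1 : ℝ) ≤ max 1 (c k)⁻¹ := le_max_left _ _
    calc F k r ^ N ≤ M k r := hM k r
      _ = (c k)⁻¹ * (c k * M k r) := by rw [inv_mul_cancel_left₀ (hc k).ne']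
      _ ≤ (c k)⁻¹ * Ω r := mul_le_mul_of_nonneg_left (hle k r) (inv_nonneg.2 (hc k).le)
      _ ≤ max 1 (c k)⁻¹ ^ N * Ω r := by
        refine mul_le_mul_of_nonneg_right ?_ (hΩ r).le
        exact (le_max_right _ _).trans (le_self_pow₀ h1 hN)
  · simp only [hpow]
    have h1 : ∀ s ∈ T, Summable fun k => x s * (c k * M k (w s)) := fun s _ => (hs _).mul_left _
    calc ∑ s ∈ T, x s * Ω (w s) = ∑ s ∈ T, ∑' k, x s * (c k * M k (w s)) := by
          simp only [Ω, tsum_mul_left]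
      _ = ∑' k, ∑ s ∈ T, x s * (c k * M k (w s)) := (Summable.tsum_finsetSum h1).symm
      _ ≤ ∑' k : ℕ, (1 / 2 : ℝ) ^ (k + 1) := by
          refine (summable_sum h1).tsum_le_tsum (fun k => ?_) hgeo.summable
          have h2 : ∑ s ∈ T, x s * (c k * M k (w s)) = c k * ∑ s ∈ T, x s * M k (w s) := by
            rw [Finset.mul_sum]
            exact Finset.sum_congr rfl fun s _ => by ring
          rw [h2]
          refine hc1 k _ ((hx _ (hMB k)).trans ?_)
          have h3 := le_abs_self (R (M k))
          have h4 := B.pos _ (hMB k) k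
          linarith
      _ = 1 := hgeo.tsum_eq

end BoundingClass

end

noncomputable section

/-! ### Bounded cochains on the completion and weighted cochains of `EG`. -/

section Weighted

variable {B : BoundingClass} {G : Type u} [Group G] {L : LengthFunction G}
variable {V : Type v} [AddCommGroup V] [Module ℂ V] [Bornology V] [Module (HAlg B L) V]
  [BornologicalModule (HAlg B L) V]

theorem WL1.sum_apply {S : Type u} {w : S → ℝ≥0} {ι : Type*} (T : Finset ι) (y : ι → WL1 B w)
    (s : S) : WL1.coeff (∑ t ∈ T, y t) s = ∑ t ∈ T, y t s :=
  map_sum (⟨⟨fun x : WL1 B w => x s, rfl⟩, fun _ _ => rfl⟩ : WL1 B w →+ ℂ) y T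

theorem HAlg.sum_smul_of_apply (x : G → ℂ) (T : Finset G) (h : G) :
    WL1.coeff (∑ g ∈ T, x g • (HAlg.of g : HAlg B L)) h = Set.indicator (↑T) x h := by
  classical
  have h1 : ∀ g, WL1.coeff (x g • (HAlg.of g : HAlg B L)) h =
      if g = h then x h else 0 := fun g => by
    split_ifs with hg
    · subst hg
      exact (congrArg (x g * ·) (WL1.delta_apply_self g)).trans (mul_one _)
    · exact (congrArg (x g * ·) (WL1.delta_apply_ne (Ne.symm hg))).trans (mul_zero _)
  rw [WL1.sum_apply, Finset.sum_congr rfl fun g _ => h1 g, Finset.sum_ite_eq', Set.indicator_apply]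
  rfl

theorem HAlg.wnorm_smul_of {f : ℝ≥0 → ℝ} (c : ℂ) (g : G) :
    wnorm L f (WL1.coeff (c • HAlg.of g : HAlg B L)) = ‖c‖ * f (L g) := by
  rw [wnorm, tsum_eq_single g]
  · rw [WL1.smul_apply]
    have : WL1.coeff (HAlg.of g : HAlg B L) g = 1 := WL1.delta_apply_self g
    rw [this, mul_one]
  · intro h hh
    rw [WL1.smul_apply]
    have : WL1.coeff (HAlg.of g : HAlg B L) h = 0 := WL1.delta_apply_ne hh
    rw [this, mul_zero, norm_zero, zero_mul]

/-- A bounded linear map which vanishes on the group vanishes. -/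
theorem eq_zero_of_forall_of (hF : B.IsFrechet) (hm : B.Multiplicative) (l : HAlg B L →ₗ[ℂ] V)
    (hl : IsBoundedMap l) (h0 : ∀ g, l (HAlg.of g) = 0) (x : HAlg B L) : l x = 0 := by
  classical
  obtain ⟨Λ, -, hpos, hdom, hsum⟩ := BoundingClass.exists_dominating.{u} hF hm one_ne_zero
    fun f => wnorm L f x
  have hb : ∀ T : Finset G, ∑ g ∈ T, ‖x g‖ * Λ (L g) ≤ 1 := fun T => by
    simpa using hsum L (fun g => ‖x g‖) T fun f hf =>
      (x.summable hf).sum_le_tsum T fun g _ => x.term_nonneg hf g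
  have h1 : Summable fun g => ‖x g‖ * Λ (L g) :=
    summable_of_sum_le (fun g => mul_nonneg (norm_nonneg _) (hpos _).le) hb
  have h2 : ∀ n : ℕ, ∃ S : Finset G, ∀ T, Disjoint T S →
      ((n : ℝ) + 1) * ∑ g ∈ T, ‖x g‖ * Λ (L g) ≤ 1 := fun n => by
    obtain ⟨S, hS⟩ := summable_iff_vanishing_norm.1 h1 (1 / ((n : ℝ) + 1)) (by positivity)
    refine ⟨S, fun T hT => ?_⟩
    have h3 := (le_abs_self _).trans (hS T hT).le
    rwa [le_div_iff₀ (by positivity), mul_comm] at h3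
  choose S hS using h2
  -- The tail outside `S n` has `Λ`-norm at most `1 / (n + 1)`, so the tails times `n + 1` form a
  -- bounded set. Their images are `(n + 1) • l x`, and separation gives `l x = 0`.
  let z : ℕ → HAlg B L := fun n => x - ∑ g ∈ S n, x g • HAlg.of g
  have hz : ∀ n h, ‖z n h‖ = if h ∈ S n then 0 else ‖x h‖ := fun n h => by
    have h3 : z n h = x h - Set.indicator (S n : Set G) x h := by
      rw [← HAlg.sum_smul_of_apply (B := B) (L := L)]
      rfl
    rw [h3, Set.indicator_apply]
    simp only [Finset.mem_coe]
    split_ifs <;> simp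
  have hlz : ∀ n, l (z n) = l x := fun n => by
    rw [map_sub, map_sum, Finset.sum_eq_zero fun g _ => by rw [map_smul, h0, smul_zero], sub_zero]
  refine CompleteBornological.eq_zero_of_isBounded (c := fun n => (n : ℝ) + 1)
    (Filter.tendsto_atTop_add_const_right _ _ tendsto_natCast_atTop_atTop) ?_
  have hbd : Bornology.IsBounded (Set.range fun n : ℕ => (((n : ℝ) + 1 : ℝ) : ℂ) • z n) := by
    rw [WL1.isBounded_iff]
    intro f hf
    obtain ⟨C, hC, hfC⟩ := hdom f hf
    refine ⟨C, ?_⟩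
    rintro _ ⟨n, rfl⟩
    refine Real.tsum_le_of_sum_le (fun g => WL1.term_nonneg hf _ g) fun T => ?_
    have h4 : ∀ g, ‖((((n : ℝ) + 1 : ℝ) : ℂ) • z n) g‖ * f (L g) ≤
        C * (((n : ℝ) + 1) * if g ∈ S n then 0 else ‖x g‖ * Λ (L g)) := fun g => by
      rw [WL1.smul_apply, norm_mul, hz, Complex.norm_real, Real.norm_of_nonneg (by positivity)]
      split_ifs
      · simp
      · have := mul_le_mul_of_nonneg_left (hfC (L g))
          (mul_nonneg (by positivity : (0 : ℝ) ≤ n + 1) (norm_nonneg (x g)))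
        linarith
    refine (Finset.sum_le_sum fun g _ => h4 g).trans ?_
    rw [← Finset.mul_sum, ← Finset.mul_sum]
    refine mul_le_of_le_one_right hC ?_
    have h5 : ∑ g ∈ T, (if g ∈ S n then 0 else ‖x g‖ * Λ (L g)) =
        ∑ g ∈ T \ S n, ‖x g‖ * Λ (L g) := by
      rw [← Finset.filter_notMem_eq_sdiff, Finset.sum_filter]
      exact Finset.sum_congr rfl fun g _ => by split_ifs <;> rfl
    rw [h5]
    exact hS n _ Finset.sdiff_disjoint
  refine (hl _ hbd).subset ?_
  rintro _ ⟨n, rfl⟩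
  exact ⟨_, ⟨n, rfl⟩, by rw [map_smul, hlz]⟩

/-- A bounded multilinear map which vanishes on the group vanishes. -/
theorem eq_zero_of_restrict_eq_zero (hF : B.IsFrechet) (hm : B.Multiplicative) {n : ℕ}
    {c : (Fin n → HAlg B L) → V} (hc : c ∈ boundedCochains B L V n)
    (h0 : restrict (HAlg.of (B := B) (L := L)) n c = 0) : c = 0 := by
  rw [mem_boundedCochains_iff] at hc
  -- Group elements are replaced by arbitrary elements of the algebra one slot at a time; the slots
  -- of index at least `k` still contain group elements.
  have key : ∀ k : ℕ, ∀ m : Fin n → HAlg B L,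
      (∀ i : Fin n, k ≤ i → ∃ g, m i = HAlg.of g) → c m = 0 := by
    intro k
    induction k with
    | zero =>
      intro m h
      choose g hg using fun i => h i (Nat.zero_le _)
      rw [funext hg]
      exact congrFun h0 g
    | succ k ih =>
      intro m h
      by_cases hk : k < n
      · have h1 := eq_zero_of_forall_of hF hm (IsLinearMap.mk' _ (hc.1 m ⟨k, hk⟩))
          (hc.2.comp (IsBoundedMap.pi fun i => ?_)) (fun g => ?_) (m ⟨k, hk⟩)
        · simpa using h1
        · by_cases hi : i = ⟨k, hk⟩
          · subst hi
            simpa using IsBoundedMap.self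
          · simpa [Function.update_of_ne hi] using IsBoundedMap.const (m i)
        · refine ih _ fun i hi => ?_
          by_cases hik : i = ⟨k, hk⟩
          · subst hik
            exact ⟨g, by simp⟩
          · rw [Function.update_of_ne hik]
            exact h i (Nat.lt_of_le_of_ne hi fun h' => hik (Fin.ext h'.symm))
      · exact ih m fun i hi => absurd (hi.trans_lt i.2) hk
  funext m
  exact key n m fun i hi => absurd i.2 hi.not_gt

/-- Deduced from the two-sided case with second variable in `H`: multiply by the augmentation, apply
`bar`, and evaluate at `1`. -/
theorem barD_mem_boundedCochains {n : ℕ} {c : (Fin n → HAlg B L) → V}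
    (hc : c ∈ boundedCochains B L V n) :
    barD (actH B L V) HAlg.aug n c ∈ boundedCochains B L V (n + 1) := by
  have h1 := bar_mem_boundedBicochains HAlg.isBoundedMap_mul
    (augment_mem_boundedBicochains hc (HAlg.augₗ (B := B) (L := L)) HAlg.isBoundedMap_aug)
  have h2 : bar (actH B L V) (fun x (y : HAlg B L) => x * y) n (augment HAlg.augₗ n c) =
      augment HAlg.augₗ (n + 1) (barD (actH B L V) HAlg.aug n c) :=
    bar_augment (e := HAlg.augₗ (B := B) (L := L)) (fun x y => HAlg.aug_mul x y) n c
  have h3 := apply_mem_boundedCochains h1 (1 : HAlg B L)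
  have h4 : HAlg.aug (1 : HAlg B L) = 1 := by
    rw [← map_one (HAlg.of (B := B) (L := L)), HAlg.aug_of]
  have h5 : (fun m => augment HAlg.augₗ (n + 1) (barD (actH B L V) HAlg.aug n c) m (1 : HAlg B L)) =
      barD (actH B L V) HAlg.aug n c := by
    funext m
    change HAlg.aug (1 : HAlg B L) • barD (actH B L V) HAlg.aug n c m = _
    rw [h4, one_smul]
  rw [← h5, ← h2]
  exact h3

theorem mem_weightedCochains_iff {n : ℕ} {f : (Fin n → G) → V} :
    f ∈ weightedCochains B L V n ↔ ∀ K : Set ((G × (Fin n → G)) →₀ ℂ),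
      (∀ h ∈ B.carrier, ∃ R : ℝ, ∀ x ∈ K, wnorm (weightEG L n) h x ≤ R) →
        Bornology.IsBounded (evalEG B L V n f '' K) := Iff.rfl

theorem sum_le_wnorm {S : Type*} {w : S → ℝ≥0} {f : ℝ≥0 → ℝ} (x : S →₀ ℂ) :
    ∑ s ∈ x.support, ‖x s‖ * f (w s) ≤ wnorm w f x := by
  refine le_of_eq (tsum_eq_sum fun s hs => ?_).symm
  rw [Finsupp.notMem_support_iff.1 hs, norm_zero, zero_mul]

/-- The restriction of a bounded cochain is a weighted cochain. -/
theorem restrict_mem_weightedCochains (hF : B.IsFrechet) (hm : B.Multiplicative) {n : ℕ}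
    {c : (Fin n → HAlg B L) → V} (hc : c ∈ boundedCochains B L V n) :
    restrict (HAlg.of (B := B) (L := L)) n c ∈ weightedCochains B L V n := by
  rw [mem_weightedCochains_iff]
  intro K hK
  have hK' : ∀ f, ∃ R : ℝ, f ∈ B.carrier → ∀ x ∈ K, wnorm (weightEG L n) f x ≤ R := fun f => by
    by_cases hf : f ∈ B.carrier
    · obtain ⟨R, hR⟩ := hK f hf
      exact ⟨R, fun _ => hR⟩
    · exact ⟨0, fun h => absurd h hf⟩
  choose R hR using hK'
  -- The power `n + 1` is needed because a basis element has `n + 1` group entries, each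
  -- contributing a factor `Λ` of its length.
  obtain ⟨Λ, hmono, hpos, hdom, hsum⟩ :=
    BoundingClass.exists_dominating.{u} hF hm (Nat.succ_ne_zero n) R
  obtain ⟨⟨φ, rfl⟩, hcb⟩ := hc
  -- Group elements rescaled by `Λ` form a bounded set, since `Λ` dominates every weight. One disc
  -- therefore contains all rescaled values, and undoing the scaling costs at most `Λ (weight) ^ (n
  -- + 1)`, which is summable on `K`.
  let a : G → HAlg B L := fun g => ((Λ (L g) : ℝ) : ℂ)⁻¹ • HAlg.of g
  have hA : Bornology.IsBounded (Set.range a) := by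
    rw [WL1.isBounded_iff]
    intro f hf
    obtain ⟨C, hC, hfC⟩ := hdom f hf
    refine ⟨C, ?_⟩
    rintro _ ⟨g, rfl⟩
    rw [HAlg.wnorm_smul_of, norm_inv, Complex.norm_real, Real.norm_of_nonneg (hpos _).le,
      inv_mul_le_iff₀ (hpos _), mul_comm]
    exact hfC _
  have hT : Bornology.IsBounded ((fun z : HAlg B L × (Fin n → HAlg B L) => z.1 • φ z.2) ''
      (Set.range a ×ˢ Set.univ.pi fun _ => Set.range a)) :=
    IsBoundedMap.smul IsBoundedMap.fst (hcb.comp IsBoundedMap.snd) _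
      (hA.prod (Bornology.IsBounded.pi fun _ => hA))
  obtain ⟨E, _, _, _, i, -, hb, hsub⟩ := CompleteBornological.exists_disc _ hT
  have hy : ∀ s : G × (Fin n → G), ∃ y : E,
      i y = actG B L V s.1 (restrict (HAlg.of (B := B) (L := L)) n φ s.2) ∧
        ‖y‖ ≤ Λ (weightEG L n s) ^ (n + 1) := by
    rintro ⟨g, h⟩
    obtain ⟨e, he, hie⟩ := hsub ⟨(a g, fun k => a (h k)),
      ⟨⟨g, rfl⟩, fun k _ => ⟨h k, rfl⟩⟩, rfl⟩
    rw [mem_closedBall_zero_iff] at he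
    let p : ℝ := Λ (L g) * ∏ k, Λ (L (h k))
    have hp : 0 < p := mul_pos (hpos _) (Finset.prod_pos fun k _ => hpos _)
    have hie' : i e = ((p : ℝ) : ℂ)⁻¹ • actG B L V g (φ fun k => HAlg.of (h k)) := by
      rw [hie]
      simp only [a]
      rw [φ.map_smul_univ]
      change _ = _ • (HAlg.of g : HAlg B L) • (φ fun k => HAlg.of (h k) : V)
      rw [smul_assoc, smul_algebra_smul_comm, smul_smul]
      congr 1
      simp only [p]
      push_cast
      rw [mul_inv, Finset.prod_inv_distrib]
    refine ⟨(p : ℂ) • e, ?_, ?_⟩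
    · rw [map_smul, hie', smul_inv_smul₀ (by exact_mod_cast hp.ne')]
      rfl
    · rw [norm_smul, Complex.norm_real, Real.norm_of_nonneg hp.le, pow_succ']
      refine (mul_le_of_le_one_right hp.le he).trans ?_
      refine mul_le_mul (hmono le_self_add) ?_ (Finset.prod_nonneg fun k _ => (hpos _).le)
        (hpos _).le
      refine (Finset.prod_le_prod (fun k _ => (hpos _).le) fun k _ => hmono ?_).trans_eq
        (by rw [Finset.prod_const, Finset.card_univ, Fintype.card_fin])
      exact (Finset.single_le_sum (f := fun k => L (h k)) (fun _ _ => zero_le)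
        (Finset.mem_univ k)).trans le_add_self
  choose y hiy hny using hy
  refine (hb 1).subset ?_
  rintro _ ⟨x, hx, rfl⟩
  refine ⟨∑ s ∈ x.support, x s • y s, ?_, ?_⟩
  · rw [mem_closedBall_zero_iff]
    refine (norm_sum_le _ _).trans ((Finset.sum_le_sum fun s _ => ?_).trans
      (hsum (weightEG L n) (fun s => ‖x s‖) x.support fun f hf =>
        (sum_le_wnorm x).trans (hR f hf x hx)))
    rw [norm_smul]
    exact mul_le_mul_of_nonneg_left (hny s) (norm_nonneg _)
  · simp only [map_sum, map_smul, hiy]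
    rfl

/-- The total weight is at most `n` times the largest length plus `L 1`, so a single factor controls
it; the other factors are at least `1`. The constant `F (L 1) + 1` covers `n = 0`, where the product
is empty. -/
theorem exists_prod_weight {F : ℝ≥0 → ℝ} (hF : F ∈ B.carrier) (L : LengthFunction G) (n : ℕ) :
    ∃ F' ∈ B.carrier, ∃ C : ℝ, 0 ≤ C ∧
      ∀ h : Fin n → G, F (weightEG L n (1, h)) ≤ C * ∏ i, F' (L (h i)) := by
  obtain ⟨F₁, hF₁, h1⟩ := B.exists_dilate hF n (L 1)
  obtain ⟨F', hF', h2⟩ := B.exists_mul_add hF₁ B.one_mem 0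
  have hC := B.pos F hF (L 1)
  refine ⟨F', hF', F (L 1) + 1, by linarith, fun h => ?_⟩
  have hone : ∀ T : Finset (Fin n), 1 ≤ ∏ i ∈ T, F' (L (h i)) := fun T => by
    have := Finset.prod_le_prod (s := T) (f := fun _ => (1 : ℝ)) (fun _ _ => zero_le_one)
      fun i _ => (h2 (L (h i))).2.1
    simpa using this
  rcases isEmpty_or_nonempty (Fin n) with hn | hn
  · have : weightEG L n (1, h) = L 1 := by simp [weightEG]
    rw [this]
    nlinarith [hone Finset.univ]
  · obtain ⟨i, hi⟩ := Finite.exists_max fun i => L (h i)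
    have h3 : F (weightEG L n (1, h)) ≤ F' (L (h i)) := by
      refine (B.mono F hF ?_).trans ((h1 (L (h i))).trans (h2 _).1)
      rw [weightEG, add_comm]
      refine add_le_add_left ?_ _
      simpa using Finset.sum_le_card_nsmul Finset.univ _ _ fun k _ => hi k
    have h4 : F' (L (h i)) ≤ ∏ k, F' (L (h k)) := by
      rw [← Finset.mul_prod_erase _ _ (Finset.mem_univ i)]
      exact le_mul_of_one_le_right (B.pos F' hF' _).le (hone _)
    nlinarith [hone Finset.univ]

theorem sum_prod_le_prod_wnorm {F : ℝ≥0 → ℝ} (hF : F ∈ B.carrier) {n : ℕ} (x : Fin n → HAlg B L)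
    (T : Finset (Fin n → G)) :
    ∑ h ∈ T, ∏ i, (‖x i (h i)‖ * F (L (h i))) ≤ ∏ i, wnorm L F (x i) := by
  classical
  have h1 : T ⊆ Fintype.piFinset fun i => T.image fun h => h i := fun h hh =>
    Fintype.mem_piFinset.2 fun i => Finset.mem_image_of_mem _ hh
  refine (Finset.sum_le_sum_of_subset_of_nonneg h1 fun h _ _ =>
    Finset.prod_nonneg fun i _ => (x i).term_nonneg hF _).trans ?_
  rw [← Finset.prod_univ_sum (fun i => T.image fun h => h i)
    (fun i g => ‖x i g‖ * F (L g))]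
  exact Finset.prod_le_prod (fun i _ => Finset.sum_nonneg fun g _ => (x i).term_nonneg hF g)
    fun i _ => ((x i).summable hF).sum_le_tsum _ fun g _ => (x i).term_nonneg hF g

/-- The values of a weighted cochain, multiplied with the coefficients of the elements of a bounded
set, are summable in a common disc. -/
theorem exists_summable_disc (hF : B.IsFrechet) (hm : B.Multiplicative) {n : ℕ}
    {f : (Fin n → G) → V} (hf : f ∈ weightedCochains B L V n) {A : Set (Fin n → HAlg B L)}
    (hA : Bornology.IsBounded A) :
    ∃ (E : Type v) (_ : NormedAddCommGroup E) (_ : NormedSpace ℂ E) (_ : CompleteSpace E)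
      (i : E →ₗ[ℂ] V), Bornology.IsBounded (i '' Metric.closedBall 0 1) ∧ ∀ x ∈ A,
        ∃ η : (Fin n → G) → E, (∀ h, i (η h) = (∏ k, x k (h k)) • f h) ∧
          (Summable fun h => ‖η h‖) ∧ ‖∑' h, η h‖ ≤ 1 := by
  have hR : ∀ F, ∃ R : ℝ, F ∈ B.carrier → ∀ x ∈ A, ∀ T : Finset (Fin n → G),
      ∑ h ∈ T, (∏ k, ‖x k (h k)‖) * F (weightEG L n (1, h)) ≤ R := fun F => by
    by_cases hFB : F ∈ B.carrier
    · obtain ⟨F', hF', C, hC, hle⟩ := exists_prod_weight hFB L n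
      choose M hM using fun k => WL1.isBounded_iff.1
        ((Bornology.forall_isBounded_image_eval_iff.2 hA) k) F' hF'
      refine ⟨C * ∏ k, M k, fun _ x hx T => ?_⟩
      calc ∑ h ∈ T, (∏ k, ‖x k (h k)‖) * F (weightEG L n (1, h))
          ≤ ∑ h ∈ T, C * ∏ k, (‖x k (h k)‖ * F' (L (h k))) := by
            refine Finset.sum_le_sum fun h _ => ?_
            refine (mul_le_mul_of_nonneg_left (hle h)
              (Finset.prod_nonneg fun k _ => norm_nonneg _)).trans_eq ?_
            rw [Finset.prod_mul_distrib]
            ring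
        _ ≤ C * ∏ k, M k := by
            rw [← Finset.mul_sum]
            refine mul_le_mul_of_nonneg_left ((sum_prod_le_prod_wnorm hF' x T).trans ?_) hC
            exact Finset.prod_le_prod (fun k _ => WL1.wnorm_nonneg hF' _)
              fun k _ => hM k _ ⟨x, hx, rfl⟩
    · exact ⟨0, fun h => absurd h hFB⟩
  choose R hR using hR
  obtain ⟨Λ, -, hpos, hdom, hsum⟩ := BoundingClass.exists_dominating.{u} hF hm one_ne_zero R
  let w : (Fin n → G) → ℝ≥0 := fun h => weightEG L n (1, h)
  -- The basis chains rescaled by `Λ` are bounded, so the values `f h / Λ` lie in the unit ball of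
  -- one disc. The coefficients times `Λ` have `ℓ¹`-norm at most `1`, uniformly over `A`.
  let K : Set ((G × (Fin n → G)) →₀ ℂ) :=
    Set.range fun h => Finsupp.single (1, h) ((Λ (w h) : ℝ) : ℂ)⁻¹
  have hK : Bornology.IsBounded (evalEG B L V n f '' K) := by
    refine mem_weightedCochains_iff.1 hf K fun F hFB => ?_
    obtain ⟨C, hC, hFC⟩ := hdom F hFB
    refine ⟨C, ?_⟩
    rintro _ ⟨h, rfl⟩
    rw [wnorm, tsum_eq_single (1, h)]
    · rw [Finsupp.single_eq_same, norm_inv, Complex.norm_real, Real.norm_of_nonneg (hpos _).le,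
        inv_mul_le_iff₀ (hpos _), mul_comm]
      exact hFC _
    · intro s hs
      rw [Finsupp.single_eq_of_ne hs, norm_zero, zero_mul]
  obtain ⟨E, _, _, _, i, -, hb, hsub⟩ := CompleteBornological.exists_disc _ hK
  have he : ∀ h, ∃ e : E, ‖e‖ ≤ 1 ∧ i e = ((Λ (w h) : ℝ) : ℂ)⁻¹ • f h := fun h => by
    obtain ⟨e, he, hie⟩ := hsub ⟨_, ⟨h, rfl⟩, rfl⟩
    refine ⟨e, mem_closedBall_zero_iff.1 he, ?_⟩
    have h1 : actG B L V (1 : G) (f h) = f h := by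
      change (HAlg.of (1 : G) : HAlg B L) • f h = f h
      rw [map_one, one_smul]
    rw [hie, evalEG, Finsupp.sum_single_index (by simp), h1]
  choose e hen hie using he
  refine ⟨E, _, _, ‹_›, i, hb 1, fun x hx => ?_⟩
  let η : (Fin n → G) → E := fun h => ((∏ k, x k (h k)) * ((Λ (w h) : ℝ) : ℂ)) • e h
  have hη : ∀ h, ‖η h‖ ≤ (∏ k, ‖x k (h k)‖) * Λ (w h) := fun h => by
    rw [norm_smul, norm_mul, norm_prod, Complex.norm_real, Real.norm_of_nonneg (hpos _).le]
    exact mul_le_of_le_one_right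
      (mul_nonneg (Finset.prod_nonneg fun _ _ => norm_nonneg _) (hpos _).le) (hen h)
  have hsumη : ∀ T : Finset (Fin n → G), ∑ h ∈ T, ‖η h‖ ≤ 1 := fun T => by
    refine (Finset.sum_le_sum fun h _ => hη h).trans ?_
    simpa using hsum w (fun h => ∏ k, ‖x k (h k)‖) T fun F hFB => hR F hFB x hx T
  have hs : Summable fun h => ‖η h‖ := summable_of_sum_le (fun _ => norm_nonneg _) hsumη
  refine ⟨η, fun h => ?_, hs, ?_⟩
  · rw [map_smul, hie, smul_smul, mul_assoc,
      mul_inv_cancel₀ (by exact_mod_cast (hpos _).ne'), mul_one]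
  · exact (norm_tsum_le_tsum_norm hs).trans
      (Real.tsum_le_of_sum_le (fun _ => norm_nonneg _) hsumη)

theorem BornHasSum.single {V : Type v} [AddCommGroup V] [Module ℂ V] [Bornology V]
    [CompleteBornological V] {ι : Type*} {a : ι → V} (s : ι) (ha : ∀ t, t ≠ s → a t = 0) :
    BornHasSum a (a s) := by
  classical
  obtain ⟨E, _, _, _, i, -, hb, hsub⟩ := CompleteBornological.exists_disc {a s}
    Bornology.isBounded_singleton
  obtain ⟨e, -, he⟩ := hsub rfl
  have h0 : ∀ t, t ≠ s → (Pi.single s e : ι → E) t = 0 := fun t ht => Pi.single_eq_of_ne ht _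
  refine ⟨E, _, _, ‹_›, i, Pi.single s e, hb 1, fun t => ?_, ?_, ?_⟩
  · by_cases ht : t = s
    · subst ht; rw [Pi.single_eq_same, he]
    · rw [h0 t ht, map_zero, ha t ht]
  · refine summable_of_ne_finset_zero (s := {s}) fun t ht => ?_
    rw [h0 t (by simpa using ht), norm_zero]
  · rw [tsum_eq_single s h0, Pi.single_eq_same, he]

theorem prod_update_apply {n : ℕ} (m : Fin n → HAlg B L) (i : Fin n) (x : HAlg B L)
    (h : Fin n → G) : ∏ k, (Function.update m i x k) (h k) =
      x (h i) * ∏ k ∈ Finset.univ.erase i, m k (h k) := by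
  rw [← Finset.mul_prod_erase _ _ (Finset.mem_univ i), Function.update_self]
  congr 1
  refine Finset.prod_congr rfl fun k hk => ?_
  rw [Function.update_of_ne (Finset.ne_of_mem_erase hk)]

/-- Every weighted cochain extends to a bounded cochain. -/
theorem exists_restrict_eq (hF : B.IsFrechet) (hm : B.Multiplicative) {n : ℕ}
    {f : (Fin n → G) → V} (hf : f ∈ weightedCochains B L V n) :
    ∃ c ∈ boundedCochains B L V n, restrict (HAlg.of (B := B) (L := L)) n c = f := by
  -- The extension is `∑ (∏ x k (h k)) • f h`, summed in a disc that may depend on `x`. Uniqueness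
  -- of sums makes it multilinear and allows a common disc to be used on bounded sets.
  have hex : ∀ x : Fin n → HAlg B L, ∃ v, BornHasSum (fun h => (∏ k, x k (h k)) • f h) v := by
    intro x
    obtain ⟨E, _, _, _, i, hb, hη⟩ := exists_summable_disc hF hm hf
      (Bornology.isBounded_singleton (x := x))
    obtain ⟨η, h1, h2, -⟩ := hη x rfl
    exact ⟨_, E, _, _, ‹_›, i, η, hb, h1, h2, rfl⟩
  choose c hc using hex
  refine ⟨c, mem_boundedCochains_iff.2 ⟨fun m i => ⟨fun x y => ?_, fun a x => ?_⟩,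
    fun A hA => ?_⟩, ?_⟩
  · refine (hc _).unique ?_
    have := (hc (Function.update m i x)).add (hc (Function.update m i y))
    simpa only [prod_update_apply, WL1.add_apply, add_mul, add_smul] using this
  · refine (hc _).unique ?_
    have := (hc (Function.update m i x)).smul a
    simpa only [prod_update_apply, WL1.smul_apply, mul_assoc, mul_smul] using this
  · obtain ⟨E, _, _, _, i, hb, hη⟩ := exists_summable_disc hF hm hf hA
    refine hb.subset ?_
    rintro _ ⟨x, hx, rfl⟩
    obtain ⟨η, h1, h2, h3⟩ := hη x hx
    refine ⟨∑' h, η h, mem_closedBall_zero_iff.2 h3, ?_⟩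
    exact BornHasSum.unique ⟨E, _, _, ‹_›, i, η, hb, h1, h2, rfl⟩ (hc x)
  · funext g
    have h1 : ∀ h, h ≠ g → (∏ k, (HAlg.of (g k) : HAlg B L) (h k)) • f h = 0 := fun h hh => by
      obtain ⟨k, hk⟩ := Function.ne_iff.1 hh
      have : (HAlg.of (g k) : HAlg B L) (h k) = 0 := WL1.delta_apply_ne hk
      rw [Finset.prod_eq_zero (Finset.mem_univ k) this, zero_smul]
    have h2 : (∏ k, (HAlg.of (g k) : HAlg B L) (g k)) • f g = f g := by
      have h4 : ∀ k, (HAlg.of (g k) : HAlg B L) (g k) = 1 := fun k => WL1.delta_apply_self (g k)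
      rw [Finset.prod_eq_one fun k _ => h4 k, one_smul]
    have h3 := (hc fun k => HAlg.of (g k)).unique (BornHasSum.single g h1)
    exact h3.trans h2

end Weighted

/-! ### The weighted comparison map. -/

section WeightedComparison

variable {B : BoundingClass} {G : Type u} [Group G] {L : LengthFunction G}
variable (V : Type v) [AddCommGroup V] [Module ℂ V] [Bornology V] [Module (HAlg B L) V]
  [BornologicalModule (HAlg B L) V]

theorem barD_restrict_of {n : ℕ} (c : (Fin n → HAlg B L) → V) :
    barD (actG B L V) (fun _ => 1) n (restrict (HAlg.of (B := B) (L := L)) n c) =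
      restrict (HAlg.of (B := B) (L := L)) (n + 1) (barD (actH B L V) HAlg.aug n c) :=
  barD_restrict _ (map_mul _) (fun _ => rfl) HAlg.aug_of n c

variable {V}

/-- The differential of a bounded extension is bounded and vanishes on the group, hence vanishes; so
the extension of a cocycle is a cocycle. -/
theorem exists_cocycle_restrict_eq (hF : B.IsFrechet) (hm : B.Multiplicative) {n : ℕ}
    {f : (Fin n → G) → V}
    (hf : f ∈ cocycles (actG B L V) (fun _ => 1) (weightedCochains B L V) n) :
    ∃ c ∈ cocycles (actH B L V) HAlg.aug (boundedCochains B L V) n,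
      restrict (HAlg.of (B := B) (L := L)) n c = f := by
  obtain ⟨c, hc, rfl⟩ := exists_restrict_eq hF hm hf.1
  refine ⟨c, ⟨hc, ?_⟩, rfl⟩
  refine eq_zero_of_restrict_eq_zero hF hm (barD_mem_boundedCochains hc) ?_
  rw [← barD_restrict_of]
  exact hf.2

variable (V)

theorem comparisonMap_surjective_of_weighted (hF : B.IsFrechet) (hm : B.Multiplicative) {n : ℕ}
    (h : Function.Surjective (weightedComparisonMap B L V n)) :
    Function.Surjective (comparisonMap B L V n) := by
  refine (comparison_surjective_iff _ _ _ _ _ _).2 fun f hf => ?_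
  rw [weightedComparisonMap, comparison_surjective_iff] at h
  obtain ⟨f', hf', h1⟩ := h f hf
  obtain ⟨c, hc, rfl⟩ := exists_cocycle_restrict_eq hF hm hf'
  exact ⟨c, hc, h1⟩

theorem weightedComparisonMap_surjective (hF : B.IsFrechet) (hm : B.Multiplicative) {n : ℕ}
    (h : Function.Surjective (comparisonMap B L V n)) :
    Function.Surjective (weightedComparisonMap B L V n) := by
  rw [weightedComparisonMap, comparison_surjective_iff]
  replace h := (comparison_surjective_iff _ _ _ _ _ _).1 h
  intro f hf
  obtain ⟨c, hc, h1⟩ := h f hf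
  refine ⟨restrict (HAlg.of (B := B) (L := L)) n c,
    ⟨restrict_mem_weightedCochains hF hm hc.1, ?_⟩, h1⟩
  have h2 : barD (actH B L V) HAlg.aug n c = 0 := hc.2
  refine (barD_restrict_of V c).trans ?_
  rw [h2, map_zero]

theorem weightedComparisonMap_injective (hF : B.IsFrechet) (hm : B.Multiplicative) {n : ℕ}
    (h : Function.Injective (comparisonMap B L V n)) :
    Function.Injective (weightedComparisonMap B L V n) := by
  rw [weightedComparisonMap, comparison_injective_iff]
  replace h := (comparison_injective_iff _ _ _ _ _ _).1 h
  intro f hf h1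
  obtain ⟨c, hc, rfl⟩ := exists_cocycle_restrict_eq hF hm hf
  have h2 := h c hc h1
  cases n with
  | zero =>
    have h3 : c = 0 := h2
    rw [h3, map_zero]
    exact Submodule.zero_mem _
  | succ n =>
    obtain ⟨b, hb, rfl⟩ := h2
    exact ⟨_, restrict_mem_weightedCochains hF hm hb, barD_restrict_of V b⟩

end WeightedComparison

/-- Restriction identifies the bounded and the weighted cocycles and maps bounded coboundaries to
weighted ones, over the same group cohomology. The first equivalence therefore transfers. -/
theorem weightedIsocohomological_tfae {G : Type u} [Group G] (L : LengthFunction G)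
    (B : BoundingClass) (hG : TypeFPInfty G) (hm : B.Multiplicative) (hF : B.IsFrechet) :
    [WeightedStronglyIsocohomological.{u, v} B L, WeightedComparisonSurjective.{u, v} B L,
      TypeBFPInfty B L].TFAE := by
  tfae_have 1 → 2 := fun h V _ _ _ _ _ n => (h V n).2
  tfae_have 2 → 3 := fun h => ComparisonSurjective.typeBFPInfty.{u, v}
    (fun V _ _ _ _ _ n => comparisonMap_surjective_of_weighted V hF hm (h V n)) hG
  tfae_have 3 → 1 := fun h V _ _ _ _ _ n =>
    have h' := h.stronglyIsocohomological.{u, v} V n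
    ⟨weightedComparisonMap_injective V hF hm h'.1, weightedComparisonMap_surjective V hF hm h'.2⟩
  tfae_finish

end

theorem theorem3 {G : Type u} [Group G] (L : LengthFunction G) (B : BoundingClass)
    (hG : TypeFPInfty G) :
    [StronglyIsocohomological.{u, v} B L,
      ComparisonSurjective.{u, v} B L,
      TypeBFPInfty B L].TFAE ∧
    (B.Multiplicative → B.IsFrechet →
      [WeightedStronglyIsocohomological.{u, v} B L,
        WeightedComparisonSurjective.{u, v} B L,
        TypeBFPInfty B L].TFAE) :=
  ⟨isocohomological_tfae L B hG, weightedIsocohomological_tfae L B hG⟩
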